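/- **Lemma 3.3.** Let $N\in\mathbb N$, $\beta\ge 0$, $\mu>0$, $2\beta+\mu<N$ and $2\le p<N$. Put $p^*=\frac{Np}{N-p}$, $r=p^*_{\beta,\mu}=\frac{p(2N-2\beta-\mu)}{2(N-p)}$ and $$D^{1,p}(\mathbb R^N)=\Big\{u\in L^{p^*}(\mathbb R^N):\ \nabla u \text{ exists weakly},\ \int_{\mathbb R^N}|\nabla u|^p\,dx<\infty\Big\},\qquad \|u\|=\Big(\int_{\mathbb R^N}|\nabla u|^p\,dx\Big)^{1/p}.$$ For $u\in D^{1,p}(\mathbb R^N)$ write $$F_u(x)=\Big(\int_{\mathbb R^N}\frac{|u(y)|^{r}}{|y|^{\beta}|x-y|^{\mu}}\,dy\Big)\frac{|u(x)|^{r}}{|x|^{\beta}} .$$ Let $C=C(N,\beta,\mu)$ be the best constant in the doubly weighted Hardy–Littlewood–Sobolev inequality $$\int_{\mathbb R^N}\int_{\mathbb R^N}\frac{|f(x)||g(y)|}{|x|^{\beta}|x-y|^{\mu}|y|^{\beta}}\,dx\,dy\le C\,\|f\|_{L^t}\|g\|_{L^t},\qquad t=\frac{2N}{2N-2\beta-\mu},$$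 and let $$S=\inf_{u\in D^{1,p},\ \|u\|_{L^{p^*}}=1}\int_{\mathbb R^N}|\nabla u|^p\,dx,\qquad S_{\beta,\mu}=\inf_{u\in D^{1,p}\setminus\{0\}}\frac{\int_{\mathbb R^N}|\nabla u|^p\,dx}{\big(\int_{\mathbb R^N}F_u\,dx\big)^{p/(2r)}} .$$ A sequence of nonnegative functions $f_n$ is said to converge to a Borel measure $m$ in the sense of measures if $\int\varphi f_n\,dx\to\int\varphi\,dm$ for every continuous $\varphi$ with compact support. Let $(u_n)$ be a bounded sequence in $D^{1,p}(\mathbb R^N)$ that converges weakly in $D^{1,p}(\mathbb R^N)$ and almost everywhere to some $u\in D^{1,p}(\mathbb R^N)$. Suppose that $|u_n|^{p^*}\rightharpoonup\omega$, $|\nabla u_n|^p\rightharpoonup\nu$ and $F_{u_n}\rightharpoonup\zeta$ in the sense of measures, where $\omega,\nu,\zeta$ are finite nonnegative Borel measures on $\mathbb R^N$, and define $$\nu_\infty=\lim_{R\to\infty}\limsup_{n\to\infty}\int_{|x|\ge R}|\nabla u_n|^p\,dx,\quad \omega_\infty=\lim_{R\to\infty}\limsup_{n\to\infty}\int_{|x|\ge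 R}|u_n|^{p^*}dx,\quad \zeta_\infty=\lim_{R\to\infty}\limsup_{n\to\infty}\int_{|x|\ge R}F_{u_n}\,dx .$$ Then $C<\infty$, and there are an at most countable set $J$, distinct points $z_j\in\mathbb R^N$ and numbers $\omega_j,\zeta_j,\nu_j>0$ $(j\in J)$ such that $$\zeta=F_u\,dx+\sum_{j\in J}\zeta_j\delta_{z_j},\qquad \sum_{j\in J}\zeta_j^{\frac{p}{2r}}<\infty,$$ $$\nu\ge|\nabla u|^p\,dx+\sum_{j\in J}\nu_j\delta_{z_j},\qquad \omega\ge|u|^{p^*}dx+\sum_{j\in J}\omega_j\delta_{z_j},$$ and, for every $j\in J$, $$S_{\beta,\mu}\,\zeta_j^{\frac{p}{2r}}\le\nu_j,\qquad \zeta_j^{\frac{N}{2N-2\beta-\mu}}\le C^{\frac{N}{2N-2\beta-\mu}}\,\omega_j .$$ Moreover, $$\limsup_{n\to\infty}\int_{\mathbb R^N}|\nabla u_n|^p\,dx=\nu_\infty+\nu(\mathbb R^N),\qquad \limsup_{n\to\infty}\int_{\mathbb R^N}|u_n|^{p^*}dx=\omega_\infty+\omega(\mathbb R^N),$$ $$\limsup_{n\to\infty}\int_{\mathbb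 R^N}F_{u_n}\,dx=\zeta_\infty+\zeta(\mathbb R^N),$$ $$C^{-\frac{2N}{2N-2\beta-\mu}}\,\zeta_\infty^{\frac{2N}{2N-2\beta-\mu}}\le\omega_\infty\big(\omega(\mathbb R^N)+\omega_\infty\big),\qquad S^{2}\,C^{-\frac{p}{r}}\,\zeta_\infty^{\frac{p}{r}}\le\nu_\infty\big(\nu(\mathbb R^N)+\nu_\infty\big).$$ -/

import Mathlib

open MeasureTheory Filter Topology
open scoped ENNReal NNReal

noncomputable section

/-- The Euclidean space `ℝ^N`. -/
abbrev RN (N : ℕ) : Type := EuclideanSpace ℝ (Fin N)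

/-- The critical Sobolev exponent `p^* = N p / (N - p)`. -/
def sobolevExp (N : ℕ) (p : ℝ) : ℝ := N * p / (N - p)

/-- The upper critical Stein-Weiss exponent `p^*_{β,μ} = p (2N - 2β - μ) / (2 (N - p))`. -/
def steinWeissExp (N : ℕ) (p β μ : ℝ) : ℝ := p * (2 * N - 2 * β - μ) / (2 * (N - p))

/-- `G` is the weak (distributional) gradient of `u` on `ℝ^N`. -/
def IsWeakGradient {N : ℕ} (u : RN N → ℝ) (G : RN N → RN N) : Prop :=
  LocallyIntegrable u ∧ LocallyIntegrable G ∧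
    ∀ φ : RN N → ℝ, ContDiff ℝ (⊤ : ℕ∞) φ → HasCompactSupport φ → ∀ v : RN N,
      ∫ x, u x * fderiv ℝ φ x v = -∫ x, φ x * inner ℝ (G x) v

theorem IsWeakGradient.congr {N : ℕ} {u u' : RN N → ℝ} {G G' : RN N → RN N}
    (h : IsWeakGradient u G) (hu : u =ᵐ[volume] u') (hG : G =ᵐ[volume] G') :
    IsWeakGradient u' G' := by
  obtain ⟨h1, h2, h3⟩ := h
  refine ⟨h1.congr hu, h2.congr hG, fun φ hφ hc v => ?_⟩
  have e1 : ∫ x, u' x * fderiv ℝ φ x v = ∫ x, u x * fderiv ℝ φ x v :=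
    integral_congr_ae (hu.mono fun x hx => by simp only [hx])
  have e2 : ∫ x, φ x * inner ℝ (G' x) v = ∫ x, φ x * inner ℝ (G x) v :=
    integral_congr_ae (hG.mono fun x hx => by simp only [hx])
  rw [e1, e2]
  exact h3 φ hφ hc v

theorem IsWeakGradient.integrable_left {N : ℕ} {u : RN N → ℝ} (hu : LocallyIntegrable u)
    {φ : RN N → ℝ} (hφ : ContDiff ℝ (⊤ : ℕ∞) φ) (hc : HasCompactSupport φ) (v : RN N) :
    Integrable fun x => u x * fderiv ℝ φ x v := by
  have hcont : Continuous fun x => fderiv ℝ φ x v :=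
    (hφ.continuous_fderiv (by simp)).clm_apply continuous_const
  have hcs : HasCompactSupport fun x => fderiv ℝ φ x v :=
    (hc.fderiv (𝕜 := ℝ)).comp_left (g := fun L : RN N →L[ℝ] ℝ => L v) (by simp)
  exact hu.integrable_smul_right_of_hasCompactSupport hcont hcs

theorem IsWeakGradient.integrable_right {N : ℕ} {G : RN N → RN N} (hG : LocallyIntegrable G)
    {φ : RN N → ℝ} (hφ : ContDiff ℝ (⊤ : ℕ∞) φ) (hc : HasCompactSupport φ) (v : RN N) :
    Integrable fun x => φ x * inner ℝ (G x) v := by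
  have h := (hG.integrable_smul_left_of_hasCompactSupport hφ.continuous hc).inner_const (𝕜 := ℝ) v
  refine h.congr (ae_of_all _ fun x => ?_)
  simp [real_inner_smul_left]

theorem IsWeakGradient.add {N : ℕ} {u u' : RN N → ℝ} {G G' : RN N → RN N}
    (h : IsWeakGradient u G) (h' : IsWeakGradient u' G') :
    IsWeakGradient (u + u') (G + G') := by
  refine ⟨h.1.add h'.1, h.2.1.add h'.2.1, fun φ hφ hc v => ?_⟩
  simp only [Pi.add_apply, add_mul, inner_add_left, mul_add]
  rw [integral_add (integrable_left h.1 hφ hc v) (integrable_left h'.1 hφ hc v),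
    integral_add (integrable_right h.2.1 hφ hc v) (integrable_right h'.2.1 hφ hc v),
    h.2.2 φ hφ hc v, h'.2.2 φ hφ hc v]
  ring

theorem IsWeakGradient.const_smul {N : ℕ} {u : RN N → ℝ} {G : RN N → RN N}
    (h : IsWeakGradient u G) (c : ℝ) : IsWeakGradient (c • u) (c • G) := by
  refine ⟨h.1.smul c, h.2.1.smul c, fun φ hφ hc v => ?_⟩
  simp only [Pi.smul_apply, smul_eq_mul, real_inner_smul_left, mul_assoc, mul_left_comm (φ _) c]
  rw [integral_const_mul, integral_const_mul, h.2.2 φ hφ hc v]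
  ring

/-- The space `D^{1,p}(ℝ^N)`: the functions `u ∈ L^{p^*}` whose weak gradient exists and lies in
`L^p`. An element is stored as the pair `(u, ∇u)` of classes of functions. -/
def D1p (N : ℕ) (p : ℝ) : Submodule ℝ
    (Lp ℝ (ENNReal.ofReal (sobolevExp N p)) (volume : Measure (RN N)) ×
      Lp (RN N) (ENNReal.ofReal p) (volume : Measure (RN N))) where
  carrier := {w | IsWeakGradient (w.1 : RN N → ℝ) (w.2 : RN N → RN N)}
  zero_mem' := by
    have h0 : IsWeakGradient (0 : RN N → ℝ) (0 : RN N → RN N) :=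
      ⟨locallyIntegrable_zero, locallyIntegrable_zero, fun φ _ _ v => by simp⟩
    exact h0.congr (Lp.coeFn_zero _ _ _).symm (Lp.coeFn_zero _ _ _).symm
  add_mem' := fun {a b} ha hb =>
    (IsWeakGradient.add ha hb).congr (Lp.coeFn_add a.1 b.1).symm (Lp.coeFn_add a.2 b.2).symm
  smul_mem' := fun c a ha =>
    (IsWeakGradient.const_smul ha c).congr (Lp.coeFn_smul c a.1).symm (Lp.coeFn_smul c a.2).symm

/-- The function `u` of an element of `D^{1,p}(ℝ^N)`. -/
def D1p.fn {N : ℕ} {p : ℝ} (w : D1p N p) : RN N → ℝ := w.1.1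

/-- The weak gradient `∇u` of an element of `D^{1,p}(ℝ^N)`. -/
def D1p.grad {N : ℕ} {p : ℝ} (w : D1p N p) : RN N → RN N := w.1.2

/-- The norm `‖u‖ = (∫ |∇u|^p)^{1/p}` of `D^{1,p}(ℝ^N)`. -/
def D1p.gradNorm {N : ℕ} {p : ℝ} (w : D1p N p) : ℝ := ‖w.1.2‖

/-- Weak convergence in `D^{1,p}(ℝ^N)`: convergence under every linear functional that is bounded
for the norm `‖u‖ = (∫ |∇u|^p)^{1/p}`. -/
def D1p.WeakTendsto {N : ℕ} {p : ℝ} (u : ℕ → D1p N p) (w : D1p N p) : Prop :=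
  ∀ l : D1p N p →ₗ[ℝ] ℝ, (∃ K : ℝ, ∀ v, |l v| ≤ K * D1p.gradNorm v) →
    Tendsto (fun n => l (u n)) atTop (𝓝 (l w))

/-- `x ↦ ∫ f(y) / (|y|^β |x - y|^μ) dy`. -/
def weightedPotential {N : ℕ} (β μ : ℝ) (f : RN N → ℝ≥0∞) (x : RN N) : ℝ≥0∞ :=
  ∫⁻ y, f y / (‖y‖ₑ ^ β * ‖x - y‖ₑ ^ μ)

/-- `∫∫ f(x) g(y) / (|x|^β |x - y|^μ |y|^β) dy dx`. -/
def steinWeissForm {N : ℕ} (β μ : ℝ) (f g : RN N → ℝ≥0∞) : ℝ≥0∞ :=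
  ∫⁻ x, weightedPotential β μ g x * (f x / ‖x‖ₑ ^ β)

/-- The best constant `C(N,β,μ)` in the doubly weighted Hardy-Littlewood-Sobolev inequality
`∫∫ |f(x)| |g(y)| / (|x|^β |x - y|^μ |y|^β) dx dy ≤ C ‖f‖_t ‖g‖_t` with
`t = 2N / (2N - 2β - μ)`. -/
def steinWeissConst (N : ℕ) (β μ : ℝ) : ℝ≥0∞ :=
  sInf {C : ℝ≥0∞ | ∀ f g : RN N → ℝ,
    MemLp f (ENNReal.ofReal (2 * N / (2 * N - 2 * β - μ))) volume →
    MemLp g (ENNReal.ofReal (2 * N / (2 * N - 2 * β - μ))) volume →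
    steinWeissForm β μ (fun x => ‖f x‖ₑ) (fun y => ‖g y‖ₑ) ≤
      C * eLpNorm f (ENNReal.ofReal (2 * N / (2 * N - 2 * β - μ))) volume *
        eLpNorm g (ENNReal.ofReal (2 * N / (2 * N - 2 * β - μ))) volume}

/-- The density `|∇u|^p`. -/
def gradDensity {N : ℕ} {p : ℝ} (w : D1p N p) (x : RN N) : ℝ≥0∞ := ‖D1p.grad w x‖ₑ ^ p

/-- The density `|u|^{p^*}`. -/
def sobolevDensity {N : ℕ} {p : ℝ} (w : D1p N p) (x : RN N) : ℝ≥0∞ :=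
  ‖D1p.fn w x‖ₑ ^ sobolevExp N p

/-- The density
`(∫ |u(y)|^{p^*_{β,μ}} / (|y|^β |x - y|^μ) dy) |u(x)|^{p^*_{β,μ}} / |x|^β`. -/
def steinWeissDensity {N : ℕ} {p : ℝ} (β μ : ℝ) (w : D1p N p) (x : RN N) : ℝ≥0∞ :=
  weightedPotential β μ (fun y => ‖D1p.fn w y‖ₑ ^ steinWeissExp N p β μ) x *
    (‖D1p.fn w x‖ₑ ^ steinWeissExp N p β μ / ‖x‖ₑ ^ β)

/-- The best Sobolev constant `S = inf {∫ |∇u|^p : u ∈ D^{1,p}, ‖u‖_{p^*} = 1}`. -/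
def sobolevConst (N : ℕ) (p : ℝ) : ℝ≥0∞ :=
  ⨅ (w : D1p N p)
    (_ : eLpNorm (D1p.fn w) (ENNReal.ofReal (sobolevExp N p)) volume = 1),
    ∫⁻ x, gradDensity w x

/-- The best constant `S_{β,μ}`: the infimum over `u ∈ D^{1,p}`, `u ≠ 0`, of
`∫ |∇u|^p` divided by
`(∫∫ |u(x)|^{p^*_{β,μ}} |u(y)|^{p^*_{β,μ}} / (|x|^β |x - y|^μ |y|^β))^{p / (2 p^*_{β,μ})}`. -/
def steinWeissSobolevConst (N : ℕ) (p β μ : ℝ) : ℝ≥0∞ :=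
  ⨅ (w : D1p N p) (_ : w.1.1 ≠ 0),
    (∫⁻ x, gradDensity w x) /
      (∫⁻ x, steinWeissDensity β μ w x) ^ (p / (2 * steinWeissExp N p β μ))

/-- `f_n dx ⇀ m` weakly in the sense of measures: `∫ φ f_n dx → ∫ φ dm` for every continuous `φ`
with compact support. -/
def TendstoMeasure {N : ℕ} (f : ℕ → RN N → ℝ≥0∞) (m : Measure (RN N)) : Prop :=
  ∀ φ : RN N → ℝ, Continuous φ → HasCompactSupport φ →
    Tendsto (fun n => ∫ x, φ x ∂(volume.withDensity (f n))) atTop (𝓝 (∫ x, φ x ∂m))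

/-- The mass at infinity `lim_{R → ∞} limsup_{n → ∞} ∫_{|x| ≥ R} f_n dx`. The inner quantity
decreases in `R`, so the limit is an infimum; see `tendsto_massAtInfinity`. -/
def massAtInfinity {N : ℕ} (f : ℕ → RN N → ℝ≥0∞) : ℝ≥0∞ :=
  ⨅ R : ℝ, limsup (fun n => ∫⁻ x in {x : RN N | R ≤ ‖x‖}, f n x) atTop

theorem tendsto_massAtInfinity {N : ℕ} (f : ℕ → RN N → ℝ≥0∞) :
    Tendsto (fun R : ℝ => limsup (fun n => ∫⁻ x in {x : RN N | R ≤ ‖x‖}, f n x) atTop) atTop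
      (𝓝 (massAtInfinity f)) := by
  refine tendsto_atTop_iInf fun R R' h => ?_
  exact limsup_le_limsup (Eventually.of_forall fun n =>
    lintegral_mono_set fun x (hx : R' ≤ ‖x‖) => h.trans hx)

end

noncomputable section

/-! ### Powers in `ℝ≥0∞` and radial integrals -/

/-! Write `f n = |u_n|^r`, `f' = |u|^r` and let `B` be `steinWeissForm`, a positive bilinear form.
Since `r t = p^*`, `f n` is bounded in `L^t`, and everything about `ζ` is a statement on `B (φ f n)
(f n)` for cutoffs `φ`.

Finiteness of `C`: for `‖x‖ ≤ ‖y‖` the kernel is at most a constant times `‖x - y‖^(-(2β+μ)) +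
‖x‖^(-β) ‖y‖^(-(β+μ))` (`steinWeissKernel_le`). The first term is an unweighted
Hardy–Littlewood–Sobolev kernel (`exists_hls_bound`), the second is handled by a Schur test
(`exists_hardy_bound`).

Decomposition of `ζ`: let `g n = |f n - f'|`, so that `f n ≤ f' + g n`. Positivity and bilinearity
bound `B (φ f n) (f n)` by `B (φ f') f'`, two mixed terms and `B (φ g n) (g n)`. The mixed terms
vanish: by duality the potential of `f'` lies in `L^{t'}`, while `g n → 0` almost everywhere with
bounded `L^t` norm (`tendsto_steinWeissForm_zero`). In `B (φ g n) (g n)` the interaction at positive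
distance also vanishes (`tendsto_steinWeissForm_far`), and the near part is at most `C ‖1_V g
n‖_t^2`. Because `(g n)^t ≤ (f n)^t + f'^t`, the defect `κ = ζ - F_u dx`, nonnegative by Fatou,
satisfies `κ ≤ C (ω + |u|^{p^*} dx)^{2/t}` on measurable sets
(`InteractionSeq.measure_le_of_eq_add`, `measure_le_const_mul_rpow`). No Brezis–Lieb splitting is
needed: the extra absolutely continuous term charges no point, so it disappears at atoms. As `2/t >
1`, a measure dominated in this way is purely atomic (`exists_eq_sum_dirac`), and the bound at a
point compares `ζ_j` with `ω_j`.

Gradient at an atom: apply the inequality defining `S_{β,μ}` to `η u_n` with `η` a cutoff at scale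
`ε`. The error `u_n ∇η` converges in `L^p` to `u ∇η`, which Hölder bounds by `‖u‖_{p^*}` on a ball
of radius `2ε`, because `∫ ‖∇η‖^N` is scale invariant. Letting `ε → 0` gives
`steinWeissSobolevConst_mul_atom_le`. Positivity of `S_{β,μ}` then makes `ν_j` positive and the sum
of the powers of `ζ_j` finite.

Lower bound for `ν`: convexity of `‖·‖^p` and weak convergence tested against `φ |∇u|^{p-2} ∇u`
(`withDensity_gradDensity_le`).

Infinity: a cutoff divides the total mass into a vague part and an exterior part
(`TendstoMeasure.limsup_lintegral`). The Stein–Weiss inequality with one factor restricted to `‖x‖ ≥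
R` bounds `ζ_∞^t` by `C^t ω_∞ (ω(ℝ^N) + ω_∞)`. The last estimate follows by raising this to the
power `p / p^*` and using Sobolev twice, at infinity with the cutoff `1 - η`
(`sobolevConst_mul_massAtInfinity_le`) and globally. -/

theorem ENNReal.rpow_neg_le_mul_rpow_neg {a b m : ℝ≥0∞} {s : ℝ} (hs : 0 ≤ s) (hm0 : m ≠ 0)
    (hm : m ≠ ⊤) (h : a ≤ m * b) : b ^ (-s) ≤ m ^ s * a ^ (-s) := by
  have h1 : a ^ s ≤ m ^ s * b ^ s := by
    rw [← ENNReal.mul_rpow_of_nonneg _ _ hs]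
    exact ENNReal.rpow_le_rpow h hs
  have hms : m ^ s ≠ ⊤ := ENNReal.rpow_ne_top_of_nonneg hs hm
  have hms0 : m ^ s ≠ 0 := by
    intro h0
    rcases ENNReal.rpow_eq_zero_iff.1 h0 with h | h
    · exact hm0 h.1
    · exact hm h.1
  rw [ENNReal.rpow_neg, ENNReal.rpow_neg]
  have h2 := ENNReal.inv_le_inv.2 h1
  rw [ENNReal.mul_inv (Or.inl hms0) (Or.inl hms)] at h2
  calc (b ^ s)⁻¹ = m ^ s * ((m ^ s)⁻¹ * (b ^ s)⁻¹) := by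
        rw [← mul_assoc, ENNReal.mul_inv_cancel hms0 hms, one_mul]
    _ ≤ _ := by gcongr

theorem ENNReal.rpow_neg_le_rpow_neg {a b : ℝ≥0∞} {s : ℝ} (hs : 0 ≤ s) (h : a ≤ b) :
    b ^ (-s) ≤ a ^ (-s) := by
  rw [ENNReal.rpow_neg, ENNReal.rpow_neg]
  exact ENNReal.inv_le_inv.2 (ENNReal.rpow_le_rpow h hs)

variable {N : ℕ}

theorem lintegral_eq_rpow_mul_lintegral_comp_smul {ρ : ℝ} (hρ : 0 < ρ) (h : RN N → ℝ≥0∞) :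
    ∫⁻ x, h x = ENNReal.ofReal ρ ^ (N : ℝ) * ∫⁻ x, h (ρ • x) := by
  have e : MeasurableEmbedding (fun x : RN N => ρ • x) :=
    (Homeomorph.smulOfNeZero ρ hρ.ne').measurableEmbedding
  have h1 := e.lintegral_map (μ := volume) h
  rw [Measure.map_addHaar_smul _ hρ.ne', lintegral_smul_measure] at h1
  rw [← h1, finrank_euclideanSpace_fin, abs_of_pos (by positivity),
    ENNReal.ofReal_inv_of_pos (by positivity), ENNReal.ofReal_pow hρ.le, ENNReal.rpow_natCast,
    smul_eq_mul, ← mul_assoc, ENNReal.mul_inv_cancel, one_mul]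
  · exact pow_ne_zero _ (by simpa using hρ)
  · exact ENNReal.pow_ne_top ENNReal.ofReal_ne_top

theorem lintegral_norm_rpow_ball_lt_top (hN : 0 < N) {s : ℝ} (hs : s < N) :
    ∫⁻ x in {x : RN N | ‖x‖ₑ < 1}, ‖x‖ₑ ^ (-s) < ⊤ := by
  have hset : {x : RN N | ‖x‖ₑ < 1} = Metric.ball 0 1 := by
    ext x
    rw [Set.mem_ofPred_eq, mem_ball_zero_iff, ← ofReal_norm, ENNReal.ofReal_lt_one]
  have hd : 1 ≤ Module.finrank ℝ (RN N) := by
    rw [finrank_euclideanSpace_fin]; exact hN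
  have hi : IntegrableOn (fun x : RN N => ‖x‖ ^ (-s)) (Metric.ball 0 1) := by
    refine integrableOn_ball_of_norm_le_rpow (C := 1) (α := s) hd
      (by rwa [finrank_euclideanSpace_fin]) ?_ ?_
    · refine ae_of_all _ fun x => ?_
      rw [Real.norm_of_nonneg (by positivity), one_mul]
    · exact (measurable_norm.pow_const _).aestronglyMeasurable
  have hne : Nontrivial (RN N) := Module.nontrivial_of_finrank_pos (R := ℝ) hd
  rw [hset]
  refine lt_of_eq_of_lt ?_ hi.2
  refine lintegral_congr_ae ?_
  have : ∀ᵐ x ∂(volume.restrict (Metric.ball (0 : RN N) 1)), x ≠ 0 :=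
    ae_restrict_of_ae (Measure.ae_ne volume 0)
  filter_upwards [this] with x hx
  have hx' : 0 < ‖x‖ := norm_pos_iff.2 hx
  rw [← ofReal_norm x, ENNReal.ofReal_rpow_of_pos hx', ← ofReal_norm,
    Real.norm_of_nonneg (by positivity)]

theorem lintegral_norm_rpow_compl_ball_lt_top {s : ℝ} (hs : N < s) :
    ∫⁻ x in {x : RN N | 1 ≤ ‖x‖ₑ}, ‖x‖ₑ ^ (-s) < ⊤ := by
  have hs0 : 0 ≤ s := (Nat.cast_nonneg N).trans hs.le
  have h := finite_integral_one_add_norm (E := RN N) (μ := volume) (r := s)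
    (by rwa [finrank_euclideanSpace_fin])
  have hm : MeasurableSet {x : RN N | 1 ≤ ‖x‖ₑ} := measurableSet_le measurable_const (by fun_prop)
  calc ∫⁻ x in {x : RN N | 1 ≤ ‖x‖ₑ}, ‖x‖ₑ ^ (-s)
      ≤ ∫⁻ x in {x : RN N | 1 ≤ ‖x‖ₑ}, 2 ^ s * ENNReal.ofReal ((1 + ‖x‖) ^ (-s)) := by
        -- On this set `1 + ‖x‖ ≤ 2 ‖x‖`, whence the factor `2 ^ s`.
        refine setLIntegral_mono' hm fun x hx => ?_
        rw [← ENNReal.ofReal_rpow_of_pos (by positivity)]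
        refine ENNReal.rpow_neg_le_mul_rpow_neg hs0 (by simp) (by simp) ?_
        rw [ENNReal.ofReal_add zero_le_one (norm_nonneg _), ofReal_norm, ENNReal.ofReal_one, two_mul]
        gcongr
        exact hx
    _ ≤ ∫⁻ x : RN N, 2 ^ s * ENNReal.ofReal ((1 + ‖x‖) ^ (-s)) := setLIntegral_le_lintegral _ _
    _ < ⊤ := by
        rw [lintegral_const_mul' _ _ (ENNReal.rpow_ne_top_of_nonneg hs0 (by simp))]
        exact ENNReal.mul_lt_top (ENNReal.rpow_lt_top_of_nonneg hs0 (by simp)) h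

theorem enorm_smul_of_pos {ρ : ℝ} (hρ : 0 < ρ) (x : RN N) :
    ‖ρ • x‖ₑ = ENNReal.ofReal ρ * ‖x‖ₑ := by
  rw [enorm_smul, Real.enorm_eq_ofReal hρ.le]

/-- Homogeneity of the integrals of `‖x‖ ^ (-s)` over the dilates of a set `{x | P ‖x‖}`. -/
theorem lintegral_norm_rpow_dilate {ρ : ℝ≥0∞} (hρ : ρ ≠ 0) (hρ' : ρ ≠ ⊤) (s : ℝ)
    (P Q : ℝ≥0∞ → Prop) (hP : MeasurableSet {x : RN N | P ‖x‖ₑ})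
    (hQ : MeasurableSet {x : RN N | Q ‖x‖ₑ}) (h : ∀ a, P (ρ * a) ↔ Q a) :
    ∫⁻ x in {x : RN N | P ‖x‖ₑ}, ‖x‖ₑ ^ (-s) =
      (∫⁻ x in {x : RN N | Q ‖x‖ₑ}, ‖x‖ₑ ^ (-s)) * ρ ^ (N - s) := by
  have hr : 0 < ρ.toReal := ENNReal.toReal_pos hρ hρ'
  rw [← lintegral_indicator hP, ← lintegral_indicator hQ,
    lintegral_eq_rpow_mul_lintegral_comp_smul hr, ENNReal.ofReal_toReal hρ', sub_eq_add_neg,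
    ENNReal.rpow_add _ _ hρ hρ', mul_comm (∫⁻ _, _), mul_assoc]
  congr 1
  have hne : ρ ^ (-s) ≠ ⊤ := by
    intro h0
    rcases ENNReal.rpow_eq_top_iff.1 h0 with h | h
    · exact hρ h.1
    · exact hρ' h.1
  rw [← lintegral_const_mul' _ _ hne]
  refine lintegral_congr fun x => ?_
  have hPQ : P ‖ρ.toReal • x‖ₑ ↔ Q ‖x‖ₑ := by
    rw [enorm_smul_of_pos hr, ENNReal.ofReal_toReal hρ']
    exact h _
  by_cases hx : Q ‖x‖ₑ
  · simp only [Set.indicator, Set.mem_ofPred_eq, hPQ, hx, if_true]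
    rw [enorm_smul_of_pos hr, ENNReal.ofReal_toReal hρ',
      ENNReal.mul_rpow_of_ne_top hρ' enorm_ne_top]
  · simp only [Set.indicator, Set.mem_ofPred_eq, hPQ, hx, if_false, mul_zero]

theorem exists_lintegral_norm_rpow_ball (hN : 0 < N) {s : ℝ} (hs : s < N) :
    ∃ c : ℝ≥0∞, c < ⊤ ∧ ∀ ρ : ℝ≥0∞, ρ ≠ 0 → ρ ≠ ⊤ →
      ∫⁻ x in {x : RN N | ‖x‖ₑ < ρ}, ‖x‖ₑ ^ (-s) ≤ c * ρ ^ (N - s) := by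
  refine ⟨_, lintegral_norm_rpow_ball_lt_top hN hs, fun ρ h0 ht => le_of_eq ?_⟩
  refine lintegral_norm_rpow_dilate h0 ht s (fun a => a < ρ) (fun a => a < 1)
    (measurableSet_lt (by fun_prop) measurable_const)
    (measurableSet_lt (by fun_prop) measurable_const) fun a => ?_
  nth_rw 2 [← mul_one ρ]
  exact ENNReal.mul_lt_mul_iff_right h0 ht

theorem exists_lintegral_norm_rpow_compl_ball {s : ℝ} (hs : N < s) :
    ∃ c : ℝ≥0∞, c < ⊤ ∧ ∀ ρ : ℝ≥0∞, ρ ≠ 0 → ρ ≠ ⊤ →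
      ∫⁻ x in {x : RN N | ρ ≤ ‖x‖ₑ}, ‖x‖ₑ ^ (-s) ≤ c * ρ ^ (N - s) := by
  refine ⟨_, lintegral_norm_rpow_compl_ball_lt_top hs, fun ρ h0 ht => le_of_eq ?_⟩
  refine lintegral_norm_rpow_dilate h0 ht s (fun a => ρ ≤ a) (fun a => 1 ≤ a)
    (measurableSet_le measurable_const (by fun_prop))
    (measurableSet_le measurable_const (by fun_prop)) fun a => ?_
  nth_rw 1 [← mul_one ρ]
  exact ENNReal.mul_le_mul_iff_right h0 ht

theorem setLIntegral_comp_sub (x : RN N) (P : ℝ≥0∞ → Prop) (s : ℝ)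
    (hP : MeasurableSet {y : RN N | P ‖y‖ₑ}) :
    ∫⁻ y in {y : RN N | P ‖x - y‖ₑ}, ‖x - y‖ₑ ^ (-s) =
      ∫⁻ y in {y : RN N | P ‖y‖ₑ}, ‖y‖ₑ ^ (-s) := by
  have hP' : MeasurableSet {y : RN N | P ‖x - y‖ₑ} :=
    (measurable_const.sub measurable_id : Measurable fun y : RN N => x - y) hP
  rw [← lintegral_indicator hP, ← lintegral_indicator hP',
    ← lintegral_sub_left_eq_self (fun y : RN N => Set.indicator {y : RN N | P ‖y‖ₑ}
      (fun y => ‖y‖ₑ ^ (-s)) y) x]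
  rfl

/-! ### The Hardy–Littlewood–Sobolev inequality -/

/-- Split at distance `ρ` from `x`. Inside, use `g ≤ a` and local integrability of the kernel, which
gives `a ρ^(N - lam)`. Outside, use Hölder with `‖g‖_t ≤ 1`: the exponent conjugate to `t` is `2N /
lam`, so the kernel becomes `‖x - y‖^(-2N)` and the result is `ρ^(-lam/2)`. The choice `ρ =
a^(-2/(2N - lam))` turns both contributions into `a^(t - 1)`. -/
theorem exists_truncated_riesz_le {lam t : ℝ} (hl : 0 < lam) (hlN : lam < N)
    (ht : t = 2 * N / (2 * N - lam)) :
    ∃ c : ℝ≥0∞, c < ⊤ ∧ ∀ g : RN N → ℝ≥0∞, Measurable g → ∫⁻ x, g x ^ t ≤ 1 →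
      ∀ a : ℝ≥0∞, a ≠ 0 → a ≠ ⊤ → ∀ x : RN N,
        ∫⁻ y in {y | g y ≤ a}, g y * ‖x - y‖ₑ ^ (-lam) ≤ c * a ^ (t - 1) := by
  have hNpos : (0 : ℝ) < N := hl.trans hlN
  have hN : 0 < N := by exact_mod_cast hNpos
  obtain ⟨c1, hc1, h1⟩ := exists_lintegral_norm_rpow_ball hN hlN
  obtain ⟨c2, hc2, h2⟩ := exists_lintegral_norm_rpow_compl_ball (N := N) (s := 2 * N) (by linarith)
  have hd : 0 < 2 * N - lam := by linarith
  have ht0 : 0 < t := by rw [ht]; positivity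
  refine ⟨c1 + c2 ^ (lam / (2 * N)), ENNReal.add_lt_top.2
    ⟨hc1, ENNReal.rpow_lt_top_of_nonneg (by positivity) hc2.ne⟩, ?_⟩
  intro g hg hg1 a ha0 ha x
  set ρ : ℝ≥0∞ := a ^ (-(2 / (2 * N - lam))) with hρ
  have hρ0 : ρ ≠ 0 := (ENNReal.rpow_pos (pos_iff_ne_zero.2 ha0) ha).ne'
  have hρt : ρ ≠ ⊤ := ENNReal.rpow_ne_top_of_ne_zero ha0 ha
  have hmn : MeasurableSet {y : RN N | ‖x - y‖ₑ < ρ} :=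
    measurableSet_lt (by fun_prop) measurable_const
  have hma : MeasurableSet {y : RN N | g y ≤ a} := measurableSet_le hg measurable_const
  rw [← lintegral_inter_add_sdiff _ _ hmn, add_mul]
  refine add_le_add ?_ ?_
  · calc ∫⁻ y in {y | g y ≤ a} ∩ {y | ‖x - y‖ₑ < ρ}, g y * ‖x - y‖ₑ ^ (-lam)
        ≤ ∫⁻ y in {y | g y ≤ a} ∩ {y | ‖x - y‖ₑ < ρ}, a * ‖x - y‖ₑ ^ (-lam) :=
          setLIntegral_mono' (hma.inter hmn) fun y hy => mul_le_mul_left hy.1 _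
      _ ≤ ∫⁻ y in {y | ‖x - y‖ₑ < ρ}, a * ‖x - y‖ₑ ^ (-lam) :=
          lintegral_mono_set Set.inter_subset_right
      _ = a * ∫⁻ y in {y : RN N | ‖x - y‖ₑ < ρ}, ‖x - y‖ₑ ^ (-lam) := lintegral_const_mul' _ _ ha
      _ = a * ∫⁻ y in {y : RN N | ‖y‖ₑ < ρ}, ‖y‖ₑ ^ (-lam) := by
          rw [setLIntegral_comp_sub x (fun b => b < ρ) lam
            (measurableSet_lt (by fun_prop) measurable_const)]
      _ ≤ a * (c1 * ρ ^ (N - lam)) := by gcongr; exact h1 ρ hρ0 hρt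
      _ = c1 * (a ^ (1 : ℝ) * ρ ^ (N - lam)) := by rw [ENNReal.rpow_one]; ring
      _ = c1 * a ^ (t - 1) := by
          rw [hρ, ← ENNReal.rpow_mul, ← ENNReal.rpow_add _ _ ha0 ha, ht]
          congr 2
          field_simp
          ring
  · have hmd : MeasurableSet ({y : RN N | g y ≤ a} \ {y | ‖x - y‖ₑ < ρ}) := hma.diff hmn
    have hmf : MeasurableSet {y : RN N | ρ ≤ ‖x - y‖ₑ} :=
      measurableSet_le measurable_const (by fun_prop)
    have hε : 0 ≤ lam / (2 * N) := by positivity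
    have hti : 0 ≤ 1 / t := by positivity
    have hsum : 1 / t + lam / (2 * N) = 1 := by rw [ht]; field_simp; ring
    calc ∫⁻ y in {y | g y ≤ a} \ {y | ‖x - y‖ₑ < ρ}, g y * ‖x - y‖ₑ ^ (-lam)
        ≤ ∫⁻ y in {y | ρ ≤ ‖x - y‖ₑ}, g y * ‖x - y‖ₑ ^ (-lam) :=
          lintegral_mono_set fun y hy => by simpa using hy.2
      _ = ∫⁻ y in {y | ρ ≤ ‖x - y‖ₑ}, (g y ^ t) ^ (1 / t) *
            (‖x - y‖ₑ ^ (-(2 * N : ℝ))) ^ (lam / (2 * N)) := by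
          refine lintegral_congr fun y => ?_
          rw [← ENNReal.rpow_mul, ← ENNReal.rpow_mul, mul_one_div_cancel ht0.ne', ENNReal.rpow_one]
          congr 2
          field_simp
      _ ≤ (∫⁻ y in {y | ρ ≤ ‖x - y‖ₑ}, g y ^ t) ^ (1 / t) *
            (∫⁻ y in {y | ρ ≤ ‖x - y‖ₑ}, ‖x - y‖ₑ ^ (-(2 * N : ℝ))) ^ (lam / (2 * N)) :=
          ENNReal.lintegral_mul_norm_pow_le (by fun_prop) (by fun_prop) hti hε hsum
      _ ≤ 1 ^ (1 / t) * (c2 * ρ ^ (N - 2 * N : ℝ)) ^ (lam / (2 * N)) := by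
          gcongr
          · exact (setLIntegral_le_lintegral _ _).trans hg1
          · rw [setLIntegral_comp_sub x (fun b => ρ ≤ b) (2 * N)
              (measurableSet_le measurable_const (by fun_prop))]
            exact h2 ρ hρ0 hρt
      _ = c2 ^ (lam / (2 * N)) * a ^ (t - 1) := by
          rw [ENNReal.one_rpow, one_mul, ENNReal.mul_rpow_of_nonneg _ _ hε, hρ,
            ← ENNReal.rpow_mul, ← ENNReal.rpow_mul, ht]
          congr 2
          field_simp
          ring

/-- Where `g y ≤ f x`, the truncated potential at the level `a = f x` gives `f x * f x ^ (t - 1) = f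
x ^ t`, which is integrable. The remaining region is symmetric, so neither rearrangement nor
interpolation is needed. -/
theorem exists_hls_bound {lam t : ℝ} (hl : 0 < lam) (hlN : lam < N)
    (ht : t = 2 * N / (2 * N - lam)) :
    ∃ c : ℝ≥0∞, c < ⊤ ∧ ∀ f g : RN N → ℝ≥0∞, Measurable f → Measurable g →
      (∀ x, f x ≠ ⊤) → (∀ x, g x ≠ ⊤) → ∫⁻ x, f x ^ t ≤ 1 → ∫⁻ x, g x ^ t ≤ 1 →
        ∫⁻ x, ∫⁻ y, ‖x - y‖ₑ ^ (-lam) * (f x * g y) ≤ c := by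
  obtain ⟨c, hc, h⟩ := exists_truncated_riesz_le hl hlN ht
  have ht0 : 0 < t := by rw [ht]; exact div_pos (by linarith) (by linarith)
  have half : ∀ f g : RN N → ℝ≥0∞, Measurable f → Measurable g → (∀ x, f x ≠ ⊤) →
      ∫⁻ x, f x ^ t ≤ 1 → ∫⁻ x, g x ^ t ≤ 1 →
      ∫⁻ x, ∫⁻ y in {y | g y ≤ f x}, ‖x - y‖ₑ ^ (-lam) * (f x * g y) ≤ c := by
    intro f g hf hg hft hf1 hg1
    calc ∫⁻ x, ∫⁻ y in {y | g y ≤ f x}, ‖x - y‖ₑ ^ (-lam) * (f x * g y)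
        ≤ ∫⁻ x, c * f x ^ t := by
          refine lintegral_mono fun x => ?_
          have e : ∫⁻ y in {y | g y ≤ f x}, ‖x - y‖ₑ ^ (-lam) * (f x * g y) =
              f x * ∫⁻ y in {y | g y ≤ f x}, g y * ‖x - y‖ₑ ^ (-lam) := by
            rw [← lintegral_const_mul' _ _ (hft x)]
            exact lintegral_congr fun y => by ring
          rw [e]
          rcases eq_or_ne (f x) 0 with h0 | h0
          · simp [h0]
          · calc f x * ∫⁻ y in {y | g y ≤ f x}, g y * ‖x - y‖ₑ ^ (-lam)
                ≤ f x ^ (1 : ℝ) * (c * f x ^ (t - 1)) := by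
                  rw [ENNReal.rpow_one]
                  gcongr
                  exact h g hg hg1 _ h0 (hft x) x
              _ = c * f x ^ t := by
                  rw [mul_left_comm, ← ENNReal.rpow_add _ _ h0 (hft x)]
                  congr 2
                  ring
      _ = c * ∫⁻ x, f x ^ t := lintegral_const_mul' _ _ hc.ne
      _ ≤ c := mul_le_of_le_one_right' hf1
  refine ⟨c + c, ENNReal.add_lt_top.2 ⟨hc, hc⟩, fun f g hf hg hft hgt hf1 hg1 => ?_⟩
  have hmeas : Measurable fun z : RN N × RN N => ‖z.1 - z.2‖ₑ ^ (-lam) * (f z.1 * g z.2) := by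
    fun_prop
  -- The complementary region `f x < g y` is enlarged to `f x ≤ g y`, so that after exchanging the
  -- integrals it is exactly `half` with `f` and `g` swapped.
  have hset : MeasurableSet {z : RN N × RN N | f z.1 ≤ g z.2} :=
    measurableSet_le (by fun_prop) (by fun_prop)
  calc ∫⁻ x, ∫⁻ y, ‖x - y‖ₑ ^ (-lam) * (f x * g y)
      ≤ ∫⁻ x, ((∫⁻ y in {y | g y ≤ f x}, ‖x - y‖ₑ ^ (-lam) * (f x * g y)) +
          ∫⁻ y, Set.indicator {z : RN N × RN N | f z.1 ≤ g z.2}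
            (fun z => ‖z.1 - z.2‖ₑ ^ (-lam) * (f z.1 * g z.2)) (x, y)) := by
        refine lintegral_mono fun x => ?_
        have hs : MeasurableSet {y | g y ≤ f x} := measurableSet_le hg measurable_const
        rw [← lintegral_add_compl _ hs]
        refine add_le_add le_rfl ?_
        rw [← lintegral_indicator hs.compl]
        refine lintegral_mono fun y => ?_
        by_cases hy : g y ≤ f x
        · simp [hy]
        · have hy' : f x ≤ g y := (not_le.1 hy).le
          simp [hy, hy']
    _ = (∫⁻ x, ∫⁻ y in {y | g y ≤ f x}, ‖x - y‖ₑ ^ (-lam) * (f x * g y)) +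
          ∫⁻ x, ∫⁻ y, Set.indicator {z : RN N × RN N | f z.1 ≤ g z.2}
            (fun z => ‖z.1 - z.2‖ₑ ^ (-lam) * (f z.1 * g z.2)) (x, y) :=
        lintegral_add_right _ (Measurable.lintegral_prod_right' (hmeas.indicator hset))
    _ ≤ c + c := by
        refine add_le_add (half f g hf hg hft hf1 hg1) ?_
        rw [lintegral_lintegral_swap (by exact (hmeas.indicator hset).aemeasurable)]
        refine le_trans (le_of_eq ?_) (half g f hg hf hgt hg1 hf1)
        refine lintegral_congr fun y => ?_
        have hs : MeasurableSet {x | f x ≤ g y} := measurableSet_le hf measurable_const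
        rw [← lintegral_indicator hs]
        refine lintegral_congr fun x => ?_
        simp only [Set.indicator, Set.mem_ofPred_eq]
        split_ifs
        · rw [← enorm_neg (x - y), neg_sub, mul_comm (f x)]
        · rfl

end

noncomputable section

variable {N : ℕ}

/-! ### The Hardy part of the Stein–Weiss inequality -/

/-- Whichever of `b ^ (t - 1)` and `θ a ^ (t - 1)` is larger may replace the other inside the
product. The free weight `θ` is the Schur weight, later a power of `‖x‖ / ‖y‖`. -/
theorem ENNReal.mul_le_weighted_rpow_add {t : ℝ} (ht1 : 1 ≤ t) (ht2 : t ≤ 2) {θ : ℝ≥0∞}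
    (h0 : θ ≠ 0) (hθ : θ ≠ ⊤) (a b : ℝ≥0∞) :
    a * b ≤ θ * (a ^ t * b ^ (2 - t)) + θ⁻¹ * (a ^ (2 - t) * b ^ t) := by
  have split : ∀ c : ℝ≥0∞, c = c ^ (2 - t) * c ^ (t - 1) := fun c => by
    rw [← ENNReal.rpow_add_of_nonneg _ _ (by linarith) (by linarith)]
    norm_num
  have join : ∀ c : ℝ≥0∞, c ^ t = c * c ^ (t - 1) := fun c => by
    nth_rw 2 [← ENNReal.rpow_one c]
    rw [← ENNReal.rpow_add_of_nonneg _ _ (by linarith) (by linarith)]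
    norm_num
  rcases le_total (b ^ (t - 1)) (θ * a ^ (t - 1)) with h | h
  · refine le_trans ?_ le_self_add
    calc a * b = a * (b ^ (2 - t) * b ^ (t - 1)) := by rw [← split b]
      _ ≤ a * (b ^ (2 - t) * (θ * a ^ (t - 1))) := by gcongr
      _ = _ := by rw [join a]; ring
  · refine le_trans ?_ le_add_self
    have h' : a ^ (t - 1) ≤ θ⁻¹ * b ^ (t - 1) := by
      calc a ^ (t - 1) = θ⁻¹ * (θ * a ^ (t - 1)) := by
            rw [← mul_assoc, ENNReal.inv_mul_cancel h0 hθ, one_mul]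
        _ ≤ _ := by gcongr
    calc a * b = (a ^ (2 - t) * a ^ (t - 1)) * b := by rw [← split a]
      _ ≤ (a ^ (2 - t) * (θ⁻¹ * b ^ (t - 1))) * b := by gcongr
      _ = _ := by rw [join b]; ring

theorem ENNReal.rpow_neg_mul_rpow_neg {a b : ℝ} (ha : 0 ≤ a) (hb : 0 ≤ b) {x : ℝ≥0∞}
    (hx : x ≠ ⊤) : x ^ (-a) * x ^ (-b) = x ^ (-(a + b)) := by
  rw [ENNReal.rpow_neg, ENNReal.rpow_neg, ENNReal.rpow_neg, ENNReal.rpow_add_of_nonneg _ _ ha hb,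
    ENNReal.mul_inv (Or.inr (ENNReal.rpow_ne_top_of_nonneg hb hx))
      (Or.inl (ENNReal.rpow_ne_top_of_nonneg ha hx))]

/-- Hölder with exponents `N / lam` and `t / (2 - t)`, conjugate because `2 / t = 2 - lam / N`. -/
theorem setLIntegral_norm_rpow_mul_le {lam t : ℝ} (hl : 0 < lam) (hlN : lam < N)
    (ht : t = 2 * N / (2 * N - lam)) {g : RN N → ℝ≥0∞} (hg : Measurable g)
    (hg1 : ∫⁻ x, g x ^ t ≤ 1) (S : Set (RN N)) (σ : ℝ) :
    ∫⁻ y in S, ‖y‖ₑ ^ (-σ) * g y ^ (2 - t) ≤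
      (∫⁻ y in S, ‖y‖ₑ ^ (-(σ * N / lam))) ^ (lam / N) := by
  have hN : (0 : ℝ) < N := hl.trans hlN
  have hd : 0 < 2 * N - lam := by linarith
  have ht0 : 0 < t := by rw [ht]; positivity
  have ht2 : t ≤ 2 := by rw [ht, div_le_iff₀ hd]; linarith
  have hsum : lam / N + (2 - t) / t = 1 := by
    have : (2 - t) / t = 2 / t - 1 := by field_simp
    rw [this, ht]
    field_simp
    ring
  calc ∫⁻ y in S, ‖y‖ₑ ^ (-σ) * g y ^ (2 - t)
      = ∫⁻ y in S, (‖y‖ₑ ^ (-(σ * N / lam))) ^ (lam / N) * (g y ^ t) ^ ((2 - t) / t) := by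
        refine lintegral_congr fun y => ?_
        rw [← ENNReal.rpow_mul, ← ENNReal.rpow_mul]
        congr 2 <;> field_simp
    _ ≤ (∫⁻ y in S, ‖y‖ₑ ^ (-(σ * N / lam))) ^ (lam / N) * (∫⁻ y in S, g y ^ t) ^ ((2 - t) / t) :=
        ENNReal.lintegral_mul_norm_pow_le (by fun_prop) (by fun_prop) (by positivity)
          (div_nonneg (by linarith) ht0.le) hsum
    _ ≤ (∫⁻ y in S, ‖y‖ₑ ^ (-(σ * N / lam))) ^ (lam / N) * 1 := by
        gcongr
        exact ENNReal.rpow_le_one ((setLIntegral_le_lintegral _ _).trans hg1)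
          (div_nonneg (by linarith) ht0.le)
    _ = _ := mul_one _

theorem exists_setLIntegral_compl_ball_le {lam t σ : ℝ} (hl : 0 < lam) (hlN : lam < N)
    (ht : t = 2 * N / (2 * N - lam)) (hσ : lam < σ) :
    ∃ c : ℝ≥0∞, c < ⊤ ∧ ∀ g : RN N → ℝ≥0∞, Measurable g → ∫⁻ x, g x ^ t ≤ 1 →
      ∀ ρ : ℝ≥0∞, ρ ≠ 0 → ρ ≠ ⊤ →
        ∫⁻ y in {y | ρ ≤ ‖y‖ₑ}, ‖y‖ₑ ^ (-σ) * g y ^ (2 - t) ≤ c * ρ ^ (lam - σ) := by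
  have hN : (0 : ℝ) < N := hl.trans hlN
  obtain ⟨c, hc, h⟩ := exists_lintegral_norm_rpow_compl_ball (N := N) (s := σ * N / lam)
    (by rw [lt_div_iff₀ hl]; nlinarith)
  refine ⟨c ^ (lam / N), ENNReal.rpow_lt_top_of_nonneg (by positivity) hc.ne, ?_⟩
  intro g hg hg1 ρ h0 hρ
  refine (setLIntegral_norm_rpow_mul_le hl hlN ht hg hg1 _ _).trans ?_
  calc _ ≤ (c * ρ ^ (N - σ * N / lam)) ^ (lam / N) := by gcongr; exact h ρ h0 hρ
    _ = _ := by
      rw [ENNReal.mul_rpow_of_nonneg _ _ (by positivity), ← ENNReal.rpow_mul]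
      congr 2
      field_simp

theorem exists_setLIntegral_closedBall_le {lam t σ : ℝ} (hl : 0 < lam) (hlN : lam < N)
    (ht : t = 2 * N / (2 * N - lam)) (hσ : σ < lam) :
    ∃ c : ℝ≥0∞, c < ⊤ ∧ ∀ g : RN N → ℝ≥0∞, Measurable g → ∫⁻ x, g x ^ t ≤ 1 →
      ∀ ρ : ℝ≥0∞, ρ ≠ 0 → ρ ≠ ⊤ →
        ∫⁻ y in {y | ‖y‖ₑ ≤ ρ}, ‖y‖ₑ ^ (-σ) * g y ^ (2 - t) ≤ c * ρ ^ (lam - σ) := by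
  have hN : (0 : ℝ) < N := hl.trans hlN
  have hN' : 0 < N := by exact_mod_cast hN
  obtain ⟨c, hc, h⟩ := exists_lintegral_norm_rpow_ball hN' (s := σ * N / lam)
    (by rw [div_lt_iff₀ hl]; nlinarith)
  refine ⟨c ^ (lam / N) * 2 ^ (lam - σ), ENNReal.mul_lt_top
    (ENNReal.rpow_lt_top_of_nonneg (by positivity) hc.ne)
    (ENNReal.rpow_lt_top_of_nonneg (by linarith) (by simp)), ?_⟩
  intro g hg hg1 ρ h0 hρ
  refine (setLIntegral_norm_rpow_mul_le hl hlN ht hg hg1 _ _).trans ?_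
  -- The radial integral is known on open balls; doubling the radius costs the factor `2 ^ (lam -
  -- σ)`.
  have hsub : {y : RN N | ‖y‖ₑ ≤ ρ} ⊆ {y : RN N | ‖y‖ₑ < 2 * ρ} := fun y hy => by
    have h2 : ρ < 2 * ρ := by
      rw [two_mul]
      exact ENNReal.lt_add_right hρ h0
    exact lt_of_le_of_lt hy h2
  calc _ ≤ (∫⁻ y in {y : RN N | ‖y‖ₑ < 2 * ρ}, ‖y‖ₑ ^ (-(σ * N / lam))) ^ (lam / N) := by
        gcongr
    _ ≤ (c * (2 * ρ) ^ (N - σ * N / lam)) ^ (lam / N) := by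
        gcongr
        exact h (2 * ρ) (mul_ne_zero (by simp) h0) (ENNReal.mul_ne_top (by simp) hρ)
    _ = _ := by
      rw [ENNReal.mul_rpow_of_nonneg _ _ (by positivity), ← ENNReal.rpow_mul,
        ENNReal.mul_rpow_of_ne_top (by simp) hρ, mul_assoc]
      congr 3 <;> field_simp

/-- A Schur test. With `θ = (‖x‖ / ‖y‖)^s` the product `f x * g y` is dominated by one term
containing `f^t g^(2-t)` and one containing `f^(2-t) g^t`. Integrating first in the variable that
carries `2 - t`, all powers of the norms cancel by homogeneity, and `∫ f^t` or `∫ g^t` remains. -/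
theorem exists_hardy_bound {β μ t : ℝ} (hβ : 0 ≤ β) (hμ : 0 < μ) (hβμ : 2 * β + μ < N)
    (ht : t = 2 * N / (2 * N - (2 * β + μ))) :
    ∃ c : ℝ≥0∞, c < ⊤ ∧ ∀ f g : RN N → ℝ≥0∞, Measurable f → Measurable g →
      (∀ x, f x ≠ ⊤) → (∀ x, g x ≠ ⊤) → ∫⁻ x, f x ^ t ≤ 1 → ∫⁻ x, g x ^ t ≤ 1 →
        ∫⁻ x, ∫⁻ y, Set.indicator {z : RN N × RN N | ‖z.1‖ₑ ≤ ‖z.2‖ₑ}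
          (fun z => ‖z.1‖ₑ ^ (-β) * ‖z.2‖ₑ ^ (-(β + μ)) * (f z.1 * g z.2)) (x, y) ≤ c := by
  have hl : 0 < 2 * β + μ := by linarith
  have hN : (0 : ℝ) < N := hl.trans hβμ
  have hd : 0 < 2 * N - (2 * β + μ) := by linarith
  have ht0 : 0 < t := by rw [ht]; positivity
  have ht1 : 1 ≤ t := by rw [ht, le_div_iff₀ hd]; linarith
  have ht2 : t ≤ 2 := by rw [ht, div_le_iff₀ hd]; linarith
  -- The outer integral in `y` needs `s > β`, the inner one in `x` needs `s < β + μ`; the midpoint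
  -- serves both.
  set s : ℝ := β + μ / 2 with hs
  obtain ⟨c1, hc1, h1⟩ := exists_setLIntegral_compl_ball_le (σ := β + μ + s) hl hβμ ht
    (by linarith)
  obtain ⟨c2, hc2, h2⟩ := exists_setLIntegral_closedBall_le (σ := β + s) hl hβμ ht (by linarith)
  refine ⟨c1 + c2, ENNReal.add_lt_top.2 ⟨hc1, hc2⟩, ?_⟩
  intro f g hf hg hft hgt hf1 hg1
  set E : Set (RN N × RN N) := {z | ‖z.1‖ₑ ≤ ‖z.2‖ₑ} with hE
  have hEm : MeasurableSet E := measurableSet_le (by fun_prop) (by fun_prop)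
  set F1 : RN N × RN N → ℝ≥0∞ := fun z =>
    (‖z.1‖ₑ ^ (s - β) * f z.1 ^ t) * (‖z.2‖ₑ ^ (-(β + μ + s)) * g z.2 ^ (2 - t)) with hF1
  set F2 : RN N × RN N → ℝ≥0∞ := fun z =>
    (‖z.2‖ₑ ^ (s - (β + μ)) * g z.2 ^ t) * (‖z.1‖ₑ ^ (-(β + s)) * f z.1 ^ (2 - t)) with hF2
  have hF1m : Measurable (E.indicator F1) := Measurable.indicator (by fun_prop) hEm
  have hF2m : Measurable (E.indicator F2) := Measurable.indicator (by fun_prop) hEm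
  have hne : ∀ᵐ x : RN N, x ≠ 0 := by
    have : Nontrivial (RN N) := Module.nontrivial_of_finrank_pos (R := ℝ)
      (by rw [finrank_euclideanSpace_fin]; exact_mod_cast hN)
    exact Measure.ae_ne volume 0
  have htop : ∀ {x : RN N} {a : ℝ}, x ≠ 0 → ‖x‖ₑ ^ a ≠ ⊤ := fun hx =>
    ENNReal.rpow_ne_top_of_ne_zero (by simpa using hx) enorm_ne_top
  have b1 : ∀ x : RN N, x ≠ 0 → ∫⁻ y, E.indicator F1 (x, y) ≤ c1 * f x ^ t := by
    intro x hx
    have hx0 : ‖x‖ₑ ≠ 0 := by simpa using hx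
    have e : ∫⁻ y, E.indicator F1 (x, y) = (‖x‖ₑ ^ (s - β) * f x ^ t) *
        ∫⁻ y in {y | ‖x‖ₑ ≤ ‖y‖ₑ}, ‖y‖ₑ ^ (-(β + μ + s)) * g y ^ (2 - t) := by
      rw [← lintegral_const_mul' _ _ (ENNReal.mul_ne_top (htop hx)
        (ENNReal.rpow_ne_top_of_nonneg ht0.le (hft x))), ← lintegral_indicator
        (measurableSet_le measurable_const (by fun_prop))]
      rfl
    rw [e]
    calc _ ≤ (‖x‖ₑ ^ (s - β) * f x ^ t) * (c1 * ‖x‖ₑ ^ (2 * β + μ - (β + μ + s))) := by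
          gcongr
          exact h1 g hg hg1 _ hx0 enorm_ne_top
      _ = c1 * f x ^ t * (‖x‖ₑ ^ (s - β) * ‖x‖ₑ ^ (2 * β + μ - (β + μ + s))) := by ring
      _ = c1 * f x ^ t := by
          rw [← ENNReal.rpow_add _ _ hx0 enorm_ne_top]
          ring_nf
          simp
  have b2 : ∀ y : RN N, y ≠ 0 → ∫⁻ x, E.indicator F2 (x, y) ≤ c2 * g y ^ t := by
    intro y hy
    have hy0 : ‖y‖ₑ ≠ 0 := by simpa using hy
    have e : ∫⁻ x, E.indicator F2 (x, y) = (‖y‖ₑ ^ (s - (β + μ)) * g y ^ t) *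
        ∫⁻ x in {x | ‖x‖ₑ ≤ ‖y‖ₑ}, ‖x‖ₑ ^ (-(β + s)) * f x ^ (2 - t) := by
      rw [← lintegral_const_mul' _ _ (ENNReal.mul_ne_top (htop hy)
        (ENNReal.rpow_ne_top_of_nonneg ht0.le (hgt y))), ← lintegral_indicator
        (measurableSet_le (by fun_prop) measurable_const)]
      rfl
    rw [e]
    calc _ ≤ (‖y‖ₑ ^ (s - (β + μ)) * g y ^ t) * (c2 * ‖y‖ₑ ^ (2 * β + μ - (β + s))) := by
          gcongr
          exact h2 f hf hf1 _ hy0 enorm_ne_top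
      _ = c2 * g y ^ t * (‖y‖ₑ ^ (s - (β + μ)) * ‖y‖ₑ ^ (2 * β + μ - (β + s))) := by ring
      _ = c2 * g y ^ t := by
          rw [← ENNReal.rpow_add _ _ hy0 enorm_ne_top]
          ring_nf
          simp
  calc ∫⁻ x, ∫⁻ y, E.indicator
          (fun z => ‖z.1‖ₑ ^ (-β) * ‖z.2‖ₑ ^ (-(β + μ)) * (f z.1 * g z.2)) (x, y)
      ≤ ∫⁻ x, ∫⁻ y, (E.indicator F1 (x, y) + E.indicator F2 (x, y)) := by
        refine lintegral_mono_ae ?_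
        filter_upwards [hne] with x hx
        refine lintegral_mono_ae ?_
        filter_upwards [hne] with y hy
        have hx0 : ‖x‖ₑ ≠ 0 := by simpa using hx
        have hy0 : ‖y‖ₑ ≠ 0 := by simpa using hy
        by_cases hz : (x, y) ∈ E
        · simp only [Set.indicator_of_mem hz, hF1, hF2]
          have key := ENNReal.mul_le_weighted_rpow_add ht1 ht2
            (θ := ‖x‖ₑ ^ s * ‖y‖ₑ ^ (-s))
            (mul_ne_zero (ENNReal.rpow_pos (pos_iff_ne_zero.2 hx0) enorm_ne_top).ne'
              (ENNReal.rpow_pos (pos_iff_ne_zero.2 hy0) enorm_ne_top).ne')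
            (ENNReal.mul_ne_top (htop hx) (htop hy)) (f x) (g y)
          have hinv : (‖x‖ₑ ^ s * ‖y‖ₑ ^ (-s))⁻¹ = ‖x‖ₑ ^ (-s) * ‖y‖ₑ ^ s := by
            rw [ENNReal.mul_inv (Or.inr (htop hy)) (Or.inl (htop hx)), ← ENNReal.rpow_neg,
              ← ENNReal.rpow_neg, neg_neg]
          rw [hinv] at key
          calc _ ≤ ‖x‖ₑ ^ (-β) * ‖y‖ₑ ^ (-(β + μ)) *
                (‖x‖ₑ ^ s * ‖y‖ₑ ^ (-s) * (f x ^ t * g y ^ (2 - t)) +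
                  ‖x‖ₑ ^ (-s) * ‖y‖ₑ ^ s * (f x ^ (2 - t) * g y ^ t)) := by gcongr
            _ = ((‖x‖ₑ ^ s * ‖x‖ₑ ^ (-β)) * f x ^ t) *
                  ((‖y‖ₑ ^ (-(β + μ)) * ‖y‖ₑ ^ (-s)) * g y ^ (2 - t)) +
                ((‖y‖ₑ ^ s * ‖y‖ₑ ^ (-(β + μ))) * g y ^ t) *
                  ((‖x‖ₑ ^ (-β) * ‖x‖ₑ ^ (-s)) * f x ^ (2 - t)) := by ring
            _ = _ := by
              simp only [← ENNReal.rpow_add _ _ hx0 enorm_ne_top,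
                ← ENNReal.rpow_add _ _ hy0 enorm_ne_top, sub_eq_add_neg]
              ring_nf
        · simp [Set.indicator_of_notMem hz]
    _ = (∫⁻ x, ∫⁻ y, E.indicator F1 (x, y)) + ∫⁻ x, ∫⁻ y, E.indicator F2 (x, y) := by
        rw [← lintegral_add_left (Measurable.lintegral_prod_right' hF1m)]
        exact lintegral_congr fun x => lintegral_add_left (by fun_prop) _
    _ ≤ c1 + c2 := by
        refine add_le_add ?_ ?_
        · calc _ ≤ ∫⁻ x, c1 * f x ^ t := lintegral_mono_ae (hne.mono b1)
            _ = c1 * ∫⁻ x, f x ^ t := lintegral_const_mul' _ _ hc1.ne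
            _ ≤ c1 := mul_le_of_le_one_right' hf1
        · rw [lintegral_lintegral_swap (by exact hF2m.aemeasurable)]
          calc _ ≤ ∫⁻ x, c2 * g x ^ t := lintegral_mono_ae (hne.mono b2)
            _ = c2 * ∫⁻ x, g x ^ t := lintegral_const_mul' _ _ hc2.ne
            _ ≤ c2 := mul_le_of_le_one_right' hg1

/-! ### The kernel -/

/-- The kernel `|x|^{-β} |x - y|^{-μ} |y|^{-β}`. -/
def steinWeissKernel (β μ : ℝ) (x y : RN N) : ℝ≥0∞ :=
  ‖x‖ₑ ^ (-β) * ‖x - y‖ₑ ^ (-μ) * ‖y‖ₑ ^ (-β)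

@[fun_prop]
theorem measurable_steinWeissKernel (β μ : ℝ) :
    Measurable fun z : RN N × RN N => steinWeissKernel β μ z.1 z.2 := by
  unfold steinWeissKernel
  fun_prop

theorem steinWeissKernel_comm (β μ : ℝ) (x y : RN N) :
    steinWeissKernel β μ x y = steinWeissKernel β μ y x := by
  unfold steinWeissKernel
  rw [← enorm_neg (x - y), neg_sub]
  ring

/-- If `‖x - y‖ ≤ 2 ‖x‖ ≤ 2 ‖y‖`, both weights are controlled by powers of `‖x - y‖`. Otherwise `‖y‖
≤ 2 ‖x - y‖`, and the singularity of the kernel on the diagonal is replaced by a power of `‖y‖`. -/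
theorem steinWeissKernel_le {β μ : ℝ} (hβ : 0 ≤ β) (hμ : 0 < μ) {x y : RN N}
    (hxy : ‖x‖ₑ ≤ ‖y‖ₑ) :
    steinWeissKernel β μ x y ≤ (2 ^ β * 2 ^ β + 2 ^ μ) *
      (‖x - y‖ₑ ^ (-(2 * β + μ)) + ‖x‖ₑ ^ (-β) * ‖y‖ₑ ^ (-(β + μ))) := by
  unfold steinWeissKernel
  rcases le_total ‖x - y‖ₑ (2 * ‖x‖ₑ) with h | h
  · have h1 := ENNReal.rpow_neg_le_mul_rpow_neg hβ (by simp) (by simp) h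
    have h2 := ENNReal.rpow_neg_le_mul_rpow_neg hβ (by simp) (by simp)
      (h.trans (mul_le_mul_right hxy 2))
    calc _ ≤ (2 ^ β * ‖x - y‖ₑ ^ (-β)) * ‖x - y‖ₑ ^ (-μ) * (2 ^ β * ‖x - y‖ₑ ^ (-β)) := by gcongr
      _ = 2 ^ β * 2 ^ β * (‖x - y‖ₑ ^ (-β) * ‖x - y‖ₑ ^ (-μ) * ‖x - y‖ₑ ^ (-β)) := by ring
      _ = 2 ^ β * 2 ^ β * ‖x - y‖ₑ ^ (-(2 * β + μ)) := by
          rw [ENNReal.rpow_neg_mul_rpow_neg hβ hμ.le enorm_ne_top,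
            ENNReal.rpow_neg_mul_rpow_neg (by linarith) hβ enorm_ne_top]
          ring_nf
      _ ≤ _ := by gcongr <;> exact le_self_add
  · have h3 : ‖y‖ₑ ≤ 2 * ‖x - y‖ₑ := by
      calc ‖y‖ₑ = ‖x - (x - y)‖ₑ := by rw [sub_sub_cancel]
        _ ≤ ‖x‖ₑ + ‖x - y‖ₑ := enorm_sub_le
        _ ≤ ‖x - y‖ₑ + ‖x - y‖ₑ := by
            gcongr
            refine le_trans ?_ h
            rw [two_mul]
            exact le_self_add
        _ = _ := (two_mul _).symm
    have h4 := ENNReal.rpow_neg_le_mul_rpow_neg hμ.le (by simp) (by simp) h3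
    calc _ ≤ ‖x‖ₑ ^ (-β) * (2 ^ μ * ‖y‖ₑ ^ (-μ)) * ‖y‖ₑ ^ (-β) := by gcongr
      _ = 2 ^ μ * (‖x‖ₑ ^ (-β) * (‖y‖ₑ ^ (-β) * ‖y‖ₑ ^ (-μ))) := by ring
      _ = 2 ^ μ * (‖x‖ₑ ^ (-β) * ‖y‖ₑ ^ (-(β + μ))) := by
          rw [ENNReal.rpow_neg_mul_rpow_neg hβ hμ.le enorm_ne_top]
      _ ≤ _ := by gcongr <;> exact le_add_self

theorem weightedPotential_mul_div {β μ : ℝ} (hβ : 0 ≤ β) (hμ : 0 < μ) {g : RN N → ℝ≥0∞}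
    (hg : Measurable g) (a : ℝ≥0∞) (x : RN N) :
    weightedPotential β μ g x * (a / ‖x‖ₑ ^ β) =
      ∫⁻ y, steinWeissKernel β μ x y * (a * g y) := by
  unfold weightedPotential steinWeissKernel
  rw [← lintegral_mul_const _ (by fun_prop)]
  refine lintegral_congr fun y => ?_
  rw [div_eq_mul_inv, div_eq_mul_inv, ENNReal.mul_inv
    (Or.inr (ENNReal.rpow_ne_top_of_nonneg hμ.le enorm_ne_top))
    (Or.inl (ENNReal.rpow_ne_top_of_nonneg hβ enorm_ne_top)), ENNReal.rpow_neg, ENNReal.rpow_neg,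
    ENNReal.rpow_neg]
  ring

theorem steinWeissForm_eq_lintegral {β μ : ℝ} (hβ : 0 ≤ β) (hμ : 0 < μ) (f : RN N → ℝ≥0∞)
    {g : RN N → ℝ≥0∞} (hg : Measurable g) :
    steinWeissForm β μ f g = ∫⁻ x, ∫⁻ y, steinWeissKernel β μ x y * (f x * g y) :=
  lintegral_congr fun x => weightedPotential_mul_div hβ hμ hg (f x) x

theorem weightedPotential_congr_ae {β μ : ℝ} {g g' : RN N → ℝ≥0∞} (h : g =ᵐ[volume] g')
    (x : RN N) : weightedPotential β μ g x = weightedPotential β μ g' x :=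
  lintegral_congr_ae (h.mono fun y hy => by simp only [hy])

theorem steinWeissForm_congr_ae {β μ : ℝ} {f f' g g' : RN N → ℝ≥0∞} (hf : f =ᵐ[volume] f')
    (hg : g =ᵐ[volume] g') : steinWeissForm β μ f g = steinWeissForm β μ f' g' :=
  lintegral_congr_ae (hf.mono fun x hx => by
    simp only [hx, weightedPotential_congr_ae hg x])

theorem exists_steinWeissForm_le_of_normalized {β μ t : ℝ} (hβ : 0 ≤ β) (hμ : 0 < μ)
    (hβμ : 2 * β + μ < N) (ht : t = 2 * N / (2 * N - (2 * β + μ))) :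
    ∃ c : ℝ≥0∞, c < ⊤ ∧ ∀ f g : RN N → ℝ≥0∞, Measurable f → Measurable g →
      (∀ x, f x ≠ ⊤) → (∀ x, g x ≠ ⊤) → ∫⁻ x, f x ^ t ≤ 1 → ∫⁻ x, g x ^ t ≤ 1 →
        steinWeissForm β μ f g ≤ c := by
  have hl : 0 < 2 * β + μ := by linarith
  obtain ⟨c1, hc1, h1⟩ := exists_hls_bound hl hβμ ht
  obtain ⟨c2, hc2, h2⟩ := exists_hardy_bound hβ hμ hβμ ht
  set A : ℝ≥0∞ := 2 ^ β * 2 ^ β + 2 ^ μ with hA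
  have hAt : A ≠ ⊤ := ENNReal.add_ne_top.2
    ⟨ENNReal.mul_ne_top (ENNReal.rpow_ne_top_of_nonneg hβ (by simp))
      (ENNReal.rpow_ne_top_of_nonneg hβ (by simp)), ENNReal.rpow_ne_top_of_nonneg hμ.le (by simp)⟩
  refine ⟨A * (c1 + c2 + c2), ENNReal.mul_lt_top hAt.lt_top
    (ENNReal.add_lt_top.2 ⟨ENNReal.add_lt_top.2 ⟨hc1, hc2⟩, hc2⟩), ?_⟩
  intro f g hf hg hft hgt hf1 hg1
  rw [steinWeissForm_eq_lintegral hβ hμ f hg]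
  set E : Set (RN N × RN N) := {z | ‖z.1‖ₑ ≤ ‖z.2‖ₑ} with hE
  have hEm : MeasurableSet E := measurableSet_le (by fun_prop) (by fun_prop)
  set H : (RN N → ℝ≥0∞) → (RN N → ℝ≥0∞) → RN N × RN N → ℝ≥0∞ := fun f g =>
    E.indicator fun z => ‖z.1‖ₑ ^ (-β) * ‖z.2‖ₑ ^ (-(β + μ)) * (f z.1 * g z.2) with hH
  have hHm : ∀ {f g : RN N → ℝ≥0∞}, Measurable f → Measurable g → Measurable (H f g) :=
    fun hf hg => Measurable.indicator (by fun_prop) hEm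
  set R : RN N × RN N → ℝ≥0∞ := fun z => ‖z.1 - z.2‖ₑ ^ (-(2 * β + μ)) * (f z.1 * g z.2) with hR
  have hRm : Measurable R := by fun_prop
  have hHs : Measurable fun z : RN N × RN N => H g f (z.2, z.1) :=
    (hHm hg hf).comp measurable_swap
  -- The kernel bound assumes `‖x‖ ≤ ‖y‖`; for the opposite order the kernel is symmetric and `f`,
  -- `g` change roles. This is why the Hardy constant enters twice.
  have pt : ∀ x y, steinWeissKernel β μ x y * (f x * g y) ≤
      A * (R (x, y) + H f g (x, y) + H g f (y, x)) := by
    intro x y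
    rcases le_total ‖x‖ₑ ‖y‖ₑ with h | h
    · calc _ ≤ A * (‖x - y‖ₑ ^ (-(2 * β + μ)) + ‖x‖ₑ ^ (-β) * ‖y‖ₑ ^ (-(β + μ))) *
            (f x * g y) := by gcongr; exact steinWeissKernel_le hβ hμ h
        _ = A * (R (x, y) + H f g (x, y)) := by
            have : (x, y) ∈ E := h
            simp only [hR, hH, Set.indicator_of_mem this]
            ring
        _ ≤ _ := mul_le_mul_right le_self_add _
    · calc _ ≤ A * (‖y - x‖ₑ ^ (-(2 * β + μ)) + ‖y‖ₑ ^ (-β) * ‖x‖ₑ ^ (-(β + μ))) *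
            (f x * g y) := by
              rw [steinWeissKernel_comm]
              gcongr
              exact steinWeissKernel_le hβ hμ h
        _ = A * (R (x, y) + H g f (y, x)) := by
            have : (y, x) ∈ E := h
            simp only [hR, hH, Set.indicator_of_mem this]
            rw [← enorm_neg (y - x), neg_sub]
            ring
        _ ≤ _ := mul_le_mul_right (add_le_add le_self_add le_rfl) _
  calc _ ≤ ∫⁻ x, ∫⁻ y, A * (R (x, y) + H f g (x, y) + H g f (y, x)) :=
        lintegral_mono fun x => lintegral_mono fun y => pt x y
    _ = A * ∫⁻ x, ∫⁻ y, (R (x, y) + H f g (x, y) + H g f (y, x)) := by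
        rw [← lintegral_const_mul' _ _ hAt]
        exact lintegral_congr fun x => lintegral_const_mul' _ _ hAt
    _ = A * ((∫⁻ x, ∫⁻ y, R (x, y)) + (∫⁻ x, ∫⁻ y, H f g (x, y)) + ∫⁻ x, ∫⁻ y, H g f (y, x)) := by
        have hHm' := hHm hf hg
        have e1 : Measurable fun x => ∫⁻ y, R (x, y) := Measurable.lintegral_prod_right' hRm
        have e2 : Measurable fun x => ∫⁻ y, H f g (x, y) := Measurable.lintegral_prod_right' hHm'
        have e3 : Measurable fun x => (∫⁻ y, R (x, y)) + ∫⁻ y, H f g (x, y) := e1.add e2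
        rw [← lintegral_add_left e1, ← lintegral_add_left e3]
        congr 1
        refine lintegral_congr fun x => ?_
        rw [lintegral_add_left (by fun_prop), lintegral_add_left (by fun_prop)]
    _ ≤ A * (c1 + c2 + c2) := by
        gcongr
        · exact h1 f g hf hg hft hgt hf1 hg1
        · exact h2 f g hf hg hft hgt hf1 hg1
        · rw [lintegral_lintegral_swap (by exact hHs.aemeasurable)]
          exact h2 g f hg hf hgt hft hg1 hf1

end

noncomputable section

variable {N : ℕ}

/-! ### The best constant in the Stein–Weiss inequality -/

theorem steinWeissForm_comm {β μ : ℝ} (hβ : 0 ≤ β) (hμ : 0 < μ) {f g : RN N → ℝ≥0∞}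
    (hf : Measurable f) (hg : Measurable g) :
    steinWeissForm β μ f g = steinWeissForm β μ g f := by
  rw [steinWeissForm_eq_lintegral hβ hμ f hg, steinWeissForm_eq_lintegral hβ hμ g hf]
  have hm : Measurable fun z : RN N × RN N => steinWeissKernel β μ z.1 z.2 * (f z.1 * g z.2) := by
    fun_prop
  rw [lintegral_lintegral_swap (by exact hm.aemeasurable)]
  refine lintegral_congr fun x => lintegral_congr fun y => ?_
  rw [steinWeissKernel_comm, mul_comm (f y)]

theorem steinWeissForm_mono {β μ : ℝ} {f f' g g' : RN N → ℝ≥0∞}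
    (hf : ∀ x, f x ≤ f' x) (hg : ∀ x, g x ≤ g' x) :
    steinWeissForm β μ f g ≤ steinWeissForm β μ f' g' := by
  unfold steinWeissForm weightedPotential
  gcongr with x y
  · exact hg _
  · exact hf x

@[fun_prop]
theorem measurable_weightedPotential (β μ : ℝ) {g : RN N → ℝ≥0∞} (hg : Measurable g) :
    Measurable (weightedPotential β μ g) := by
  unfold weightedPotential
  exact Measurable.lintegral_prod_right'
    (f := fun z : RN N × RN N => g z.2 / (‖z.2‖ₑ ^ β * ‖z.1 - z.2‖ₑ ^ μ)) (by fun_prop)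

theorem steinWeissForm_eq_lintegral_mul (β μ : ℝ) (f g : RN N → ℝ≥0∞) :
    steinWeissForm β μ f g = ∫⁻ x, f x * (weightedPotential β μ g x / ‖x‖ₑ ^ β) :=
  lintegral_congr fun x => by simp only [div_eq_mul_inv]; ring

theorem steinWeissForm_add_left {β μ : ℝ} {f f' g : RN N → ℝ≥0∞} (hf : Measurable f)
    (hg : Measurable g) :
    steinWeissForm β μ (f + f') g = steinWeissForm β μ f g + steinWeissForm β μ f' g := by
  simp only [steinWeissForm_eq_lintegral_mul, Pi.add_apply, add_mul]
  exact lintegral_add_left (by fun_prop) _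

theorem steinWeissForm_add_right {β μ : ℝ} (hβ : 0 ≤ β) (hμ : 0 < μ) {f g g' : RN N → ℝ≥0∞}
    (hf : Measurable f) (hg : Measurable g) (hg' : Measurable g') :
    steinWeissForm β μ f (g + g') = steinWeissForm β μ f g + steinWeissForm β μ f g' := by
  rw [steinWeissForm_comm hβ hμ hf (hg.add hg'), steinWeissForm_add_left hg hf,
    steinWeissForm_comm hβ hμ hg hf, steinWeissForm_comm hβ hμ hg' hf]

theorem steinWeissForm_const_mul {β μ : ℝ} (hβ : 0 ≤ β) (hμ : 0 < μ) {f g : RN N → ℝ≥0∞}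
    (hg : Measurable g) {a b : ℝ≥0∞} (ha : a ≠ ⊤) (hb : b ≠ ⊤) :
    steinWeissForm β μ (fun x => a * f x) (fun x => b * g x) =
      a * b * steinWeissForm β μ f g := by
  rw [steinWeissForm_eq_lintegral hβ hμ _ (hg.const_mul b), steinWeissForm_eq_lintegral hβ hμ f hg,
    ← lintegral_const_mul' _ _ (ENNReal.mul_ne_top ha hb)]
  refine lintegral_congr fun x => ?_
  rw [← lintegral_const_mul' _ _ (ENNReal.mul_ne_top ha hb)]
  exact lintegral_congr fun y => by ring

theorem ae_eq_zero_of_lintegral_rpow_eq_zero {t : ℝ} (ht : 0 < t) {f : RN N → ℝ≥0∞}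
    (hf : Measurable f) (h : ∫⁻ x, f x ^ t = 0) : f =ᵐ[volume] 0 := by
  rw [lintegral_eq_zero_iff (by fun_prop)] at h
  filter_upwards [h] with x hx
  simpa [ENNReal.rpow_eq_zero_iff_of_pos ht] using hx

theorem exists_steinWeissForm_le {β μ t : ℝ} (hβ : 0 ≤ β) (hμ : 0 < μ)
    (hβμ : 2 * β + μ < N) (ht : t = 2 * N / (2 * N - 2 * β - μ)) :
    ∃ c : ℝ≥0∞, c < ⊤ ∧ ∀ f g : RN N → ℝ≥0∞, Measurable f → Measurable g →
      (∀ x, f x ≠ ⊤) → (∀ x, g x ≠ ⊤) → ∫⁻ x, f x ^ t ≠ ⊤ → ∫⁻ x, g x ^ t ≠ ⊤ →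
        steinWeissForm β μ f g ≤ c * (∫⁻ x, f x ^ t) ^ (1 / t) * (∫⁻ x, g x ^ t) ^ (1 / t) := by
  have ht' : t = 2 * N / (2 * N - (2 * β + μ)) := by rw [ht, sub_sub]
  have ht0 : 0 < t := by rw [ht']; exact div_pos (by linarith) (by linarith)
  have hti : 0 < 1 / t := by positivity
  obtain ⟨c, hc, h⟩ := exists_steinWeissForm_le_of_normalized hβ hμ hβμ ht'
  refine ⟨c, hc, fun f g hf hg hft hgt hf1 hg1 => ?_⟩
  have z : steinWeissForm β μ (0 : RN N → ℝ≥0∞) 0 = 0 := by simp [steinWeissForm]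
  have zl : ∀ g : RN N → ℝ≥0∞, steinWeissForm β μ (0 : RN N → ℝ≥0∞) g = 0 := by
    simp [steinWeissForm]
  rcases eq_or_ne (∫⁻ x, f x ^ t) 0 with hf0 | hf0
  · rw [steinWeissForm_congr_ae (ae_eq_zero_of_lintegral_rpow_eq_zero ht0 hf hf0)
      (ae_eq_refl g), zl]
    exact zero_le
  rcases eq_or_ne (∫⁻ x, g x ^ t) 0 with hg0 | hg0
  · rw [steinWeissForm_comm hβ hμ hf hg, steinWeissForm_congr_ae
      (ae_eq_zero_of_lintegral_rpow_eq_zero ht0 hg hg0) (ae_eq_refl f), zl]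
    exact zero_le
  have norm : ∀ f : RN N → ℝ≥0∞, ∫⁻ x, f x ^ t ≠ ⊤ → ∫⁻ x, f x ^ t ≠ 0 →
      ((∫⁻ x, f x ^ t) ^ (1 / t))⁻¹ ≠ ⊤ ∧ (∫⁻ x, f x ^ t) ^ (1 / t) ≠ 0 ∧
      (∫⁻ x, f x ^ t) ^ (1 / t) ≠ ⊤ ∧
      ∫⁻ x, (((∫⁻ x, f x ^ t) ^ (1 / t))⁻¹ * f x) ^ t ≤ 1 := by
    intro f h1 h0
    have h0' : (∫⁻ x, f x ^ t) ^ (1 / t) ≠ 0 :=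
      (ENNReal.rpow_pos (pos_iff_ne_zero.2 h0) h1).ne'
    refine ⟨ENNReal.inv_ne_top.2 h0', h0', ENNReal.rpow_ne_top_of_nonneg hti.le h1, ?_⟩
    simp only [ENNReal.mul_rpow_of_nonneg _ _ ht0.le]
    rw [lintegral_const_mul' _ _ (ENNReal.rpow_ne_top_of_nonneg ht0.le (ENNReal.inv_ne_top.2 h0')),
      ENNReal.inv_rpow, ← ENNReal.rpow_mul, one_div_mul_cancel ht0.ne', ENNReal.rpow_one,
      ENNReal.inv_mul_cancel h0 h1]
  obtain ⟨f1, f2, f3, f4⟩ := norm f hf1 hf0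
  obtain ⟨g1, g2, g3, g4⟩ := norm g hg1 hg0
  set a := (∫⁻ x, f x ^ t) ^ (1 / t)
  set b := (∫⁻ x, g x ^ t) ^ (1 / t)
  have key := h (fun x => a⁻¹ * f x) (fun x => b⁻¹ * g x) (hf.const_mul _) (hg.const_mul _)
    (fun x => ENNReal.mul_ne_top f1 (hft x)) (fun x => ENNReal.mul_ne_top g1 (hgt x)) f4 g4
  rw [steinWeissForm_const_mul hβ hμ hg f1 g1] at key
  calc steinWeissForm β μ f g
      = (a * a⁻¹) * (b * b⁻¹) * steinWeissForm β μ f g := by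
        rw [ENNReal.mul_inv_cancel f2 f3, ENNReal.mul_inv_cancel g2 g3, one_mul, one_mul]
    _ = a * b * (a⁻¹ * b⁻¹ * steinWeissForm β μ f g) := by ring
    _ ≤ a * b * c := by gcongr
    _ = _ := by ring

theorem eLpNorm_ofReal_eq {F : Type*} [NormedAddCommGroup F] {t : ℝ} (ht : 0 < t) (f : RN N → F) :
    eLpNorm f (ENNReal.ofReal t) volume = (∫⁻ x, ‖f x‖ₑ ^ t) ^ (1 / t) := by
  rw [eLpNorm_eq_lintegral_rpow_enorm_toReal (by simpa using ht) ENNReal.ofReal_ne_top,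
    ENNReal.toReal_ofReal ht.le]

theorem steinWeissConst_lt_top {β μ : ℝ} (hβ : 0 ≤ β) (hμ : 0 < μ) (hβμ : 2 * β + μ < N) :
    steinWeissConst N β μ < ⊤ := by
  have ht0 : (0 : ℝ) < 2 * N / (2 * N - 2 * β - μ) := div_pos (by linarith) (by linarith)
  obtain ⟨c, hc, h⟩ := exists_steinWeissForm_le (N := N) hβ hμ hβμ rfl
  refine lt_of_le_of_lt (sInf_le ?_) hc
  intro f g hf hg
  have fin : ∀ f : RN N → ℝ, MemLp f (ENNReal.ofReal (2 * N / (2 * N - 2 * β - μ))) volume →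
      ∫⁻ x, ‖f x‖ₑ ^ (2 * N / (2 * N - 2 * β - μ) : ℝ) ≠ ⊤ := by
    intro f hf h0
    have := hf.2
    rw [eLpNorm_ofReal_eq ht0, h0, ENNReal.top_rpow_of_pos (by positivity)] at this
    exact lt_irrefl _ this
  have ae : ∀ f : RN N → ℝ, ∀ hf : AEStronglyMeasurable f volume,
      (fun x => ‖f x‖ₑ) =ᵐ[volume] fun x => ‖hf.mk f x‖ₑ := fun f hf =>
    hf.ae_eq_mk.mono fun x hx => by simp only [hx]
  have aei : ∀ f : RN N → ℝ, ∀ hf : AEStronglyMeasurable f volume,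
      ∫⁻ x, ‖f x‖ₑ ^ (2 * N / (2 * N - 2 * β - μ) : ℝ) =
        ∫⁻ x, ‖hf.mk f x‖ₑ ^ (2 * N / (2 * N - 2 * β - μ) : ℝ) := fun f hf =>
    lintegral_congr_ae (hf.ae_eq_mk.mono fun x hx => by simp only [← hx])
  rw [eLpNorm_ofReal_eq ht0, eLpNorm_ofReal_eq ht0, aei f hf.1, aei g hg.1,
    steinWeissForm_congr_ae (ae f hf.1) (ae g hg.1)]
  refine h _ _ hf.1.stronglyMeasurable_mk.measurable.enorm
    hg.1.stronglyMeasurable_mk.measurable.enorm (fun _ => enorm_ne_top) (fun _ => enorm_ne_top) ?_ ?_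
  · rw [← aei]; exact fin f hf
  · rw [← aei]; exact fin g hg

/-- The infimum defining the constant is itself admissible. The constant is tested on real
functions, so `f` and `g`, finite almost everywhere, are replaced by their `toReal`. -/
theorem steinWeissForm_le {β μ t : ℝ} (hβ : 0 ≤ β) (hμ : 0 < μ) (hβμ : 2 * β + μ < N)
    (ht : t = 2 * N / (2 * N - 2 * β - μ)) {f g : RN N → ℝ≥0∞} (hf : Measurable f)
    (hg : Measurable g) (hf1 : ∫⁻ x, f x ^ t ≠ ⊤) (hg1 : ∫⁻ x, g x ^ t ≠ ⊤) :
    steinWeissForm β μ f g ≤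
      steinWeissConst N β μ * (∫⁻ x, f x ^ t) ^ (1 / t) * (∫⁻ x, g x ^ t) ^ (1 / t) := by
  have ht0 : 0 < t := by rw [ht]; exact div_pos (by linarith) (by linarith)
  have toReal : ∀ f : RN N → ℝ≥0∞, Measurable f → ∫⁻ x, f x ^ t ≠ ⊤ →
      (f =ᵐ[volume] fun x => ‖(f x).toReal‖ₑ) := by
    intro f hf h
    filter_upwards [ae_lt_top (hf.pow_const t) h] with x hx
    have hx' : f x ≠ ⊤ := fun h' => by
      rw [h', ENNReal.top_rpow_of_pos ht0] at hx
      exact lt_irrefl _ hx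
    rw [Real.enorm_eq_ofReal ENNReal.toReal_nonneg, ENNReal.ofReal_toReal hx']
  have eN : ∀ f : RN N → ℝ≥0∞, Measurable f → ∫⁻ x, f x ^ t ≠ ⊤ →
      eLpNorm (fun x => (f x).toReal) (ENNReal.ofReal t) volume = (∫⁻ x, f x ^ t) ^ (1 / t) := by
    intro f hf h
    rw [eLpNorm_ofReal_eq ht0]
    congr 1
    refine lintegral_congr_ae ?_
    filter_upwards [toReal f hf h] with x hx
    rw [← hx]
  have mem : ∀ f : RN N → ℝ≥0∞, Measurable f → ∫⁻ x, f x ^ t ≠ ⊤ →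
      MemLp (fun x => (f x).toReal) (ENNReal.ofReal t) volume := by
    intro f hf h
    refine ⟨hf.ennreal_toReal.aestronglyMeasurable, ?_⟩
    rw [eN f hf h]
    exact ENNReal.rpow_lt_top_of_nonneg (by positivity) h
  rw [← eN f hf hf1, ← eN g hg hg1, steinWeissForm_congr_ae (toReal f hf hf1) (toReal g hg hg1),
    mul_assoc]
  set X := eLpNorm (fun x => (f x).toReal) (ENNReal.ofReal t) volume *
    eLpNorm (fun x => (g x).toReal) (ENNReal.ofReal t) volume
  have hX : X ≠ ⊤ := ENNReal.mul_ne_top (mem f hf hf1).2.ne (mem g hg hg1).2.ne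
  have hne := (steinWeissConst_lt_top hβ hμ hβμ).ne
  unfold steinWeissConst at hne ⊢
  -- Multiplication by `X` commutes with the infimum because `X` is finite and the set of admissible
  -- constants is nonempty, its infimum being finite.
  rw [sInf_eq_iInf', ENNReal.iInf_mul']
  · refine le_iInf fun ⟨c, hc⟩ => ?_
    have := hc _ _ (by rw [← ht]; exact mem f hf hf1) (by rw [← ht]; exact mem g hg hg1)
    rwa [← ht, mul_assoc] at this
  · exact fun h0 => absurd h0 hX
  · refine fun _ => Set.Nonempty.to_subtype (Set.nonempty_iff_ne_empty.2 fun h0 => hne ?_)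
    rw [h0, sInf_empty]

/-! ### Duality and weak convergence to zero -/

/-- The converse of Hölder's inequality. Truncating `h` in height and in space makes `I = ∫
h_k^{t'}` finite, and the test function `h_k^(t' - 1)` gives `I ≤ M I^(1/t)`. Dividing yields `I ≤
M^{t'}` uniformly in `k`, and Fatou concludes. -/
theorem lintegral_rpow_lt_top_of_forall_lintegral_mul_le {t t' : ℝ} (hconj : t.HolderConjugate t')
    {h : RN N → ℝ≥0∞} (hh : Measurable h) {M : ℝ≥0∞} (hM : M ≠ ⊤)
    (H : ∀ g : RN N → ℝ≥0∞, Measurable g → ∫⁻ x, g x ^ t ≠ ⊤ →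
      ∫⁻ x, g x * h x ≤ M * (∫⁻ x, g x ^ t) ^ (1 / t)) : ∫⁻ x, h x ^ t' < ⊤ := by
  have ht' := hconj.symm.pos
  set hk : ℕ → RN N → ℝ≥0∞ := fun k => (Metric.ball 0 (k : ℝ)).indicator fun x => min (h x) k
    with hhk
  have hkm : ∀ k, Measurable (hk k) := fun k =>
    (hh.min measurable_const).indicator measurableSet_ball
  have hkle : ∀ k x, hk k x ≤ h x := fun k x => by
    by_cases hx : x ∈ Metric.ball (0 : RN N) k
    · simp [hhk, Set.indicator_of_mem hx]
    · simp [hhk, Set.indicator_of_notMem hx]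
  have fin : ∀ k, ∫⁻ x, hk k x ^ t' ≠ ⊤ := by
    intro k
    refine ne_top_of_le_ne_top ?_ (b := ∫⁻ x in Metric.ball (0 : RN N) k, (k : ℝ≥0∞) ^ t') ?_
    · rw [setLIntegral_const]
      exact ENNReal.mul_ne_top (ENNReal.rpow_ne_top_of_nonneg ht'.le (by simp))
        measure_ball_lt_top.ne
    · rw [← lintegral_indicator measurableSet_ball]
      refine lintegral_mono fun x => ?_
      by_cases hx : x ∈ Metric.ball (0 : RN N) k
      · simp only [hhk, Set.indicator_of_mem hx]
        gcongr
        exact min_le_right _ _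
      · simp [hhk, Set.indicator_of_notMem hx, ht']
  have bound : ∀ k, ∫⁻ x, hk k x ^ t' ≤ M ^ t' := by
    intro k
    set I := ∫⁻ x, hk k x ^ t' with hI
    have e1 : I ≤ M * I ^ (1 / t) := by
      have ex : ∀ x, (hk k x ^ (t' - 1)) ^ t = hk k x ^ t' := fun x => by
        rw [← ENNReal.rpow_mul, hconj.symm.sub_one_mul_conj]
      calc I ≤ ∫⁻ x, hk k x ^ (t' - 1) * h x := by
            refine lintegral_mono fun x => ?_
            calc hk k x ^ t' = hk k x ^ (t' - 1) * hk k x ^ (1 : ℝ) := by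
                  rw [← ENNReal.rpow_add_of_nonneg _ _ hconj.symm.sub_one_pos.le zero_le_one,
                    sub_add_cancel]
              _ ≤ _ := by
                  rw [ENNReal.rpow_one]
                  gcongr
                  exact hkle k x
        _ ≤ M * (∫⁻ x, (hk k x ^ (t' - 1)) ^ t) ^ (1 / t) :=
            H _ ((hkm k).pow_const _) (by simp only [ex]; exact fin k)
        _ = M * I ^ (1 / t) := by simp only [ex, hI]
    rcases eq_or_ne I 0 with h0 | h0
    · rw [h0]; exact zero_le
    have hp : I ^ (1 / t) ≠ 0 := (ENNReal.rpow_pos (pos_iff_ne_zero.2 h0) (fin k)).ne'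
    have hpt : I ^ (1 / t) ≠ ⊤ :=
      ENNReal.rpow_ne_top_of_nonneg (one_div_nonneg.2 hconj.nonneg) (fin k)
    have e2 : I = I ^ (1 / t') * I ^ (1 / t) := by
      rw [← ENNReal.rpow_add _ _ h0 (fin k), one_div, one_div, hconj.symm.inv_add_inv_eq_one,
        ENNReal.rpow_one]
    have e3 : I ^ (1 / t') ≤ M :=
      (ENNReal.mul_le_mul_iff_left hp hpt).1 (le_of_eq_of_le e2.symm e1)
    calc I = (I ^ (1 / t')) ^ t' := by
          rw [← ENNReal.rpow_mul, one_div_mul_cancel ht'.ne', ENNReal.rpow_one]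
      _ ≤ M ^ t' := by gcongr
  have lim : ∀ x, h x ^ t' ≤ liminf (fun k => hk k x ^ t') atTop := by
    intro x
    refine le_of_eq (Tendsto.liminf_eq ?_).symm
    refine (ENNReal.continuous_rpow_const.tendsto _).comp ?_
    have : Tendsto (fun k : ℕ => min (h x) (k : ℝ≥0∞)) atTop (𝓝 (min (h x) ⊤)) :=
      tendsto_const_nhds.min ENNReal.tendsto_nat_nhds_top
    rw [min_top_right] at this
    refine this.congr' ?_
    obtain ⟨n, hn⟩ := exists_nat_gt ‖x‖
    filter_upwards [eventually_ge_atTop n] with k hk'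
    have : x ∈ Metric.ball (0 : RN N) k := by
      rw [mem_ball_zero_iff]
      exact hn.trans_le (by exact_mod_cast hk')
    simp [hhk, Set.indicator_of_mem this]
  calc ∫⁻ x, h x ^ t' ≤ ∫⁻ x, liminf (fun k => hk k x ^ t') atTop := lintegral_mono lim
    _ ≤ liminf (fun k => ∫⁻ x, hk k x ^ t') atTop :=
        lintegral_liminf_le fun k => (hkm k).pow_const _
    _ ≤ M ^ t' := liminf_le_of_le (by isBoundedDefault) fun b hb => by
        obtain ⟨k, hk⟩ := hb.exists
        exact hk.trans (bound k)
    _ < ⊤ := ENNReal.rpow_lt_top_of_nonneg ht'.le hM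

/-- A bounded sequence in `L^t` that tends to zero almost everywhere tends weakly to zero. A Young
inequality with small weight `δ` leaves a part dominated by a multiple of `h^{t'}`, to which
dominated convergence applies, and a remainder `δ ∫ (g n)^t ≤ δ M`. -/
theorem tendsto_lintegral_mul_of_ae_tendsto_zero {t t' : ℝ} (hconj : t.HolderConjugate t')
    {g : ℕ → RN N → ℝ≥0∞} {h : RN N → ℝ≥0∞} (hg : ∀ n, Measurable (g n)) (hh : Measurable h)
    (hae : ∀ᵐ x, Tendsto (fun n => g n x) atTop (𝓝 0)) {M : ℝ≥0∞} (hM : M ≠ ⊤)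
    (hgM : ∀ n, ∫⁻ x, g n x ^ t ≤ M) (hht : ∫⁻ x, h x ^ t' < ⊤) :
    Tendsto (fun n => ∫⁻ x, g n x * h x) atTop (𝓝 0) := by
  rw [ENNReal.tendsto_nhds_zero]
  intro ε hε
  have hε2 : ε / 2 ≠ 0 := (ENNReal.half_pos hε.ne').ne'
  obtain ⟨δ, hδ, hδM⟩ := ENNReal.exists_nnreal_pos_mul_lt hM hε2
  have hδ0 : (δ : ℝ≥0∞) ≠ 0 := by simpa using hδ.ne'
  set c : ℝ≥0∞ := ((δ : ℝ≥0∞) ^ (t' - 1))⁻¹ with hc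
  have hpne : (δ : ℝ≥0∞) ^ (t' - 1) ≠ 0 :=
    (ENNReal.rpow_pos (pos_iff_ne_zero.2 hδ0) ENNReal.coe_ne_top).ne'
  have hpnt : (δ : ℝ≥0∞) ^ (t' - 1) ≠ ⊤ :=
    ENNReal.rpow_ne_top_of_nonneg hconj.symm.sub_one_pos.le ENNReal.coe_ne_top
  have hct : c ≠ ⊤ := ENNReal.inv_ne_top.2 hpne
  -- Compare `h` with `δ g^(t - 1)`. When `h` is the larger, `(t - 1)(t' - 1) = 1` inverts the
  -- relation into `g ≤ c h^(t' - 1)`.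
  have pt : ∀ n x, g n x * h x ≤ min (g n x * h x) (c * h x ^ t') + δ * g n x ^ t := by
    intro n x
    have join : ∀ {q : ℝ}, 1 ≤ q → ∀ a : ℝ≥0∞, a ^ q = a * a ^ (q - 1) := fun hq a => by
      nth_rw 2 [← ENNReal.rpow_one a]
      rw [← ENNReal.rpow_add_of_nonneg _ _ zero_le_one (by linarith), add_sub_cancel]
    rcases le_total (h x) (δ * g n x ^ (t - 1)) with hx | hx
    · refine le_trans ?_ le_add_self
      rw [join hconj.lt.le]
      calc g n x * h x ≤ g n x * (δ * g n x ^ (t - 1)) := by gcongr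
        _ = _ := by ring
    · refine le_trans (le_min le_rfl ?_) le_self_add
      have h1 : (δ : ℝ≥0∞) ^ (t' - 1) * g n x ≤ h x ^ (t' - 1) := by
        calc (δ : ℝ≥0∞) ^ (t' - 1) * g n x = (δ * g n x ^ (t - 1)) ^ (t' - 1) := by
              rw [ENNReal.mul_rpow_of_nonneg _ _ hconj.symm.sub_one_pos.le, ← ENNReal.rpow_mul]
              have : (t - 1) * (t' - 1) = 1 := by
                have := hconj.mul_eq_add
                linarith
              rw [this, ENNReal.rpow_one]
          _ ≤ _ := ENNReal.rpow_le_rpow hx hconj.symm.sub_one_pos.le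
      calc g n x * h x = c * ((δ : ℝ≥0∞) ^ (t' - 1) * g n x) * h x := by
            rw [hc, ← mul_assoc, ENNReal.inv_mul_cancel hpne hpnt, one_mul]
        _ ≤ c * h x ^ (t' - 1) * h x := by gcongr
        _ = _ := by rw [join hconj.symm.lt.le]; ring
  have hfin : ∫⁻ x, c * h x ^ t' ≠ ⊤ := by
    rw [lintegral_const_mul' _ _ hct]
    exact ENNReal.mul_ne_top hct hht.ne
  have hmin : Tendsto (fun n => ∫⁻ x, min (g n x * h x) (c * h x ^ t')) atTop (𝓝 0) := by
    have := tendsto_lintegral_of_dominated_convergence (μ := volume) (f := fun _ : RN N => 0)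
      (F := fun n x => min (g n x * h x) (c * h x ^ t')) (fun x => c * h x ^ t')
      (fun n => ((hg n).mul hh).min (by fun_prop))
      (fun n => ae_of_all _ fun x => min_le_right _ _) hfin ?_
    · simpa using this
    · have hfinite : ∀ᵐ x, h x ^ t' < ⊤ := ae_lt_top (by fun_prop) hht.ne
      filter_upwards [hae, hfinite] with x hx hx'
      have hxt : h x ≠ ⊤ := fun h' => by
        rw [h', ENNReal.top_rpow_of_pos hconj.symm.pos] at hx'
        exact lt_irrefl _ hx'
      have h1 : Tendsto (fun n => g n x * h x) atTop (𝓝 (0 * h x)) :=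
        ENNReal.Tendsto.mul_const hx (Or.inr hxt)
      have h2 := h1.min (tendsto_const_nhds (x := c * h x ^ t'))
      simpa using h2
  rw [ENNReal.tendsto_nhds_zero] at hmin
  filter_upwards [hmin (ε / 2) (pos_iff_ne_zero.2 hε2)] with n hn
  calc ∫⁻ x, g n x * h x
      ≤ ∫⁻ x, (min (g n x * h x) (c * h x ^ t') + δ * g n x ^ t) := lintegral_mono (pt n)
    _ = (∫⁻ x, min (g n x * h x) (c * h x ^ t')) + δ * ∫⁻ x, g n x ^ t := by
        have hm : Measurable fun x => min (g n x * h x) (c * h x ^ t') :=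
          ((hg n).mul hh).min (by fun_prop)
        rw [lintegral_add_left hm, lintegral_const_mul' _ _ ENNReal.coe_ne_top]
    _ ≤ ε / 2 + ε / 2 := add_le_add hn ((mul_le_mul_right (hgM n) _).trans hδM.le)
    _ = ε := ENNReal.add_halves ε

end

noncomputable section

variable {N : ℕ}

/-! ### Vanishing of mixed interactions and control of distant ones -/

theorem steinWeiss_exponent_bounds {β μ t : ℝ} (hβ : 0 ≤ β) (hμ : 0 < μ) (hβμ : 2 * β + μ < N)
    (ht : t = 2 * N / (2 * N - 2 * β - μ)) : 1 < t ∧ t < 2 := by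
  have hd : 0 < 2 * N - 2 * β - μ := by linarith
  rw [ht]
  exact ⟨by rw [lt_div_iff₀ hd]; linarith, by rw [div_lt_iff₀ hd]; linarith⟩

/-- The Stein–Weiss inequality makes pairing with the weighted potential of `f` bounded on `L^t`.
That potential therefore lies in the dual space, where weak convergence applies. -/
theorem tendsto_steinWeissForm_zero {β μ t : ℝ} (hβ : 0 ≤ β) (hμ : 0 < μ) (hβμ : 2 * β + μ < N)
    (ht : t = 2 * N / (2 * N - 2 * β - μ)) {g : ℕ → RN N → ℝ≥0∞} {f : RN N → ℝ≥0∞}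
    (hg : ∀ n, Measurable (g n)) (hf : Measurable f)
    (hae : ∀ᵐ x, Tendsto (fun n => g n x) atTop (𝓝 0)) {M : ℝ≥0∞} (hM : M ≠ ⊤)
    (hgM : ∀ n, ∫⁻ x, g n x ^ t ≤ M) (hf1 : ∫⁻ x, f x ^ t ≠ ⊤) :
    Tendsto (fun n => steinWeissForm β μ (g n) f) atTop (𝓝 0) := by
  obtain ⟨ht1, ht2⟩ := steinWeiss_exponent_bounds hβ hμ hβμ ht
  have hconj := Real.HolderConjugate.conjExponent ht1
  have hm : Measurable fun x => weightedPotential β μ f x / ‖x‖ₑ ^ β := by fun_prop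
  simp only [steinWeissForm_eq_lintegral_mul]
  refine tendsto_lintegral_mul_of_ae_tendsto_zero hconj hg hm hae hM hgM ?_
  refine lintegral_rpow_lt_top_of_forall_lintegral_mul_le hconj hm
    (M := steinWeissConst N β μ * (∫⁻ x, f x ^ t) ^ (1 / t)) ?_ ?_
  · exact ENNReal.mul_ne_top (steinWeissConst_lt_top hβ hμ hβμ).ne
      (ENNReal.rpow_ne_top_of_nonneg (by positivity) hf1)
  · intro g hg hg1
    rw [← steinWeissForm_eq_lintegral_mul]
    refine (steinWeissForm_le hβ hμ hβμ ht hg hf hg1 hf1).trans (le_of_eq (by ring))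

theorem one_le_enorm_rpow_neg {β : ℝ} (hβ : 0 ≤ β) {z : RN N} (hz : z ∈ Metric.ball (0 : RN N) 1) :
    1 ≤ ‖z‖ₑ ^ (-β) := by
  have h : ‖z‖ₑ ≤ 1 := by
    rw [← ofReal_norm, ENNReal.ofReal_le_one]
    exact (mem_ball_zero_iff.1 hz).le
  simpa using ENNReal.rpow_neg_le_rpow_neg hβ h

/-- Interaction at positive distance is controlled by the interactions with a fixed bounded
function. -/
theorem exists_steinWeissForm_far_le {β μ : ℝ} (hβ : 0 ≤ β) (hμ : 0 < μ) {R d : ℝ} (hR : 0 ≤ R)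
    (hd : 0 < d) :
    ∃ c : ℝ≥0∞, c < ⊤ ∧ ∀ f g : RN N → ℝ≥0∞, Measurable f → Measurable g →
      ∀ A V : Set (RN N), MeasurableSet A → MeasurableSet V → (∀ x ∈ A, ‖x‖ ≤ R) →
        (∀ x ∈ A, ∀ y ∉ V, d ≤ dist x y) →
        steinWeissForm β μ (A.indicator f) (Vᶜ.indicator g) ≤
          c * steinWeissForm β μ f ((Metric.ball (0 : RN N) 1).indicator fun _ => 1) *
            steinWeissForm β μ g ((Metric.ball (0 : RN N) 1).indicator fun _ => 1) := by
  set B : Set (RN N) := Metric.ball 0 1 with hB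
  have hBm : MeasurableSet B := measurableSet_ball
  set v : ℝ≥0∞ := volume B with hv
  have hv0 : v ≠ 0 := (Metric.measure_ball_pos volume _ one_pos).ne'
  have hvt : v ≠ ⊤ := measure_ball_lt_top.ne
  set m1 : ℝ≥0∞ := ENNReal.ofReal (1 + R) with hm1
  set m2 : ℝ≥0∞ := ENNReal.ofReal ((1 + R) / d + 1) with hm2
  have hm10 : m1 ≠ 0 := by simp [hm1]; linarith
  have hm20 : m2 ≠ 0 := by
    simp only [hm2, ne_eq, ENNReal.ofReal_eq_zero, not_le]
    positivity
  -- `h x` is the kernel integrated over the unit ball in its second variable. The aim is to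
  -- dominate the kernel at distant points by a multiple of `h x * h y`, which decouples the
  -- variables.
  set h : RN N → ℝ≥0∞ := fun x =>
    weightedPotential β μ (B.indicator fun _ => 1) x / ‖x‖ₑ ^ β with hh
  have hbm : Measurable (B.indicator fun _ : RN N => (1 : ℝ≥0∞)) :=
    measurable_const.indicator hBm
  have hhm : Measurable h := by fun_prop
  have hker : ∀ x, h x = ∫⁻ z in B, steinWeissKernel β μ x z := by
    intro x
    have := weightedPotential_mul_div hβ hμ hbm 1 x
    rw [mul_one_div] at this
    rw [hh]
    simp only [this, one_mul]
    rw [← lintegral_indicator hBm]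
    refine lintegral_congr fun z => ?_
    by_cases hz : z ∈ B <;> simp [hz]
  refine ⟨(v * v)⁻¹ * (m1 ^ μ * m2 ^ μ), ?_, ?_⟩
  · refine ENNReal.mul_lt_top (ENNReal.inv_lt_top.2 (pos_iff_ne_zero.2 (mul_ne_zero hv0 hv0)))
      (ENNReal.mul_lt_top ?_ ?_) <;> exact ENNReal.rpow_lt_top_of_nonneg hμ.le ENNReal.ofReal_ne_top
  intro f g hf hg A V hA hV hAR hAV
  -- For `x ∈ A` and `z` in the unit ball, `‖x - z‖ ≤ 1 + R` and `‖z‖^(-β) ≥ 1`.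
  have near : ∀ x ∈ A, v * ‖x‖ₑ ^ (-β) ≤ m1 ^ μ * h x := by
    intro x hx
    rw [hker, ← lintegral_const_mul' _ _ (ENNReal.rpow_ne_top_of_nonneg hμ.le ENNReal.ofReal_ne_top),
      mul_comm, ← setLIntegral_const]
    refine setLIntegral_mono' hBm fun z hz => ?_
    have h1 : ‖x - z‖ₑ ≤ m1 * 1 := by
      rw [mul_one, ← ofReal_norm, hm1]
      apply ENNReal.ofReal_le_ofReal
      have := mem_ball_zero_iff.1 hz
      linarith [norm_sub_le x z, hAR x hx]
    have h2 := ENNReal.rpow_neg_le_mul_rpow_neg hμ.le hm10 ENNReal.ofReal_ne_top h1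
    rw [ENNReal.one_rpow] at h2
    calc ‖x‖ₑ ^ (-β) = ‖x‖ₑ ^ (-β) * 1 * 1 := by ring
      _ ≤ ‖x‖ₑ ^ (-β) * (m1 ^ μ * ‖x - z‖ₑ ^ (-μ)) * ‖z‖ₑ ^ (-β) := by
          gcongr
          exact one_le_enorm_rpow_neg hβ hz
      _ = _ := by unfold steinWeissKernel; ring
  -- Here `‖y - z‖ ≤ 1 + R + ‖x - y‖`, and `d ≤ ‖x - y‖` absorbs `1 + R`; this is the origin of
  -- `m2`.
  have far : ∀ x ∈ A, ∀ y ∉ V, v * (‖x - y‖ₑ ^ (-μ) * ‖y‖ₑ ^ (-β)) ≤ m2 ^ μ * h y := by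
    intro x hx y hy
    rw [hker, ← lintegral_const_mul' _ _ (ENNReal.rpow_ne_top_of_nonneg hμ.le ENNReal.ofReal_ne_top),
      mul_comm, ← setLIntegral_const]
    refine setLIntegral_mono' hBm fun z hz => ?_
    have h1 : ‖y - z‖ₑ ≤ m2 * ‖x - y‖ₑ := by
      rw [← ofReal_norm, ← ofReal_norm, hm2, ← ENNReal.ofReal_mul (by positivity)]
      apply ENNReal.ofReal_le_ofReal
      have e1 := mem_ball_zero_iff.1 hz
      have e2 := hAV x hx y hy
      rw [dist_eq_norm] at e2
      have e3 : ‖y - z‖ ≤ 1 + R + ‖x - y‖ := by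
        calc ‖y - z‖ = ‖(x - z) - (x - y)‖ := by congr 1; abel
          _ ≤ ‖x - z‖ + ‖x - y‖ := norm_sub_le _ _
          _ ≤ _ := by linarith [norm_sub_le x z, hAR x hx]
      have e4 : 1 + R ≤ (1 + R) / d * ‖x - y‖ := by
        rw [div_mul_eq_mul_div, le_div_iff₀ hd]
        gcongr
      linarith
    have h2 := ENNReal.rpow_neg_le_mul_rpow_neg hμ.le hm20 ENNReal.ofReal_ne_top h1
    calc ‖x - y‖ₑ ^ (-μ) * ‖y‖ₑ ^ (-β) = ‖x - y‖ₑ ^ (-μ) * ‖y‖ₑ ^ (-β) * 1 := by ring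
      _ ≤ (m2 ^ μ * ‖y - z‖ₑ ^ (-μ)) * ‖y‖ₑ ^ (-β) * ‖z‖ₑ ^ (-β) := by
          gcongr
          exact one_le_enorm_rpow_neg hβ hz
      _ = _ := by unfold steinWeissKernel; ring
  have hprod : ∀ x y, steinWeissKernel β μ x y * (A.indicator f x * Vᶜ.indicator g y) ≤
      ((v * v)⁻¹ * (m1 ^ μ * m2 ^ μ)) * ((f x * h x) * (g y * h y)) := by
    intro x y
    by_cases hx : x ∈ A
    · by_cases hy : y ∈ V
      · simp [hy]
      · have hy' : y ∈ Vᶜ := hy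
        rw [Set.indicator_of_mem hx, Set.indicator_of_mem hy']
        have hvv : v * v ≠ ⊤ := ENNReal.mul_ne_top hvt hvt
        calc steinWeissKernel β μ x y * (f x * g y)
            = ((v * v)⁻¹ * (v * v)) * (steinWeissKernel β μ x y * (f x * g y)) := by
              rw [ENNReal.inv_mul_cancel (mul_ne_zero hv0 hv0) hvv, one_mul]
          _ = (v * v)⁻¹ * ((v * ‖x‖ₑ ^ (-β)) * (v * (‖x - y‖ₑ ^ (-μ) * ‖y‖ₑ ^ (-β)))
                * (f x * g y)) := by unfold steinWeissKernel; ring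
          _ ≤ (v * v)⁻¹ * ((m1 ^ μ * h x) * (m2 ^ μ * h y) * (f x * g y)) :=
              mul_le_mul' le_rfl (mul_le_mul' (mul_le_mul' (near x hx) (far x hx y hy)) le_rfl)
          _ = _ := by ring
    · simp [hx]
  rw [steinWeissForm_eq_lintegral hβ hμ _ (hg.indicator hV.compl),
    steinWeissForm_eq_lintegral_mul, steinWeissForm_eq_lintegral_mul]
  have hcm : ∀ c : ℝ≥0∞, ∫⁻ x, ∫⁻ y, c * ((f x * h x) * (g y * h y)) =
      c * (∫⁻ x, f x * h x) * ∫⁻ y, g y * h y := by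
    intro c
    have : ∀ x, ∫⁻ y, c * ((f x * h x) * (g y * h y)) = c * (f x * h x) * ∫⁻ y, g y * h y := by
      intro x
      rw [← lintegral_const_mul _ (by fun_prop)]
      exact lintegral_congr fun y => by ring
    simp only [this]
    rw [lintegral_mul_const _ (by fun_prop), lintegral_const_mul _ (by fun_prop)]
  rw [← hcm]
  exact lintegral_mono fun x => lintegral_mono fun y => hprod x y

end

noncomputable section

variable {N : ℕ}

/-! ### Vague convergence -/

theorem exists_cutoff {K U : Set (RN N)} (hK : IsCompact K) (hU : IsOpen U) (hKU : K ⊆ U) :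
    ∃ φ : RN N → ℝ, Continuous φ ∧ HasCompactSupport φ ∧ (∀ x ∈ K, φ x = 1) ∧ tsupport φ ⊆ U ∧
      ∀ x, 0 ≤ φ x ∧ φ x ≤ 1 := by
  obtain ⟨L, hL, hKL, hLU⟩ := exists_compact_between hK hU hKU
  obtain ⟨φ, h1, h0, hc, h01⟩ := exists_continuous_one_zero_of_isCompact hK
    (isOpen_interior (s := L)).isClosed_compl (Set.disjoint_compl_right_iff_subset.2 hKL)
  refine ⟨φ, φ.continuous, hc, fun x hx => h1 hx, ?_, fun x => h01 x⟩
  refine (closure_minimal (fun x hx => ?_) hL.isClosed).trans hLU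
  by_contra hxL
  exact hx (h0 fun hx' => hxL (interior_subset hx'))

theorem ofReal_mem_of_cutoff {K U : Set (RN N)} {φ : RN N → ℝ} (h1 : ∀ x ∈ K, φ x = 1)
    (hs : tsupport φ ⊆ U) (h01 : ∀ x, 0 ≤ φ x ∧ φ x ≤ 1) (x : RN N) :
    K.indicator 1 x ≤ ENNReal.ofReal (φ x) ∧ ENNReal.ofReal (φ x) ≤ U.indicator 1 x := by
  constructor
  · by_cases hx : x ∈ K <;> simp [hx, h1]
  · by_cases hx : x ∈ U
    · simpa [hx] using (h01 x).2
    · have : φ x = 0 := image_eq_zero_of_notMem_tsupport fun h => hx (hs h)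
      simp [this]

theorem measure_le_lintegral_cutoff (m : Measure (RN N)) {K : Set (RN N)} (hK : MeasurableSet K)
    {φ : RN N → ℝ} (h1 : ∀ x ∈ K, φ x = 1) : m K ≤ ∫⁻ x, ENNReal.ofReal (φ x) ∂m := by
  rw [← lintegral_indicator_one hK]
  refine lintegral_mono fun x => ?_
  by_cases hx : x ∈ K <;> simp [hx, h1]

theorem lintegral_cutoff_le_measure (m : Measure (RN N)) {U : Set (RN N)} (hU : MeasurableSet U)
    {φ : RN N → ℝ} (hs : tsupport φ ⊆ U) (h01 : ∀ x, 0 ≤ φ x ∧ φ x ≤ 1) :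
    ∫⁻ x, ENNReal.ofReal (φ x) ∂m ≤ m U := by
  rw [← lintegral_indicator_one hU]
  exact lintegral_mono fun x => (ofReal_mem_of_cutoff (K := ∅) (by simp) hs h01 x).2

theorem lintegral_cutoff_ne_top (m : Measure (RN N)) [IsFiniteMeasure m] {φ : RN N → ℝ}
    (h01 : ∀ x, 0 ≤ φ x ∧ φ x ≤ 1) : ∫⁻ x, ENNReal.ofReal (φ x) ∂m ≠ ⊤ :=
  ne_top_of_le_ne_top (measure_ne_top m Set.univ)
    (lintegral_cutoff_le_measure m .univ (Set.subset_univ _) h01)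

/-- Vague convergence is defined with Bochner integrals. Since all the masses are finite, `toReal`
loses nothing and the limit lifts to `ℝ≥0∞`. -/
theorem TendstoMeasure.tendsto_lintegral {f : ℕ → RN N → ℝ≥0∞} {m : Measure (RN N)}
    [IsFiniteMeasure m] (h : TendstoMeasure f m) (hf : ∀ n, Measurable (f n))
    (hfin : ∀ n, ∫⁻ x, f n x ≠ ⊤) {φ : RN N → ℝ} (hφ : Continuous φ) (hc : HasCompactSupport φ)
    (h01 : ∀ x, 0 ≤ φ x ∧ φ x ≤ 1) :
    Tendsto (fun n => ∫⁻ x, ENNReal.ofReal (φ x) * f n x) atTop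
      (𝓝 (∫⁻ x, ENNReal.ofReal (φ x) ∂m)) := by
  have hfi : ∀ n, IsFiniteMeasure (volume.withDensity (f n)) := fun n =>
    isFiniteMeasure_withDensity (hfin n)
  have e : ∀ n, ∫⁻ x, ENNReal.ofReal (φ x) ∂(volume.withDensity (f n)) =
      ∫⁻ x, ENNReal.ofReal (φ x) * f n x := fun n => by
    rw [lintegral_withDensity_eq_lintegral_mul _ (hf n) (by fun_prop)]
    exact lintegral_congr fun x => mul_comm _ _
  have hφm : Measurable φ := hφ.measurable
  have h2 := h φ hφ hc
  rw [integral_eq_lintegral_of_nonneg_ae (ae_of_all _ fun x => (h01 x).1)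
    hφm.aestronglyMeasurable] at h2
  simp only [fun n => integral_eq_lintegral_of_nonneg_ae (μ := volume.withDensity (f n))
    (ae_of_all _ fun x => (h01 x).1) hφm.aestronglyMeasurable, e] at h2
  refine (ENNReal.tendsto_toReal_iff (fun n => ?_) (lintegral_cutoff_ne_top m h01)).1 h2
  rw [← e]
  exact lintegral_cutoff_ne_top _ h01

theorem limsup_add_le_of_tendsto {a b : ℕ → ℝ≥0∞} {l : ℝ≥0∞} (hl : l ≠ ⊤)
    (hb : Tendsto b atTop (𝓝 l)) :
    limsup (fun n => a n + b n) atTop ≤ limsup a atTop + l := by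
  refine ENNReal.le_of_forall_pos_le_add fun ε hε _ => ?_
  have h1 : ∀ᶠ n in atTop, b n ≤ l + ε :=
    hb.eventually_le_const (ENNReal.lt_add_right hl (by simpa using hε.ne'))
  calc limsup (fun n => a n + b n) atTop ≤ limsup (fun n => a n + (l + ε)) atTop :=
        limsup_le_limsup (h1.mono fun n hn => add_le_add le_rfl hn)
    _ = limsup a atTop + (l + ε) := limsup_add_const _ _ _ (by isBoundedDefault)
        (by isBoundedDefault)
    _ = _ := (add_assoc _ _ _).symm

theorem le_limsup_add_of_tendsto {a b : ℕ → ℝ≥0∞} {l : ℝ≥0∞} (hl : l ≠ ⊤)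
    (hb : Tendsto b atTop (𝓝 l)) :
    limsup a atTop + l ≤ limsup (fun n => a n + b n) atTop := by
  refine ENNReal.le_of_forall_pos_le_add fun ε hε _ => ?_
  have h1 : ∀ᶠ n in atTop, l ≤ b n + ε := by
    have h2 : Tendsto (fun n => b n + (ε : ℝ≥0∞)) atTop (𝓝 (l + ε)) := hb.add_const _
    exact h2.eventually_const_le (ENNReal.lt_add_right hl (by simpa using hε.ne'))
  calc limsup a atTop + l = limsup (fun n => a n + l) atTop :=
        (limsup_add_const _ _ _ (by isBoundedDefault) (by isBoundedDefault)).symm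
    _ ≤ limsup (fun n => (a n + b n) + ε) atTop :=
        limsup_le_limsup (h1.mono fun n hn => (add_le_add le_rfl hn).trans (add_assoc _ _ _).ge)
    _ = _ := limsup_add_const _ _ _ (by isBoundedDefault) (by isBoundedDefault)

/-- Take a cutoff that is one on the ball of radius `R` and supported in the ball of radius `R + 1`.
Together with the exterior of radius `R` it covers the space, which gives `≤`; it does not overlap
the exterior of radius `R + 1`, which gives `≥`. The cutoff part has an actual limit, so it
separates from the limsup. -/
theorem TendstoMeasure.limsup_lintegral {f : ℕ → RN N → ℝ≥0∞} {m : Measure (RN N)}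
    [IsFiniteMeasure m] (h : TendstoMeasure f m) (hf : ∀ n, Measurable (f n))
    (hfin : ∀ n, ∫⁻ x, f n x ≠ ⊤) :
    limsup (fun n => ∫⁻ x, f n x) atTop = massAtInfinity f + m Set.univ := by
  have cut : ∀ R : ℝ, ∃ φ : RN N → ℝ, Continuous φ ∧ HasCompactSupport φ ∧
      (∀ x ∈ Metric.closedBall 0 R, φ x = 1) ∧ tsupport φ ⊆ Metric.ball 0 (R + 1) ∧
      ∀ x, 0 ≤ φ x ∧ φ x ≤ 1 := fun R =>
    exists_cutoff (isCompact_closedBall 0 R) Metric.isOpen_ball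
      (Metric.closedBall_subset_ball (by linarith))
  have hset : ∀ R : ℝ, MeasurableSet {x : RN N | R ≤ ‖x‖} := fun R =>
    measurableSet_le measurable_const measurable_norm
  apply le_antisymm
  · unfold massAtInfinity
    rw [ENNReal.iInf_add]
    refine le_iInf fun R => ?_
    obtain ⟨φ, hφ, hc, h1, hs, h01⟩ := cut R
    have ht := h.tendsto_lintegral hf hfin hφ hc h01
    calc limsup (fun n => ∫⁻ x, f n x) atTop
        ≤ limsup (fun n => (∫⁻ x in {x : RN N | R ≤ ‖x‖}, f n x) +
            ∫⁻ x, ENNReal.ofReal (φ x) * f n x) atTop := by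
          refine limsup_le_limsup (Eventually.of_forall fun n => ?_)
          change ∫⁻ x, f n x ≤ _
          rw [← lintegral_add_compl _ (hset R)]
          refine add_le_add le_rfl ?_
          rw [← lintegral_indicator (hset R).compl]
          refine lintegral_mono fun x => ?_
          by_cases hx : R ≤ ‖x‖
          · simp [hx]
          · have : φ x = 1 := h1 x (mem_closedBall_zero_iff.2 (not_le.1 hx).le)
            simp [hx, this]
      _ ≤ _ := limsup_add_le_of_tendsto (lintegral_cutoff_ne_top m h01) ht
      _ ≤ _ := add_le_add le_rfl (lintegral_cutoff_le_measure m .univ (Set.subset_univ _) h01)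
  · have step : ∀ R : ℝ, massAtInfinity f + m (Metric.closedBall 0 R) ≤
        limsup (fun n => ∫⁻ x, f n x) atTop := by
      intro R
      obtain ⟨φ, hφ, hc, h1, hs, h01⟩ := cut R
      have ht := h.tendsto_lintegral hf hfin hφ hc h01
      calc massAtInfinity f + m (Metric.closedBall 0 R)
          ≤ limsup (fun n => ∫⁻ x in {x : RN N | R + 1 ≤ ‖x‖}, f n x) atTop +
            ∫⁻ x, ENNReal.ofReal (φ x) ∂m :=
            add_le_add (iInf_le _ _) (measure_le_lintegral_cutoff m measurableSet_closedBall h1)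
        _ ≤ limsup (fun n => (∫⁻ x in {x : RN N | R + 1 ≤ ‖x‖}, f n x) +
              ∫⁻ x, ENNReal.ofReal (φ x) * f n x) atTop :=
            le_limsup_add_of_tendsto (lintegral_cutoff_ne_top m h01) ht
        _ ≤ _ := by
            refine limsup_le_limsup (Eventually.of_forall fun n => ?_)
            change (∫⁻ x in {x : RN N | R + 1 ≤ ‖x‖}, f n x) +
              (∫⁻ x, ENNReal.ofReal (φ x) * f n x) ≤ ∫⁻ x, f n x
            rw [← lintegral_indicator (hset _), ← lintegral_add_left ((hf n).indicator (hset _))]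
            refine lintegral_mono fun x => ?_
            by_cases hx : R + 1 ≤ ‖x‖
            · have : φ x = 0 := image_eq_zero_of_notMem_tsupport fun h' => by
                have := mem_ball_zero_iff.1 (hs h')
                linarith
              simp [hx, this]
            · simp only [Set.indicator, Set.mem_ofPred_eq, hx, if_false, zero_add]
              exact mul_le_of_le_one_left' (by simpa using (h01 x).2)
    have hmono : Monotone fun k : ℕ => Metric.closedBall (0 : RN N) (k : ℝ) := fun i j hij =>
      Metric.closedBall_subset_closedBall (by exact_mod_cast hij)
    have htend := tendsto_measure_iUnion_atTop (μ := m) hmono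
    rw [Metric.iUnion_closedBall_nat] at htend
    exact le_of_tendsto (tendsto_const_nhds.add htend) (Eventually.of_forall fun k => step k)

/-! ### Comparison of measures -/

theorem measure_le_of_isCompact_le {a b : Measure (RN N)} [IsFiniteMeasure a]
    (h : ∀ K, IsCompact K → a K ≤ b K) : a ≤ b := by
  refine Measure.le_iff.2 fun A hA => ?_
  rw [hA.measure_eq_iSup_isCompact_of_ne_top (measure_ne_top a A)]
  exact iSup₂_le fun K hK => iSup_le fun hc => (h K hc).trans (measure_mono hK)

theorem measure_le_of_lintegral_cutoff_le {a b : Measure (RN N)} [IsFiniteMeasure a]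
    [IsFiniteMeasure b]
    (h : ∀ φ : RN N → ℝ, Continuous φ → HasCompactSupport φ → (∀ x, 0 ≤ φ x ∧ φ x ≤ 1) →
      ∫⁻ x, ENNReal.ofReal (φ x) ∂a ≤ ∫⁻ x, ENNReal.ofReal (φ x) ∂b) : a ≤ b := by
  refine measure_le_of_isCompact_le fun K hK => ?_
  rw [Set.measure_eq_iInf_isOpen K b]
  refine le_iInf₂ fun U hKU => le_iInf fun hU => ?_
  obtain ⟨φ, hφ, hc, h1, hs, h01⟩ := exists_cutoff hK hU hKU
  exact (measure_le_lintegral_cutoff a hK.measurableSet h1).trans ((h φ hφ hc h01).trans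
    (lintegral_cutoff_le_measure b hU.measurableSet hs h01))

/-- Fatou's lemma against every cutoff. -/
theorem TendstoMeasure.withDensity_le {f : ℕ → RN N → ℝ≥0∞} {m : Measure (RN N)}
    [IsFiniteMeasure m] (h : TendstoMeasure f m) (hf : ∀ n, Measurable (f n))
    (hfin : ∀ n, ∫⁻ x, f n x ≠ ⊤) {g : RN N → ℝ≥0∞} (hg : Measurable g) (hgfin : ∫⁻ x, g x ≠ ⊤)
    (hle : ∀ᵐ x, g x ≤ liminf (fun n => f n x) atTop) : volume.withDensity g ≤ m := by
  have := isFiniteMeasure_withDensity (μ := (volume : Measure (RN N))) hgfin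
  refine measure_le_of_lintegral_cutoff_le fun φ hφ hc h01 => ?_
  have ht := h.tendsto_lintegral hf hfin hφ hc h01
  rw [lintegral_withDensity_eq_lintegral_mul _ hg (by fun_prop), ← ht.liminf_eq]
  calc ∫⁻ x, (g * fun x => ENNReal.ofReal (φ x)) x
      ≤ ∫⁻ x, liminf (fun n => ENNReal.ofReal (φ x) * f n x) atTop := by
        refine lintegral_mono_ae (hle.mono fun x hx => ?_)
        rw [Pi.mul_apply, mul_comm]
        rw [ENNReal.liminf_const_mul_of_ne_top ENNReal.ofReal_ne_top]
        gcongr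
    _ ≤ _ := lintegral_liminf_le fun n => by
        have := hf n
        have := hφ.measurable
        fun_prop

/-! ### Atomic measures -/

/-- Outer regularity of `b` shrinks `U` to `K`; inner regularity of `a` then passes from compact to
measurable sets. -/
theorem measure_le_const_mul_rpow {a b : Measure (RN N)} [IsFiniteMeasure a] [IsFiniteMeasure b]
    {C : ℝ≥0∞} (hC : C ≠ ⊤) {s : ℝ} (hs : 0 < s)
    (h : ∀ K U, IsCompact K → IsOpen U → K ⊆ U → a K ≤ C * b U ^ s) {A : Set (RN N)}
    (hA : MeasurableSet A) : a A ≤ C * b A ^ s := by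
  have hK : ∀ K, IsCompact K → a K ≤ C * b K ^ s := by
    intro K hK
    have hcont : Tendsto (fun ε : ℝ≥0∞ => C * (b K + ε) ^ s) (𝓝[>] 0) (𝓝 (C * (b K + 0) ^ s)) := by
      have h1 : Tendsto (fun ε : ℝ≥0∞ => b K + ε) (𝓝[>] 0) (𝓝 (b K + 0)) :=
        (tendsto_const_nhds.add tendsto_id).mono_left nhdsWithin_le_nhds
      exact ENNReal.Tendsto.const_mul ((ENNReal.continuous_rpow_const.tendsto _).comp h1)
        (Or.inr hC)
    rw [add_zero] at hcont
    refine ge_of_tendsto hcont (eventually_mem_nhdsWithin.mono fun ε hε => ?_)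
    obtain ⟨U, hKU, hU, hlt⟩ := K.exists_isOpen_lt_add (measure_ne_top b K) (ne_of_gt hε)
    refine (h K U hK hU hKU).trans ?_
    gcongr
  rw [hA.measure_eq_iSup_isCompact_of_ne_top (measure_ne_top a A)]
  refine iSup₂_le fun K hKA => iSup_le fun hc => (hK K hc).trans ?_
  gcongr

/-- Each point of `S` has an open neighbourhood of `b`-mass below `δ`. On a disjoint refinement of a
countable subcover, `b(V)^s ≤ δ^(s - 1) b(V)`, and summing gives `a S ≤ C δ^(s - 1) b(univ)`. As `s
> 1`, this tends to zero with `δ`. -/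
theorem measure_eq_zero_of_forall_singleton {a b : Measure (RN N)} [IsFiniteMeasure b]
    {C : ℝ≥0∞} (hC : C ≠ ⊤) {s : ℝ} (hs : 1 < s)
    (h : ∀ A, MeasurableSet A → a A ≤ C * b A ^ s) {S : Set (RN N)}
    (hb : ∀ x ∈ S, b {x} = 0) : a S = 0 := by
  have key : ∀ δ : ℝ≥0∞, δ ≠ 0 → a S ≤ C * δ ^ (s - 1) * b Set.univ := by
    intro δ hδ
    have cover : ∀ x : RN N, ∃ U : Set (RN N), IsOpen U ∧ x ∈ U ∧ (x ∈ S → b U < δ) := by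
      intro x
      by_cases hx : x ∈ S
      · obtain ⟨U, hxU, hU, hlt⟩ := Set.exists_isOpen_lt_of_lt {x} δ
          (by rw [hb x hx]; exact pos_iff_ne_zero.2 hδ)
        exact ⟨U, hU, hxU rfl, fun _ => hlt⟩
      · exact ⟨Set.univ, isOpen_univ, trivial, fun h => absurd h hx⟩
    choose U hU hxU hlt using cover
    obtain ⟨T, hTS, hTc, hT⟩ := TopologicalSpace.countable_cover_nhdsWithin (s := S) (f := U)
      fun x _ => mem_nhdsWithin_of_mem_nhds ((hU x).mem_nhds (hxU x))
    rcases T.eq_empty_or_nonempty with h0 | hne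
    · have : S = ∅ := by simpa [h0] using hT
      simp [this]
    obtain ⟨e, he⟩ := hTc.exists_eq_range hne
    set V : ℕ → Set (RN N) := disjointed fun n => U (e n) with hV
    have hVm : ∀ n, MeasurableSet (V n) := fun n =>
      MeasurableSet.disjointed (fun n => (hU (e n)).measurableSet) n
    have hVU : ∀ n, V n ⊆ U (e n) := fun n => disjointed_subset _ n
    have hSV : S ⊆ ⋃ n, V n := by
      rw [hV, iUnion_disjointed]
      refine hT.trans ?_
      rw [he, Set.biUnion_range]
    calc a S ≤ a (⋃ n, V n) := measure_mono hSV
      _ ≤ ∑' n, a (V n) := measure_iUnion_le _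
      _ ≤ ∑' n, C * δ ^ (s - 1) * b (V n) := by
          refine ENNReal.tsum_le_tsum fun n => (h _ (hVm n)).trans ?_
          have e1 : b (V n) ^ s = b (V n) ^ (s - 1) * b (V n) := by
            nth_rw 3 [← ENNReal.rpow_one (b (V n))]
            rw [← ENNReal.rpow_add_of_nonneg _ _ (by linarith) zero_le_one, sub_add_cancel]
          rw [e1, ← mul_assoc]
          have e2 : b (V n) ≤ δ :=
            (measure_mono (hVU n)).trans (hlt (e n) (hTS (he ▸ Set.mem_range_self n))).le
          exact mul_le_mul' (mul_le_mul' le_rfl (ENNReal.rpow_le_rpow e2 (by linarith))) le_rfl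
      _ = C * δ ^ (s - 1) * ∑' n, b (V n) := ENNReal.tsum_mul_left
      _ = C * δ ^ (s - 1) * b (⋃ n, V n) := by
          rw [measure_iUnion (disjoint_disjointed _) hVm]
      _ ≤ _ := by gcongr; exact Set.subset_univ _
  have lim : Tendsto (fun δ : ℝ≥0∞ => C * δ ^ (s - 1) * b Set.univ) (𝓝[>] 0)
      (𝓝 (C * 0 ^ (s - 1) * b Set.univ)) := by
    refine ENNReal.Tendsto.mul_const (ENNReal.Tendsto.const_mul ?_ (Or.inr hC))
      (Or.inr (measure_ne_top b _))
    exact (ENNReal.continuous_rpow_const.tendsto _).mono_left nhdsWithin_le_nhds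
  rw [ENNReal.zero_rpow_of_pos (by linarith), mul_zero, zero_mul] at lim
  exact le_antisymm (ge_of_tendsto lim (eventually_mem_nhdsWithin.mono fun δ hδ =>
    key δ (ne_of_gt hδ))) zero_le

theorem countable_atoms (b : Measure (RN N)) [IsFiniteMeasure b] :
    {x : RN N | b {x} ≠ 0}.Countable := by
  have := Measure.countable_meas_pos_of_disjoint_iUnion (μ := b)
    (As := fun x : RN N => ({x} : Set (RN N))) (fun x => measurableSet_singleton x)
    (fun x y hxy => by simpa using hxy)
  simpa [pos_iff_ne_zero] using this

/-- A finite measure dominated by a power `s > 1` of another one is a countable sum of point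
masses. -/
theorem exists_eq_sum_dirac {a b : Measure (RN N)} [IsFiniteMeasure a] [IsFiniteMeasure b]
    {C : ℝ≥0∞} (hC : C ≠ ⊤) {s : ℝ} (hs : 1 < s)
    (h : ∀ A, MeasurableSet A → a A ≤ C * b A ^ s) :
    ∃ (J : Set ℕ) (z : ℕ → RN N), Set.InjOn z J ∧ (∀ j ∈ J, a {z j} ≠ 0) ∧
      a = Measure.sum fun j : J => a {z j} • Measure.dirac (z j) := by
  set D : Set (RN N) := {x | a {x} ≠ 0} with hD
  have hDc : D.Countable := countable_atoms a
  -- Off its own atoms `a` is split by the atoms of `b`: there are countably many of these, each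
  -- `a`-null in `Dᶜ`, and the rest is null by `measure_eq_zero_of_forall_singleton`.
  have hnull : a Dᶜ = 0 := by
    have hBc := countable_atoms b
    have e1 : a (Dᶜ ∩ {x | b {x} ≠ 0}) = 0 := by
      rw [← Set.biUnion_of_singleton (Dᶜ ∩ {x | b {x} ≠ 0}),
        measure_biUnion_null_iff (hBc.mono Set.inter_subset_right)]
      intro x hx
      by_contra h0
      exact hx.1 h0
    have e2 : a {x | b {x} = 0} = 0 := measure_eq_zero_of_forall_singleton hC hs h fun x hx => hx
    refine measure_mono_null (fun x hx => ?_) (measure_union_null e1 e2)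
    by_cases hb : b {x} = 0
    · exact Or.inr hb
    · exact Or.inl ⟨hx, hb⟩
  -- The index set is the image of the atoms under an injection into `ℕ`, with `z` its inverse; this
  -- covers finite and infinite sets of atoms alike.
  obtain ⟨e, he⟩ := Set.countable_iff_exists_injOn.1 hDc
  have hinv : ∀ x ∈ D, Function.invFunOn e D (e x) = x := fun x hx => he.leftInvOn_invFunOn hx
  refine ⟨e '' D, Function.invFunOn e D, ?_, ?_, ?_⟩
  · rintro _ ⟨x, hx, rfl⟩ _ ⟨y, hy, rfl⟩ hxy
    rw [hinv x hx, hinv y hy] at hxy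
    rw [hxy]
  · rintro _ ⟨x, hx, rfl⟩
    rw [hinv x hx]
    exact hx
  · ext A hA
    rw [Measure.sum_apply _ hA]
    have e1 : a A = ∫⁻ x in D, A.indicator 1 x ∂a := by
      rw [← lintegral_indicator_one hA, ← lintegral_add_compl _ hDc.measurableSet,
        Measure.restrict_eq_zero.2 hnull, lintegral_zero_measure, add_zero]
    rw [e1, lintegral_countable _ hDc]
    refine (Equiv.tsum_eq (Equiv.Set.imageOfInjOn e D he).symm _).symm.trans ?_
    refine tsum_congr fun j => ?_
    obtain ⟨x, hx⟩ := (Equiv.Set.imageOfInjOn e D he).surjective j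
    subst hx
    have hx' : Function.invFunOn e D ((Equiv.Set.imageOfInjOn e D he) x : ℕ) = x := hinv x x.2
    rw [Equiv.symm_apply_apply, hx', Measure.smul_apply, Measure.dirac_apply' _ hA, smul_eq_mul,
      mul_comm]

end

noncomputable section

variable {N : ℕ}

/-! ### The Sobolev inequality -/

open ContinuousLinearMap in
-- The weak gradient is tested with `y ↦ ρ (x - y)`. The reflection contributes a sign that cancels
-- the one from integration by parts.
theorem IsWeakGradient.fderiv_convolution {u : RN N → ℝ} {G : RN N → RN N}
    (h : IsWeakGradient u G) {ρ : RN N → ℝ} (hρ : ContDiff ℝ (⊤ : ℕ∞) ρ)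
    (hc : HasCompactSupport ρ) (x v : RN N) :
    fderiv ℝ (convolution ρ u (lsmul ℝ ℝ) volume) x v = ∫ y, ρ (x - y) * inner ℝ (G y) v := by
  have hρ1 : ContDiff ℝ 1 ρ := hρ.of_le (by exact_mod_cast le_top)
  have hd := hc.hasFDerivAt_convolution_left (lsmul ℝ ℝ) hρ1 h.1 x
  rw [hd.fderiv]
  have hex := (hc.fderiv (𝕜 := ℝ)).convolutionExists_left ((lsmul ℝ ℝ : ℝ →L[ℝ] ℝ →L[ℝ] ℝ).precompL
    (RN N)) (hρ1.continuous_fderiv one_ne_zero) h.1 x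
  have e1 : (convolution (fderiv ℝ ρ) u ((lsmul ℝ ℝ : ℝ →L[ℝ] ℝ →L[ℝ] ℝ).precompL (RN N)) volume) x v
      = ∫ t, fderiv ℝ ρ t v * u (x - t) := by
    unfold convolution
    rw [ContinuousLinearMap.integral_apply hex]
    rfl
  rw [e1, ← integral_sub_left_eq_self _ volume x]
  simp only [sub_sub_cancel]
  have hψ : ContDiff ℝ (⊤ : ℕ∞) fun y => ρ (x - y) := hρ.comp (contDiff_const.sub contDiff_id)
  have hψc : HasCompactSupport fun y => ρ (x - y) :=
    hc.comp_homeomorph (Homeomorph.subLeft x)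
  have hfd : ∀ y, fderiv ℝ (fun y => ρ (x - y)) y v = -fderiv ℝ ρ (x - y) v := by
    intro y
    have h1 : HasFDerivAt (fun y : RN N => x - y) (-ContinuousLinearMap.id ℝ (RN N)) y :=
      (hasFDerivAt_id y).const_sub x
    have h2 := ((hρ1.differentiable one_ne_zero) (x - y)).hasFDerivAt.comp y h1
    change fderiv ℝ (ρ ∘ fun y => x - y) y v = _
    rw [h2.fderiv]
    simp
  have key := h.2.2 _ hψ hψc v
  simp only [hfd, mul_neg, integral_neg, neg_inj] at key
  rw [← key]
  exact integral_congr_ae (ae_of_all _ fun y => mul_comm _ _)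

/-- Averages against a probability density do not increase `L^p` norms. -/
theorem lintegral_convolution_rpow_le {ρ g : RN N → ℝ≥0∞} (hρ : Measurable ρ) (hg : Measurable g)
    (h1 : ∫⁻ x, ρ x = 1) {p : ℝ} (hp : 1 ≤ p) :
    ∫⁻ x, (∫⁻ y, ρ (x - y) * g y) ^ p ≤ ∫⁻ y, g y ^ p := by
  have hp0 : 0 < p := by linarith
  have hq : 0 ≤ 1 - 1 / p := by
    rw [sub_nonneg, div_le_one hp0]
    exact hp
  have h1x : ∀ x, ∫⁻ y, ρ (x - y) = 1 := fun x => by rw [lintegral_sub_left_eq_self, h1]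
  have pt : ∀ x, (∫⁻ y, ρ (x - y) * g y) ^ p ≤ ∫⁻ y, ρ (x - y) * g y ^ p := by
    intro x
    -- Jensen's inequality in the form of Hölder: the factor with exponent `1 - 1 / p` integrates to
    -- one.
    have e : ∀ y, ρ (x - y) * g y = ρ (x - y) ^ (1 - 1 / p) * (ρ (x - y) * g y ^ p) ^ (1 / p) := by
      intro y
      rw [ENNReal.mul_rpow_of_nonneg _ _ (by positivity), ← mul_assoc,
        ← ENNReal.rpow_add_of_nonneg _ _ hq (by positivity), sub_add_cancel, ENNReal.rpow_one,
        ← ENNReal.rpow_mul, mul_one_div_cancel hp0.ne', ENNReal.rpow_one]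
    have hm1 : Measurable fun y => ρ (x - y) := hρ.comp (measurable_const.sub measurable_id)
    calc (∫⁻ y, ρ (x - y) * g y) ^ p
        = (∫⁻ y, ρ (x - y) ^ (1 - 1 / p) * (ρ (x - y) * g y ^ p) ^ (1 / p)) ^ p := by
          simp only [← e]
      _ ≤ ((∫⁻ y, ρ (x - y)) ^ (1 - 1 / p) * (∫⁻ y, ρ (x - y) * g y ^ p) ^ (1 / p)) ^ p := by
          gcongr
          exact ENNReal.lintegral_mul_norm_pow_le hm1.aemeasurable
            (hm1.mul (hg.pow_const p)).aemeasurable hq (by positivity) (by ring)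
      _ = _ := by
          rw [h1x, ENNReal.one_rpow, one_mul, ← ENNReal.rpow_mul, one_div_mul_cancel hp0.ne',
            ENNReal.rpow_one]
  have hm : Measurable fun z : RN N × RN N => ρ (z.1 - z.2) * g z.2 ^ p :=
    (hρ.comp (measurable_fst.sub measurable_snd)).mul ((hg.comp measurable_snd).pow_const p)
  calc _ ≤ ∫⁻ x, ∫⁻ y, ρ (x - y) * g y ^ p := lintegral_mono pt
    _ = ∫⁻ y, ∫⁻ x, ρ (x - y) * g y ^ p := lintegral_lintegral_swap (by exact hm.aemeasurable)
    _ = ∫⁻ y, g y ^ p := by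
        refine lintegral_congr fun y => ?_
        have hm1 : Measurable fun x => ρ (x - y) := hρ.comp (measurable_id.sub measurable_const)
        rw [lintegral_mul_const _ hm1, lintegral_sub_right_eq_self, h1, one_mul]

theorem sobolevExp_pos {p : ℝ} (hp : 2 ≤ p) (hpN : p < N) : 0 < sobolevExp N p := by
  unfold sobolevExp
  have : (0 : ℝ) < N := by linarith
  exact div_pos (by positivity) (by linarith)

open ContinuousLinearMap in
-- Mollification gives `C^1` functions with compact support, for which the
-- Gagliardo–Nirenberg–Sobolev inequality is available. Their gradients are averages of `G`, so the
-- `L^p` norm does not grow; almost everywhere convergence and Fatou recover `u`.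
theorem exists_eLpNorm_le_of_hasCompactSupport {p : ℝ} (hp : 2 ≤ p) (hpN : p < N) :
    ∃ K : ℝ≥0∞, K < ⊤ ∧ ∀ (u : RN N → ℝ) (G : RN N → RN N), IsWeakGradient u G →
      HasCompactSupport u →
      eLpNorm u (ENNReal.ofReal (sobolevExp N p)) volume ≤
        K * eLpNorm G (ENNReal.ofReal p) volume := by
  have hN : (0 : ℝ) < N := by linarith
  have hp0 : 0 < p := by linarith
  refine ⟨(SNormLESNormFDerivOfEqConst ℝ (volume : Measure (RN N)) (p.toNNReal) : ℝ≥0∞),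
    ENNReal.coe_lt_top, ?_⟩
  intro u G h hu
  -- A fixed ratio of outer to inner radius is what the almost everywhere convergence of
  -- mollifications requires.
  set φ : ℕ → ContDiffBump (0 : RN N) := fun k =>
    ⟨1 / ((k : ℝ) + 1), 2 / ((k : ℝ) + 1), by positivity, by gcongr; norm_num⟩ with hφ
  set ρ : ℕ → RN N → ℝ := fun k => (φ k).normed volume with hρ
  have hρs : ∀ k, ContDiff ℝ (⊤ : ℕ∞) (ρ k) := fun k => (φ k).contDiff_normed
  have hρc : ∀ k, HasCompactSupport (ρ k) := fun k => (φ k).hasCompactSupport_normed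
  have hρ1 : ∀ k, ∫⁻ x, ‖ρ k x‖ₑ = 1 := by
    intro k
    have h1 := (φ k).integral_normed (μ := volume)
    have h2 : ∀ x, 0 ≤ ρ k x := fun x => (φ k).nonneg_normed x
    have h3 : Integrable (ρ k) := ((hρs k).continuous).integrable_of_hasCompactSupport (hρc k)
    have h4 := ofReal_integral_eq_lintegral_ofReal h3 (ae_of_all _ h2)
    rw [h1, ENNReal.ofReal_one] at h4
    rw [h4]
    exact lintegral_congr fun x => Real.enorm_eq_ofReal (h2 x)
  set v : ℕ → RN N → ℝ := fun k => convolution (ρ k) u (lsmul ℝ ℝ) volume with hv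
  have hvs : ∀ k, ContDiff ℝ 1 (v k) := fun k =>
    (hρc k).contDiff_convolution_left (lsmul ℝ ℝ) ((hρs k).of_le (by exact_mod_cast le_top)) h.1
  have hvc : ∀ k, HasCompactSupport (v k) := fun k => (hρc k).convolution (lsmul ℝ ℝ) hu
  have hGm : AEStronglyMeasurable G volume := h.2.1.aestronglyMeasurable
  have hgrad : ∀ k, eLpNorm (fderiv ℝ (v k)) (ENNReal.ofReal p) volume ≤
      eLpNorm G (ENNReal.ofReal p) volume := by
    intro k
    rw [eLpNorm_ofReal_eq hp0, eLpNorm_ofReal_eq hp0]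
    refine ENNReal.rpow_le_rpow ?_ (by positivity)
    have eG : ∫⁻ x, ‖G x‖ₑ ^ p = ∫⁻ x, ‖hGm.mk G x‖ₑ ^ p :=
      lintegral_congr_ae (hGm.ae_eq_mk.mono fun x hx => by simp only [← hx])
    rw [eG]
    refine le_trans (lintegral_mono fun x => ?_) (lintegral_convolution_rpow_le
      (ρ := fun x => ‖ρ k x‖ₑ) (g := fun x => ‖hGm.mk G x‖ₑ)
      (hρs k).continuous.measurable.enorm hGm.stronglyMeasurable_mk.measurable.enorm (hρ1 k)
      (by linarith))
    gcongr
    set b := ∫⁻ y, ‖ρ k (x - y)‖ₑ * ‖hGm.mk G y‖ₑ with hb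
    have eb : b = ∫⁻ y, ‖ρ k (x - y)‖ₑ * ‖G y‖ₑ :=
      lintegral_congr_ae (hGm.ae_eq_mk.mono fun y hy => by simp only [← hy])
    rcases eq_or_ne b ⊤ with hbt | hbt
    · rw [hbt]; exact le_top
    have hop : ‖fderiv ℝ (v k) x‖ ≤ b.toReal := by
      refine ContinuousLinearMap.opNorm_le_bound _ ENNReal.toReal_nonneg fun w => ?_
      rw [hv, h.fderiv_convolution (hρs k) (hρc k)]
      have h1 : ‖∫ y, ρ k (x - y) * inner ℝ (G y) w‖ₑ ≤ b * ‖w‖ₑ := by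
        refine (enorm_integral_le_lintegral_enorm _).trans ?_
        rw [eb, ← lintegral_mul_const' _ _ enorm_ne_top]
        refine lintegral_mono fun y => ?_
        rw [enorm_mul, mul_assoc]
        gcongr
        rw [← ofReal_norm, ← ofReal_norm, ← ofReal_norm, ← ENNReal.ofReal_mul (norm_nonneg _)]
        exact ENNReal.ofReal_le_ofReal (norm_inner_le_norm _ _)
      have h2 := ENNReal.toReal_mono (ENNReal.mul_ne_top hbt enorm_ne_top) h1
      rwa [toReal_enorm, ENNReal.toReal_mul, toReal_enorm] at h2
    rw [← ofReal_norm, ← ENNReal.ofReal_toReal hbt]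
    exact ENNReal.ofReal_le_ofReal hop
  have hlim : ∀ᵐ x, Tendsto (fun k => v k x) atTop (𝓝 (u x)) := by
    refine ContDiffBump.ae_convolution_tendsto_right_of_locallyIntegrable (K := 2) ?_
      (Eventually.of_forall fun k => ?_) h.1
    · have := tendsto_one_div_add_atTop_nhds_zero_nat (𝕜 := ℝ)
      have h2 := this.const_mul 2
      simp only [mul_zero, mul_one_div] at h2
      exact h2
    · simp only [hφ]
      ring_nf
      exact le_rfl
  have hpe : ((sobolevExp N p).toNNReal : ℝ)⁻¹ =
      ((p.toNNReal : ℝ≥0) : ℝ)⁻¹ - (Module.finrank ℝ (RN N) : ℝ)⁻¹ := by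
    rw [finrank_euclideanSpace_fin, Real.coe_toNNReal _ (sobolevExp_pos hp hpN).le,
      Real.coe_toNNReal _ hp0.le]
    unfold sobolevExp
    have : (N : ℝ) - p ≠ 0 := by linarith
    field_simp
  have hGNS : ∀ k, eLpNorm (v k) (ENNReal.ofReal (sobolevExp N p)) volume ≤
      (SNormLESNormFDerivOfEqConst ℝ (volume : Measure (RN N)) (p.toNNReal) : ℝ≥0∞) *
        eLpNorm G (ENNReal.ofReal p) volume := by
    intro k
    refine (eLpNorm_le_eLpNorm_fderiv_of_eq volume (hvs k) (hvc k) (p := p.toNNReal)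
      (p' := (sobolevExp N p).toNNReal) ?_ ?_ hpe).trans ?_
    · rw [← NNReal.coe_le_coe, Real.coe_toNNReal _ hp0.le]
      push_cast
      linarith
    · rw [finrank_euclideanSpace_fin]
      exact_mod_cast hN
    · gcongr
      exact hgrad k
  refine (Lp.eLpNorm_lim_le_liminf_eLpNorm (fun k => (hvs k).continuous.aestronglyMeasurable) u
    hlim).trans ?_
  refine liminf_le_of_le (by isBoundedDefault) fun b hb => ?_
  obtain ⟨k, hk⟩ := hb.exists
  exact hk.trans (hGNS k)

end

noncomputable section

variable {N : ℕ}

/-! ### Multiplication by cutoff functions -/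

theorem enorm_gradient (η : RN N → ℝ) (x : RN N) : ‖gradient η x‖ₑ = ‖fderiv ℝ η x‖ₑ := by
  rw [← ofReal_norm, ← ofReal_norm]
  congr 1
  exact LinearIsometryEquiv.norm_map _ _

theorem continuous_gradient_of_contDiff {η : RN N → ℝ} (hη : ContDiff ℝ (⊤ : ℕ∞) η) :
    Continuous (gradient η) :=
  (LinearIsometryEquiv.continuous _).comp (hη.continuous_fderiv (by simp))

/-- Testing the gradient of `u` with `η φ` yields the product rule. -/
theorem IsWeakGradient.mul {u : RN N → ℝ} {G : RN N → RN N} (h : IsWeakGradient u G)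
    {η : RN N → ℝ} (hη : ContDiff ℝ (⊤ : ℕ∞) η) :
    IsWeakGradient (fun x => η x * u x) (fun x => η x • G x + u x • gradient η x) := by
  have hg := continuous_gradient_of_contDiff hη
  refine ⟨h.1.continuous_mul hη.continuous, (h.2.1.continuous_smul hη.continuous).add
    (h.1.smul_continuous hg), fun φ hφ hc v => ?_⟩
  have hηφ : ContDiff ℝ (⊤ : ℕ∞) fun x => η x * φ x := hη.mul hφ
  have hηc : HasCompactSupport fun x => η x * φ x := hc.mul_left
  have key := h.2.2 _ hηφ hηc v
  have hd : ∀ x, fderiv ℝ (fun x => η x * φ x) x v =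
      η x * fderiv ℝ φ x v + φ x * fderiv ℝ η x v := by
    intro x
    have h1 := ((hη.differentiable (by simp)) x).hasFDerivAt
    have h2 := ((hφ.differentiable (by simp)) x).hasFDerivAt
    have h3 : HasFDerivAt (fun x => η x * φ x) _ x := h1.mul h2
    rw [h3.fderiv]
    simp
  have i1 : Integrable fun x => u x * (φ x * fderiv ℝ η x v) := by
    have hcont : Continuous fun x => φ x * fderiv ℝ η x v :=
      hφ.continuous.mul ((hη.continuous_fderiv (by simp)).clm_apply continuous_const)
    exact h.1.integrable_smul_right_of_hasCompactSupport hcont hc.mul_right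
  have i2 : Integrable fun x => u x * fderiv ℝ (fun x => η x * φ x) x v :=
    IsWeakGradient.integrable_left h.1 hηφ hηc v
  have i3 : Integrable fun x => (η x * φ x) * inner ℝ (G x) v :=
    IsWeakGradient.integrable_right h.2.1 hηφ hηc v
  have e1 : ∫ x, η x * u x * fderiv ℝ φ x v =
      (∫ x, u x * fderiv ℝ (fun x => η x * φ x) x v) - ∫ x, u x * (φ x * fderiv ℝ η x v) := by
    rw [← integral_sub i2 i1]
    refine integral_congr_ae (ae_of_all _ fun x => ?_)
    simp only [hd]
    ring
  have e2 : ∫ x, φ x * inner ℝ (η x • G x + u x • gradient η x) v =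
      (∫ x, (η x * φ x) * inner ℝ (G x) v) + ∫ x, u x * (φ x * fderiv ℝ η x v) := by
    rw [← integral_add i3 i1]
    refine integral_congr_ae (ae_of_all _ fun x => ?_)
    simp only [inner_add_left, real_inner_smul_left, inner_gradient_left]
    ring
  rw [e1, e2, key]
  ring

theorem D1p.isWeakGradient {p : ℝ} (w : D1p N p) : IsWeakGradient (D1p.fn w) (D1p.grad w) := w.2

theorem D1p.memLp_fn {p : ℝ} (w : D1p N p) :
    MemLp (D1p.fn w) (ENNReal.ofReal (sobolevExp N p)) volume := Lp.memLp _

theorem D1p.memLp_grad {p : ℝ} (w : D1p N p) :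
    MemLp (D1p.grad w) (ENNReal.ofReal p) volume := Lp.memLp _

@[fun_prop]
theorem D1p.measurable_fn {p : ℝ} (w : D1p N p) : Measurable (D1p.fn w) :=
  (Lp.stronglyMeasurable _).measurable

@[fun_prop]
theorem D1p.measurable_grad {p : ℝ} (w : D1p N p) : Measurable (D1p.grad w) :=
  (Lp.stronglyMeasurable _).measurable

theorem lt_sobolevExp {p : ℝ} (hp : 2 ≤ p) (hpN : p < N) : p < sobolevExp N p := by
  unfold sobolevExp
  rw [lt_div_iff₀ (by linarith)]
  nlinarith

/-- The support of `∇η` has finite measure, and there `L^{p^*} ⊆ L^p`. -/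
theorem D1p.memLp_smul_gradient {p : ℝ} (hp : 2 ≤ p) (hpN : p < N) (w : D1p N p) {η : RN N → ℝ}
    (hη : ContDiff ℝ (⊤ : ℕ∞) η) (hc : HasCompactSupport (gradient η)) :
    MemLp (fun x => D1p.fn w x • gradient η x) (ENNReal.ofReal p) volume := by
  have hg := continuous_gradient_of_contDiff hη
  obtain ⟨C, hC⟩ := hg.bounded_above_of_compact_support hc
  set K := tsupport (gradient η) with hK
  have hKm : MeasurableSet K := (isClosed_tsupport _).measurableSet
  have : IsFiniteMeasure (volume.restrict K) := ⟨by
    rw [Measure.restrict_apply_univ]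
    exact hc.isCompact.measure_lt_top⟩
  have h1 : MemLp (D1p.fn w) (ENNReal.ofReal p) (volume.restrict K) :=
    ((D1p.memLp_fn w).restrict K).mono_exponent
      (ENNReal.ofReal_le_ofReal (lt_sobolevExp hp hpN).le)
  have h2 : MemLp (K.indicator (D1p.fn w)) (ENNReal.ofReal p) volume :=
    (memLp_indicator_iff_restrict hKm).2 h1
  refine (h2.const_mul C).of_le
    (((D1p.measurable_fn w).smul hg.measurable).aestronglyMeasurable) (ae_of_all _ fun x => ?_)
  by_cases hx : x ∈ K
  · rw [Set.indicator_of_mem hx, norm_smul, norm_mul, mul_comm]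
    gcongr
    exact (hC x).trans (le_abs_self C)
  · have : gradient η x = 0 := image_eq_zero_of_notMem_tsupport hx
    rw [this, smul_zero, norm_zero]
    positivity

/-- Compact support is asked of `∇η` only, so that the exterior cutoffs `1 - η` are allowed as well
as the local ones. -/
theorem D1p.exists_mul {p : ℝ} (hp : 2 ≤ p) (hpN : p < N) (w : D1p N p) {η : RN N → ℝ}
    (hη : ContDiff ℝ (⊤ : ℕ∞) η) (hc : HasCompactSupport (gradient η))
    (h1 : ∀ x, 0 ≤ η x ∧ η x ≤ 1) :
    ∃ v : D1p N p, D1p.fn v =ᵐ[volume] (fun x => η x * D1p.fn w x) ∧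
      D1p.grad v =ᵐ[volume] fun x => η x • D1p.grad w x + D1p.fn w x • gradient η x := by
  have hηm := hη.continuous.measurable
  have m1 : MemLp (fun x => η x * D1p.fn w x) (ENNReal.ofReal (sobolevExp N p)) volume := by
    refine (D1p.memLp_fn w).of_le (hηm.mul (D1p.measurable_fn w)).aestronglyMeasurable
      (ae_of_all _ fun x => ?_)
    rw [norm_mul, Real.norm_of_nonneg (h1 x).1]
    exact mul_le_of_le_one_left (norm_nonneg _) (h1 x).2
  have m2 : MemLp (fun x => η x • D1p.grad w x) (ENNReal.ofReal p) volume := by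
    refine (D1p.memLp_grad w).of_le (hηm.smul (D1p.measurable_grad w)).aestronglyMeasurable
      (ae_of_all _ fun x => ?_)
    rw [norm_smul, Real.norm_of_nonneg (h1 x).1]
    exact mul_le_of_le_one_left (norm_nonneg _) (h1 x).2
  have m3 := m2.add (D1p.memLp_smul_gradient hp hpN w hη hc)
  exact ⟨⟨(m1.toLp _, m3.toLp _), ((D1p.isWeakGradient w).mul hη).congr m1.coeFn_toLp.symm
    m3.coeFn_toLp.symm⟩, m1.coeFn_toLp, m3.coeFn_toLp⟩

/-- All cutoffs are translates and dilates of one bump. The exponent `N` makes `∫ ‖∇η‖^N` invariant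
under dilation, so one constant serves every centre and scale. -/
theorem exists_smooth_cutoffs (hN : 0 < N) :
    ∃ K : ℝ≥0∞, K < ⊤ ∧ ∀ (z : RN N) (ε : ℝ), 0 < ε → ∃ η : RN N → ℝ,
      ContDiff ℝ (⊤ : ℕ∞) η ∧ HasCompactSupport η ∧ (∀ x, 0 ≤ η x ∧ η x ≤ 1) ∧
      (∀ x, dist x z ≤ ε → η x = 1) ∧ (∀ x, 2 * ε ≤ dist x z → η x = 0) ∧
      (∀ x, dist x z < ε → gradient η x = 0) ∧ (∀ x, 2 * ε < dist x z → gradient η x = 0) ∧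
      ∫⁻ x, ‖gradient η x‖ₑ ^ (N : ℝ) ≤ K := by
  set ψ : ContDiffBump (0 : RN N) := ⟨1, 2, one_pos, one_lt_two⟩ with hψ
  have hψs : ContDiff ℝ (⊤ : ℕ∞) ψ := ψ.contDiff
  have hψc : HasCompactSupport ψ := ψ.hasCompactSupport
  have hgc : HasCompactSupport (fderiv ℝ ψ) := hψc.fderiv (𝕜 := ℝ)
  have hgcont : Continuous (fderiv ℝ ψ) := hψs.continuous_fderiv (by simp)
  refine ⟨∫⁻ x, ‖fderiv ℝ ψ x‖ₑ ^ (N : ℝ), ?_, ?_⟩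
  · obtain ⟨C, hC⟩ := hgcont.bounded_above_of_compact_support hgc
    calc ∫⁻ x, ‖fderiv ℝ ψ x‖ₑ ^ (N : ℝ)
        ≤ ∫⁻ x, (Metric.closedBall (0 : RN N) 2).indicator
            (fun _ => ENNReal.ofReal C ^ (N : ℝ) + 1) x := by
          refine lintegral_mono fun x => ?_
          by_cases hx : x ∈ Metric.closedBall (0 : RN N) 2
          · rw [Set.indicator_of_mem hx]
            refine le_trans (ENNReal.rpow_le_rpow ?_ (by positivity)) le_self_add
            rw [← ofReal_norm]
            exact ENNReal.ofReal_le_ofReal (hC x)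
          · have : fderiv ℝ ψ x = 0 := by
              have h0 : (ψ : RN N → ℝ) =ᶠ[𝓝 x] fun _ => 0 := by
                filter_upwards [(Metric.isClosed_closedBall (x := (0 : RN N))
                  (ε := 2)).isOpen_compl.mem_nhds hx] with y hy
                exact ψ.zero_of_le_dist (not_le.1 fun h => hy (Metric.mem_closedBall.2 h)).le
              rw [h0.fderiv_eq]
              simp
            rw [this, show ‖(0 : RN N →L[ℝ] ℝ)‖ₑ = 0 by rw [← ofReal_norm, norm_zero,
              ENNReal.ofReal_zero],
              ENNReal.zero_rpow_of_pos (by positivity)]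
            exact zero_le
      _ < ⊤ := by
          rw [lintegral_indicator measurableSet_closedBall, setLIntegral_const]
          refine ENNReal.mul_lt_top (ENNReal.add_lt_top.2 ⟨ENNReal.rpow_lt_top_of_nonneg
            (by positivity) ENNReal.ofReal_ne_top, ENNReal.one_lt_top⟩) measure_closedBall_lt_top
  intro z ε hε
  set η : RN N → ℝ := fun x => ψ (ε⁻¹ • (x - z)) with hη
  have hηs : ContDiff ℝ (⊤ : ℕ∞) η := hψs.comp (by fun_prop)
  have hnorm : ∀ x, ‖ε⁻¹ • (x - z)‖ = ε⁻¹ * dist x z := fun x => by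
    rw [norm_smul, Real.norm_of_nonneg (by positivity), dist_eq_norm]
  have h1 : ∀ x, dist x z ≤ ε → η x = 1 := by
    intro x hx
    refine ψ.one_of_mem_closedBall ?_
    rw [mem_closedBall_zero_iff, hnorm]
    simp only [hψ]
    rw [inv_mul_le_iff₀ hε]
    linarith
  have h0 : ∀ x, 2 * ε ≤ dist x z → η x = 0 := by
    intro x hx
    refine ψ.zero_of_le_dist ?_
    rw [dist_zero_right, hnorm]
    simp only [hψ]
    rw [le_inv_mul_iff₀ hε]
    linarith
  have hηc : HasCompactSupport η :=
    HasCompactSupport.intro (isCompact_closedBall z (2 * ε)) fun x hx =>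
      h0 x (not_le.1 fun h => hx (Metric.mem_closedBall.2 h)).le
  have hgrad0 : ∀ (c : ℝ) (x : RN N), η =ᶠ[𝓝 x] (fun _ => c) → gradient η x = 0 := by
    intro c x hx
    unfold gradient
    rw [hx.fderiv_eq]
    simp
  refine ⟨η, hηs, hηc, fun x => ⟨ψ.nonneg, ψ.le_one⟩, h1, h0, ?_, ?_, ?_⟩
  · intro x hx
    refine hgrad0 1 x ?_
    filter_upwards [Metric.isOpen_ball.mem_nhds (Metric.mem_ball.2 hx)] with y hy
    exact h1 y (Metric.mem_ball.1 hy).le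
  · intro x hx
    refine hgrad0 0 x ?_
    filter_upwards [(Metric.isClosed_closedBall (x := z) (ε := 2 * ε)).isOpen_compl.mem_nhds
      (show x ∈ (Metric.closedBall z (2 * ε))ᶜ from fun h => absurd (Metric.mem_closedBall.1 h)
        (not_le.2 hx))] with y hy
    exact h0 y (not_le.1 fun h => hy (Metric.mem_closedBall.2 h)).le
  · have hder : ∀ x, ‖gradient η x‖ₑ = ENNReal.ofReal ε⁻¹ * ‖fderiv ℝ ψ (ε⁻¹ • (x - z))‖ₑ := by
      intro x
      rw [enorm_gradient]
      have hd1 : HasFDerivAt (fun x : RN N => ε⁻¹ • (x - z)) (ε⁻¹ • ContinuousLinearMap.id ℝ (RN N))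
          x := ((hasFDerivAt_id x).sub_const z).const_smul ε⁻¹
      have hd2 := ((hψs.differentiable (by simp)) (ε⁻¹ • (x - z))).hasFDerivAt.comp x hd1
      have hd3 : HasFDerivAt η _ x := hd2
      rw [hd3.fderiv, ContinuousLinearMap.comp_smul, ContinuousLinearMap.comp_id, enorm_smul,
        Real.enorm_eq_ofReal (by positivity)]
    simp only [hder]
    rw [lintegral_sub_right_eq_self (fun x => (ENNReal.ofReal ε⁻¹ *
      ‖fderiv ℝ ψ (ε⁻¹ • x)‖ₑ) ^ (N : ℝ)) z]
    rw [lintegral_eq_rpow_mul_lintegral_comp_smul (inv_pos.2 hε) (fun x => ‖fderiv ℝ ψ x‖ₑ ^ (N : ℝ))]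
    rw [← lintegral_const_mul' _ _ (ENNReal.rpow_ne_top_of_nonneg (by positivity)
      ENNReal.ofReal_ne_top)]
    refine lintegral_mono fun x => ?_
    rw [ENNReal.mul_rpow_of_nonneg _ _ (by positivity)]

/-- Hölder's inequality for `u ∇η`. -/
theorem lintegral_smul_gradient_le {p : ℝ} (hp : 2 ≤ p) (hpN : p < N) {u : RN N → ℝ}
    (hu : Measurable u) {η : RN N → ℝ} (hη : ContDiff ℝ (⊤ : ℕ∞) η) {S : Set (RN N)}
    (hS : MeasurableSet S) (hηS : ∀ x ∉ S, gradient η x = 0) :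
    ∫⁻ x, ‖u x • gradient η x‖ₑ ^ p ≤
      (∫⁻ x in S, ‖u x‖ₑ ^ sobolevExp N p) ^ (p / sobolevExp N p) *
        (∫⁻ x, ‖gradient η x‖ₑ ^ (N : ℝ)) ^ (p / N) := by
  have hN : (0 : ℝ) < N := by linarith
  have hps := sobolevExp_pos hp hpN
  have hgm := (continuous_gradient_of_contDiff hη).measurable
  have hsum : p / sobolevExp N p + p / N = 1 := by
    unfold sobolevExp
    field_simp
    ring
  calc ∫⁻ x, ‖u x • gradient η x‖ₑ ^ p
      = ∫⁻ x in S, ‖u x • gradient η x‖ₑ ^ p := by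
        rw [← lintegral_indicator hS]
        refine lintegral_congr fun x => ?_
        by_cases hx : x ∈ S
        · simp [hx]
        · rw [Set.indicator_of_notMem hx, hηS x hx, smul_zero, enorm_zero,
            ENNReal.zero_rpow_of_pos (by linarith)]
    _ = ∫⁻ x in S, (‖u x‖ₑ ^ sobolevExp N p) ^ (p / sobolevExp N p) *
          (‖gradient η x‖ₑ ^ (N : ℝ)) ^ (p / N) := by
        refine lintegral_congr fun x => ?_
        rw [← ENNReal.rpow_mul, ← ENNReal.rpow_mul, mul_div_cancel₀ _ hps.ne',
          mul_div_cancel₀ _ hN.ne', enorm_smul, ENNReal.mul_rpow_of_nonneg _ _ (by linarith)]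
    _ ≤ _ := ENNReal.lintegral_mul_norm_pow_le (by fun_prop) (by fun_prop) (by positivity)
        (by positivity) hsum
    _ ≤ _ := by
        exact mul_le_mul' le_rfl
          (ENNReal.rpow_le_rpow (setLIntegral_le_lintegral _ _) (by positivity))

theorem tendsto_lintegral_tail {f : RN N → ℝ≥0∞} (hfin : ∫⁻ x, f x ≠ ⊤) :
    Tendsto (fun k : ℕ => ∫⁻ x in {x : RN N | (k : ℝ) ≤ ‖x‖}, f x) atTop (𝓝 0) := by
  have hS : ∀ k : ℕ, MeasurableSet {x : RN N | (k : ℝ) ≤ ‖x‖} := fun k =>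
    measurableSet_le measurable_const measurable_norm
  have := isFiniteMeasure_withDensity hfin
  have h := tendsto_measure_iInter_atTop (μ := volume.withDensity f)
    (s := fun k : ℕ => {x : RN N | (k : ℝ) ≤ ‖x‖}) (fun k => (hS k).nullMeasurableSet)
    (fun a b hab x (hx : (b : ℝ) ≤ ‖x‖) => (Nat.cast_le.2 hab).trans hx)
    ⟨0, measure_ne_top _ _⟩
  have he : ⋂ k : ℕ, {x : RN N | (k : ℝ) ≤ ‖x‖} = ∅ := by
    refine Set.eq_empty_of_forall_notMem fun x hx => ?_
    obtain ⟨k, hk⟩ := exists_nat_gt ‖x‖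
    exact absurd (Set.mem_iInter.1 hx k) (not_le.2 hk)
  rw [he, measure_empty] at h
  refine h.congr fun k => withDensity_apply _ (hS k)

end

noncomputable section

variable {N : ℕ}

/-! ### The Sobolev inequality and the best constants -/

@[fun_prop]
theorem measurable_gradDensity {p : ℝ} (w : D1p N p) : Measurable (gradDensity w) := by
  unfold gradDensity
  fun_prop

@[fun_prop]
theorem measurable_sobolevDensity {p : ℝ} (w : D1p N p) : Measurable (sobolevDensity w) := by
  unfold sobolevDensity
  fun_prop

@[fun_prop]
theorem measurable_steinWeissDensity {p : ℝ} (β μ : ℝ) (w : D1p N p) :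
    Measurable (steinWeissDensity β μ w) := by
  unfold steinWeissDensity
  fun_prop

theorem D1p.eLpNorm_grad_eq {p : ℝ} (hp : 2 ≤ p) (w : D1p N p) :
    eLpNorm (D1p.grad w) (ENNReal.ofReal p) volume = (∫⁻ x, gradDensity w x) ^ (1 / p) :=
  eLpNorm_ofReal_eq (by linarith) _

theorem D1p.eLpNorm_fn_eq {p : ℝ} (hp : 2 ≤ p) (hpN : p < N) (w : D1p N p) :
    eLpNorm (D1p.fn w) (ENNReal.ofReal (sobolevExp N p)) volume =
      (∫⁻ x, sobolevDensity w x) ^ (1 / sobolevExp N p) :=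
  eLpNorm_ofReal_eq (sobolevExp_pos hp hpN) _

theorem D1p.lintegral_gradDensity_ne_top {p : ℝ} (hp : 2 ≤ p) (w : D1p N p) :
    ∫⁻ x, gradDensity w x ≠ ⊤ := by
  have h := (D1p.memLp_grad w).2.ne
  rw [D1p.eLpNorm_grad_eq hp] at h
  have : 0 < 1 / p := by positivity
  exact fun h' => h (by rw [h', ENNReal.top_rpow_of_pos this])

theorem D1p.lintegral_sobolevDensity_ne_top {p : ℝ} (hp : 2 ≤ p) (hpN : p < N) (w : D1p N p) :
    ∫⁻ x, sobolevDensity w x ≠ ⊤ := by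
  have h := (D1p.memLp_fn w).2.ne
  rw [D1p.eLpNorm_fn_eq hp hpN] at h
  have := sobolevExp_pos hp hpN
  exact fun h' => h (by rw [h', ENNReal.top_rpow_of_pos (by positivity)])

theorem D1p.lintegral_gradDensity_le {p M : ℝ} (hp : 2 ≤ p) (w : D1p N p)
    (h : D1p.gradNorm w ≤ M) : ∫⁻ x, gradDensity w x ≤ ENNReal.ofReal M ^ p := by
  have h1 : eLpNorm (D1p.grad w) (ENNReal.ofReal p) volume ≤ ENNReal.ofReal M := by
    rw [← ENNReal.ofReal_toReal (D1p.memLp_grad w).2.ne]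
    exact ENNReal.ofReal_le_ofReal h
  rw [D1p.eLpNorm_grad_eq hp, one_div, ENNReal.rpow_inv_le_iff (by linarith)] at h1
  exact h1

/-- Minkowski's inequality. Since `0 ≤ η ≤ 1`, the weight `η^p` is relaxed to `η`, which can be
tested directly against a vague limit. -/
theorem D1p.exists_mul_grad_le {p : ℝ} (hp : 2 ≤ p) (hpN : p < N) (w : D1p N p) {η : RN N → ℝ}
    (hη : ContDiff ℝ (⊤ : ℕ∞) η) (hc : HasCompactSupport (gradient η))
    (h1 : ∀ x, 0 ≤ η x ∧ η x ≤ 1) :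
    ∃ v : D1p N p, D1p.fn v =ᵐ[volume] (fun x => η x * D1p.fn w x) ∧
      (∫⁻ x, gradDensity v x) ^ (1 / p) ≤
        (∫⁻ x, ENNReal.ofReal (η x) * gradDensity w x) ^ (1 / p) +
          (∫⁻ x, ‖D1p.fn w x • gradient η x‖ₑ ^ p) ^ (1 / p) := by
  obtain ⟨v, hv1, hv2⟩ := D1p.exists_mul hp hpN w hη hc h1
  refine ⟨v, hv1, ?_⟩
  have hηm := hη.continuous.measurable
  have hgm := (continuous_gradient_of_contDiff hη).measurable
  calc (∫⁻ x, gradDensity v x) ^ (1 / p)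
      ≤ (∫⁻ x, ((fun x => ‖η x • D1p.grad w x‖ₑ) + fun x => ‖D1p.fn w x • gradient η x‖ₑ) x ^ p)
          ^ (1 / p) := by
        refine ENNReal.rpow_le_rpow (lintegral_mono_ae (hv2.mono fun x hx => ?_)) (by positivity)
        unfold gradDensity
        rw [hx]
        exact ENNReal.rpow_le_rpow (enorm_add_le _ _) (by linarith)
    _ ≤ _ := ENNReal.lintegral_Lp_add_le (by fun_prop) (by fun_prop) (by linarith)
    _ ≤ _ := by
        refine add_le_add (ENNReal.rpow_le_rpow (lintegral_mono fun x => ?_) (by positivity)) le_rfl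
        dsimp only
        rw [enorm_smul, ENNReal.mul_rpow_of_nonneg _ _ (by linarith),
          Real.enorm_eq_ofReal (h1 x).1]
        refine mul_le_mul' ?_ le_rfl
        calc ENNReal.ofReal (η x) ^ p ≤ ENNReal.ofReal (η x) ^ (1 : ℝ) :=
              ENNReal.rpow_le_rpow_of_exponent_ge (ENNReal.ofReal_le_one.2 (h1 x).2) (by linarith)
          _ = _ := ENNReal.rpow_one _

theorem hasCompactSupport_gradient {η : RN N → ℝ} (h : HasCompactSupport η) :
    HasCompactSupport (gradient η) :=
  (h.fderiv (𝕜 := ℝ)).comp_left (map_zero _)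

/-- The Sobolev inequality in `D^{1,p}`. -/
theorem D1p.exists_eLpNorm_fn_le {p : ℝ} (hp : 2 ≤ p) (hpN : p < N) :
    ∃ K : ℝ≥0∞, K < ⊤ ∧ ∀ w : D1p N p,
      (∫⁻ x, sobolevDensity w x) ^ (1 / sobolevExp N p) ≤
        K * (∫⁻ x, gradDensity w x) ^ (1 / p) := by
  obtain ⟨K, hK, hS⟩ := exists_eLpNorm_le_of_hasCompactSupport (N := N) hp hpN
  have hN : 0 < N := by
    have : (0 : ℝ) < N := by linarith
    exact_mod_cast this
  have hps := sobolevExp_pos hp hpN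
  have hp0 : 0 < p := by linarith
  obtain ⟨L, hL, hcut⟩ := exists_smooth_cutoffs hN
  refine ⟨K, hK, fun w => ?_⟩
  -- The radius `k + 1` is positive also for `k = 0`; the gradients vanish for `‖x‖ < k + 1`, so
  -- their cost `T k` involves only a tail of `|w|^{p^*}`.
  choose η hηs hηc h01 h1 h0 hg1 hg2 hLη using fun k : ℕ =>
    hcut 0 (k + 1) (by positivity)
  choose v hv1 hv2 using fun k => D1p.exists_mul_grad_le hp hpN w (hηs k)
    (hasCompactSupport_gradient (hηc k)) (h01 k)
  set T : ℕ → ℝ≥0∞ := fun k =>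
    ((∫⁻ x in {x : RN N | (k : ℝ) ≤ ‖x‖}, sobolevDensity w x) ^ (p / sobolevExp N p) *
      L ^ (p / N)) ^ (1 / p) with hT
  have hTlim : Tendsto T atTop (𝓝 0) := by
    have h2 := tendsto_lintegral_tail (D1p.lintegral_sobolevDensity_ne_top hp hpN w)
    have h3 : Tendsto (fun a : ℝ≥0∞ => (a ^ (p / sobolevExp N p) * L ^ (p / N)) ^ (1 / p)) (𝓝 0)
        (𝓝 (((0 : ℝ≥0∞) ^ (p / sobolevExp N p) * L ^ (p / N)) ^ (1 / p))) := by
      refine (ENNReal.continuous_rpow_const.tendsto _).comp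
        (ENNReal.Tendsto.mul_const (ENNReal.continuous_rpow_const.tendsto _) (Or.inr ?_))
      exact ENNReal.rpow_ne_top_of_nonneg (by positivity) hL.ne
    rw [ENNReal.zero_rpow_of_pos (by positivity), zero_mul,
      ENNReal.zero_rpow_of_pos (by positivity)] at h3
    exact h3.comp h2
  have hgrad : ∀ k, (∫⁻ x, gradDensity (v k) x) ^ (1 / p) ≤
      (∫⁻ x, gradDensity w x) ^ (1 / p) + T k := by
    intro k
    refine (hv2 k).trans (add_le_add (ENNReal.rpow_le_rpow (lintegral_mono fun x => ?_)
      (by positivity)) (ENNReal.rpow_le_rpow ?_ (by positivity)))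
    · exact mul_le_of_le_one_left' (ENNReal.ofReal_le_one.2 (h01 k x).2)
    · refine (lintegral_smul_gradient_le hp hpN (D1p.measurable_fn w) (hηs k)
        (S := {x : RN N | (k : ℝ) ≤ ‖x‖}) (measurableSet_le measurable_const measurable_norm)
        fun x hx => hg1 k x ?_).trans (mul_le_mul' le_rfl (ENNReal.rpow_le_rpow (hLη k)
          (by positivity)))
      rw [dist_zero_right]
      have : ‖x‖ < k := not_le.1 hx
      linarith
  have hlim : ∀ x, Tendsto (fun k => η k x * D1p.fn w x) atTop (𝓝 (D1p.fn w x)) := by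
    intro x
    obtain ⟨k0, hk0⟩ := exists_nat_gt ‖x‖
    refine tendsto_const_nhds.congr' ?_
    filter_upwards [eventually_ge_atTop k0] with k hk
    rw [h1 k x, one_mul]
    rw [dist_zero_right]
    have : (k0 : ℝ) ≤ k := Nat.cast_le.2 hk
    linarith
  rw [← D1p.eLpNorm_fn_eq hp hpN]
  have hηm : ∀ k, Measurable (η k) := fun k => (hηs k).continuous.measurable
  refine (Lp.eLpNorm_lim_le_liminf_eLpNorm (f := fun k x => η k x * D1p.fn w x)
    (fun k => by have := hηm k; exact Measurable.aestronglyMeasurable (by fun_prop)) (D1p.fn w)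
    (ae_of_all _ hlim)).trans ?_
  have hbound : ∀ k, eLpNorm (fun x => η k x * D1p.fn w x) (ENNReal.ofReal (sobolevExp N p)) volume
      ≤ K * ((∫⁻ x, gradDensity w x) ^ (1 / p) + T k) := by
    intro k
    have hwg := (D1p.isWeakGradient (v k)).congr (hv1 k) (Filter.EventuallyEq.refl _ _)
    refine (hS _ _ hwg (hηc k).mul_right).trans (mul_le_mul' le_rfl ?_)
    rw [D1p.eLpNorm_grad_eq hp]
    exact hgrad k
  have hl2 : Tendsto (fun k => K * ((∫⁻ x, gradDensity w x) ^ (1 / p) + T k)) atTop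
      (𝓝 (K * ((∫⁻ x, gradDensity w x) ^ (1 / p) + 0))) :=
    ENNReal.Tendsto.const_mul (tendsto_const_nhds.add hTlim) (Or.inr hK.ne)
  rw [add_zero] at hl2
  exact (liminf_le_liminf (Eventually.of_forall hbound)).trans hl2.liminf_eq.le

theorem D1p.exists_lintegral_sobolevDensity_le {p : ℝ} (hp : 2 ≤ p) (hpN : p < N) (M : ℝ) :
    ∃ K : ℝ≥0∞, K < ⊤ ∧ ∀ w : D1p N p, D1p.gradNorm w ≤ M → ∫⁻ x, sobolevDensity w x ≤ K := by
  obtain ⟨K, hK, h⟩ := D1p.exists_eLpNorm_fn_le (N := N) hp hpN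
  have hps := sobolevExp_pos hp hpN
  refine ⟨(K * (ENNReal.ofReal M ^ p) ^ (1 / p)) ^ sobolevExp N p, ?_, fun w hw => ?_⟩
  · refine ENNReal.rpow_lt_top_of_nonneg hps.le (ENNReal.mul_ne_top hK.ne ?_)
    exact ENNReal.rpow_ne_top_of_nonneg (by positivity)
      (ENNReal.rpow_ne_top_of_nonneg (by positivity) ENNReal.ofReal_ne_top)
  · have h2 := (h w).trans (mul_le_mul' le_rfl
      (ENNReal.rpow_le_rpow (D1p.lintegral_gradDensity_le hp w hw) (by positivity)))
    rwa [one_div (sobolevExp N p), ENNReal.rpow_inv_le_iff hps] at h2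

theorem sobolevConst_mul_le {p : ℝ} (hp : 2 ≤ p) (hpN : p < N) (w : D1p N p) :
    sobolevConst N p * (∫⁻ x, sobolevDensity w x) ^ (p / sobolevExp N p) ≤
      ∫⁻ x, gradDensity w x := by
  have hps := sobolevExp_pos hp hpN
  have hp0 : 0 < p := by linarith
  set I := ∫⁻ x, sobolevDensity w x with hI
  rcases eq_or_ne I 0 with h0 | h0
  · rw [h0, ENNReal.zero_rpow_of_pos (by positivity), mul_zero]
    exact zero_le
  have hIt : I ≠ ⊤ := D1p.lintegral_sobolevDensity_ne_top hp hpN w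
  set A := I ^ (1 / sobolevExp N p) with hA
  have hA0 : A ≠ 0 := (ENNReal.rpow_pos (pos_iff_ne_zero.2 h0) hIt).ne'
  have hAt : A ≠ ⊤ := ENNReal.rpow_ne_top_of_nonneg (by positivity) hIt
  set a : ℝ := A.toReal with ha
  have ha0 : 0 < a := ENNReal.toReal_pos hA0 hAt
  have hae : ‖a⁻¹‖ₑ = A⁻¹ := by
    rw [Real.enorm_eq_ofReal (by positivity), ENNReal.ofReal_inv_of_pos ha0,
      ENNReal.ofReal_toReal hAt]
  have hfn : D1p.fn (a⁻¹ • w) =ᵐ[volume] a⁻¹ • D1p.fn w := Lp.coeFn_smul a⁻¹ w.1.1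
  have hgr : D1p.grad (a⁻¹ • w) =ᵐ[volume] a⁻¹ • D1p.grad w := Lp.coeFn_smul a⁻¹ w.1.2
  have hnorm : eLpNorm (D1p.fn (a⁻¹ • w)) (ENNReal.ofReal (sobolevExp N p)) volume = 1 := by
    rw [eLpNorm_congr_ae hfn, eLpNorm_const_smul, D1p.eLpNorm_fn_eq hp hpN, hae]
    exact ENNReal.inv_mul_cancel hA0 hAt
  have h1 : sobolevConst N p ≤ ∫⁻ x, gradDensity (a⁻¹ • w) x := iInf₂_le (a⁻¹ • w) hnorm
  have h2 : ∫⁻ x, gradDensity (a⁻¹ • w) x = A⁻¹ ^ p * ∫⁻ x, gradDensity w x := by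
    rw [← lintegral_const_mul _ (measurable_gradDensity w)]
    refine lintegral_congr_ae (hgr.mono fun x hx => ?_)
    simp only [gradDensity]
    rw [hx, Pi.smul_apply, enorm_smul, ENNReal.mul_rpow_of_nonneg _ _ hp0.le, hae]
  have h3 : I ^ (p / sobolevExp N p) = A ^ p := by
    rw [hA, ← ENNReal.rpow_mul]
    congr 1
    ring
  rw [h2] at h1
  calc sobolevConst N p * I ^ (p / sobolevExp N p)
      ≤ (A⁻¹ ^ p * ∫⁻ x, gradDensity w x) * A ^ p := by
        rw [h3]
        exact mul_le_mul' h1 le_rfl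
    _ = (A⁻¹ * A) ^ p * ∫⁻ x, gradDensity w x := by
        rw [ENNReal.mul_rpow_of_nonneg _ _ hp0.le]
        ring
    _ = _ := by rw [ENNReal.inv_mul_cancel hA0 hAt, ENNReal.one_rpow, one_mul]

/-- The scaling identity `r t = p^*`, through which bounds for `|u|^r` in `L^t` become bounds for
`u` in `L^{p^*}`. -/
theorem steinWeissExp_mul {p β μ : ℝ} (hβμ : 2 * β + μ < N) (hp : 2 ≤ p) (hpN : p < N) :
    steinWeissExp N p β μ * (2 * N / (2 * N - 2 * β - μ)) = sobolevExp N p := by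
  have h1 : 2 * (N : ℝ) - 2 * β - μ ≠ 0 := by
    have : (0 : ℝ) < N := by linarith
    linarith
  have h2 : (N : ℝ) - p ≠ 0 := by linarith
  unfold steinWeissExp sobolevExp
  generalize hD : 2 * (N : ℝ) - 2 * β - μ = D at *
  field_simp

theorem steinWeissExp_pos {p β μ : ℝ} (hβμ : 2 * β + μ < N) (hp : 2 ≤ p) (hpN : p < N) :
    0 < steinWeissExp N p β μ := by
  unfold steinWeissExp
  have : 0 < 2 * (N : ℝ) - 2 * β - μ := by linarith
  have h2 : 0 < (N : ℝ) - p := by linarith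
  positivity

theorem D1p.lintegral_rpow_rpow {p β μ t : ℝ} (hβμ : 2 * β + μ < N) (hp : 2 ≤ p) (hpN : p < N)
    (ht : t = 2 * N / (2 * N - 2 * β - μ)) (w : D1p N p) (x : RN N) :
    (‖D1p.fn w x‖ₑ ^ steinWeissExp N p β μ) ^ t = sobolevDensity w x := by
  rw [← ENNReal.rpow_mul, ht, steinWeissExp_mul hβμ hp hpN]
  rfl

theorem D1p.lintegral_steinWeissDensity_eq {p β μ : ℝ} (w : D1p N p) :
    ∫⁻ x, steinWeissDensity β μ w x = steinWeissForm β μ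
      (fun x => ‖D1p.fn w x‖ₑ ^ steinWeissExp N p β μ)
      (fun x => ‖D1p.fn w x‖ₑ ^ steinWeissExp N p β μ) := rfl

theorem D1p.lintegral_steinWeissDensity_le {p β μ t : ℝ} (hβ : 0 ≤ β) (hμ : 0 < μ)
    (hβμ : 2 * β + μ < N) (hp : 2 ≤ p) (hpN : p < N)
    (ht : t = 2 * N / (2 * N - 2 * β - μ)) (w : D1p N p) :
    ∫⁻ x, steinWeissDensity β μ w x ≤
      steinWeissConst N β μ * (∫⁻ x, sobolevDensity w x) ^ (2 / t) := by
  have hs := D1p.lintegral_sobolevDensity_ne_top hp hpN w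
  have e : ∫⁻ x, (‖D1p.fn w x‖ₑ ^ steinWeissExp N p β μ) ^ t = ∫⁻ x, sobolevDensity w x :=
    lintegral_congr fun x => D1p.lintegral_rpow_rpow hβμ hp hpN ht w x
  have ht0 : 0 < t := one_pos.trans (steinWeiss_exponent_bounds hβ hμ hβμ ht).1
  have h := steinWeissForm_le hβ hμ hβμ ht
    (f := fun x => ‖D1p.fn w x‖ₑ ^ steinWeissExp N p β μ)
    (g := fun x => ‖D1p.fn w x‖ₑ ^ steinWeissExp N p β μ) (by fun_prop) (by fun_prop)
    (by rwa [e]) (by rwa [e])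
  rw [e, mul_assoc, ← ENNReal.rpow_add_of_nonneg _ _ (by positivity) (by positivity), ← add_div,
    one_add_one_eq_two] at h
  exact h

theorem D1p.lintegral_steinWeissDensity_ne_top {p β μ : ℝ} (hβ : 0 ≤ β) (hμ : 0 < μ)
    (hβμ : 2 * β + μ < N) (hp : 2 ≤ p) (hpN : p < N) (w : D1p N p) :
    ∫⁻ x, steinWeissDensity β μ w x ≠ ⊤ := by
  have ht0 := (steinWeiss_exponent_bounds hβ hμ hβμ rfl).1
  refine ne_top_of_le_ne_top (ENNReal.mul_ne_top (steinWeissConst_lt_top hβ hμ hβμ).ne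
    (ENNReal.rpow_ne_top_of_nonneg ?_ (D1p.lintegral_sobolevDensity_ne_top hp hpN w)))
    (D1p.lintegral_steinWeissDensity_le hβ hμ hβμ hp hpN rfl w)
  exact div_nonneg zero_le_two (by linarith)

theorem steinWeissSobolevConst_mul_le {p β μ : ℝ}
    (hβμ : 2 * β + μ < N) (hp : 2 ≤ p) (hpN : p < N) (w : D1p N p) :
    steinWeissSobolevConst N p β μ *
      (∫⁻ x, steinWeissDensity β μ w x) ^ (p / (2 * steinWeissExp N p β μ)) ≤
      ∫⁻ x, gradDensity w x := by
  have hr := steinWeissExp_pos (β := β) (μ := μ) hβμ hp hpN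
  by_cases h : w.1.1 = 0
  · have h0 : D1p.fn w =ᵐ[volume] 0 := by
      unfold D1p.fn
      rw [h]
      exact Lp.coeFn_zero _ _ _
    have h1 : ∫⁻ x, steinWeissDensity β μ w x = 0 := by
      rw [lintegral_eq_zero_iff (by fun_prop)]
      filter_upwards [h0] with x hx
      simp only [steinWeissDensity]
      rw [hx, Pi.zero_apply, enorm_zero, ENNReal.zero_rpow_of_pos hr, ENNReal.zero_div, mul_zero,
        Pi.zero_apply]
    rw [h1, ENNReal.zero_rpow_of_pos (by positivity), mul_zero]
    exact zero_le
  · exact ENNReal.mul_le_of_le_div (iInf₂_le w h)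

/-- Stein–Weiss followed by Sobolev bounds every quotient below by `1 / L`. Positivity permits
division by this constant and forces gradient atoms wherever `ζ` has atoms. -/
theorem steinWeissSobolevConst_pos {p β μ : ℝ} (hβ : 0 ≤ β) (hμ : 0 < μ)
    (hβμ : 2 * β + μ < N) (hp : 2 ≤ p) (hpN : p < N) : 0 < steinWeissSobolevConst N p β μ := by
  obtain ⟨K, hK, hS⟩ := D1p.exists_eLpNorm_fn_le (N := N) hp hpN
  have hr := steinWeissExp_pos (β := β) (μ := μ) hβμ hp hpN
  have hps := sobolevExp_pos hp hpN
  have hp0 : 0 < p := by linarith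
  set t : ℝ := 2 * N / (2 * N - 2 * β - μ) with ht
  set r := steinWeissExp N p β μ with hrdef
  have ht0 : 0 < t := one_pos.trans (steinWeiss_exponent_bounds hβ hμ hβμ ht).1
  have hrt : r * t = sobolevExp N p := steinWeissExp_mul hβμ hp hpN
  set C := steinWeissConst N β μ with hC
  have hCt : C ≠ ⊤ := (steinWeissConst_lt_top hβ hμ hβμ).ne
  set L : ℝ≥0∞ := C ^ (p / (2 * r)) * K ^ p with hL
  have hLt : L ≠ ⊤ := ENNReal.mul_ne_top (ENNReal.rpow_ne_top_of_nonneg (by positivity) hCt)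
    (ENNReal.rpow_ne_top_of_nonneg hp0.le hK.ne)
  have hSob : ∀ w : D1p N p, (∫⁻ x, sobolevDensity w x) ^ (p / sobolevExp N p) ≤
      K ^ p * ∫⁻ x, gradDensity w x := by
    intro w
    have h := ENNReal.rpow_le_rpow (hS w) hp0.le
    rwa [← ENNReal.rpow_mul, ENNReal.mul_rpow_of_nonneg _ _ hp0.le, ← ENNReal.rpow_mul,
      one_div_mul_cancel hp0.ne', ENNReal.rpow_one, one_div_mul_eq_div] at h
  have key : ∀ w : D1p N p, (∫⁻ x, steinWeissDensity β μ w x) ^ (p / (2 * r)) ≤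
      L * ∫⁻ x, gradDensity w x := by
    intro w
    refine (ENNReal.rpow_le_rpow (D1p.lintegral_steinWeissDensity_le hβ hμ hβμ hp hpN ht w)
      (by positivity)).trans ?_
    rw [ENNReal.mul_rpow_of_nonneg _ _ (by positivity), ← ENNReal.rpow_mul, hL, mul_assoc]
    refine mul_le_mul' le_rfl ?_
    have : 2 / t * (p / (2 * r)) = p / sobolevExp N p := by
      rw [← hrt]
      field_simp
    rw [this]
    exact hSob w
  have hinv : 0 < L⁻¹ := ENNReal.inv_pos.2 hLt
  refine hinv.trans_le (le_iInf₂ fun w hw => ?_)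
  -- A zero numerator could meet a zero denominator; the Sobolev inequality excludes it for `w ≠ 0`.
  have hg0 : ∫⁻ x, gradDensity w x ≠ 0 := by
    intro h0
    have h1 := hS w
    rw [h0, ENNReal.zero_rpow_of_pos (by positivity), mul_zero, ← D1p.eLpNorm_fn_eq hp hpN] at h1
    have h2 := (eLpNorm_eq_zero_iff (D1p.measurable_fn w).aestronglyMeasurable
      (ENNReal.ofReal_pos.2 hps).ne').1 (le_antisymm h1 zero_le)
    exact hw (Lp.eq_zero_iff_ae_eq_zero.2 h2)
  rw [ENNReal.le_div_iff_mul_le (Or.inr hg0)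
    (Or.inr (D1p.lintegral_gradDensity_ne_top hp w))]
  rw [← ENNReal.div_eq_inv_mul]
  exact ENNReal.div_le_of_le_mul' (key w)

end

noncomputable section

variable {N : ℕ}

/-! ### Concentration of the interaction energy -/

/-- The density of the interaction energy `steinWeissForm β μ f f`. -/
def interactionDensity (β μ : ℝ) (f : RN N → ℝ≥0∞) (x : RN N) : ℝ≥0∞ :=
  weightedPotential β μ f x * (f x / ‖x‖ₑ ^ β)

@[fun_prop]
theorem measurable_interactionDensity (β μ : ℝ) {f : RN N → ℝ≥0∞} (hf : Measurable f) :
    Measurable (interactionDensity β μ f) := by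
  unfold interactionDensity
  fun_prop

theorem lintegral_mul_interactionDensity (β μ : ℝ) (f φ : RN N → ℝ≥0∞) :
    ∫⁻ x, φ x * interactionDensity β μ f x = steinWeissForm β μ (fun x => φ x * f x) f :=
  lintegral_congr fun x => by
    simp only [interactionDensity, div_eq_mul_inv]
    ring

theorem setLIntegral_interactionDensity (β μ : ℝ) (f : RN N → ℝ≥0∞) {A : Set (RN N)}
    (hA : MeasurableSet A) :
    ∫⁻ x in A, interactionDensity β μ f x = steinWeissForm β μ (A.indicator f) f := by
  rw [← lintegral_indicator hA]
  refine lintegral_congr fun x => ?_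
  by_cases hx : x ∈ A <;> simp [hx, interactionDensity]

theorem steinWeissForm_add_add {β μ : ℝ} (hβ : 0 ≤ β) (hμ : 0 < μ) {f f' g g' : RN N → ℝ≥0∞}
    (hf : Measurable f) (hf' : Measurable f') (hg : Measurable g) (hg' : Measurable g') :
    steinWeissForm β μ (f + f') (g + g') = steinWeissForm β μ f g + steinWeissForm β μ f g' +
      (steinWeissForm β μ f' g + steinWeissForm β μ f' g') := by
  rw [steinWeissForm_add_left hf (hg.add hg'), steinWeissForm_add_right hβ hμ hf hg hg',
    steinWeissForm_add_right hβ hμ hf' hg hg']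

theorem lintegral_indicator_rpow {t : ℝ} (ht : 0 < t) (f : RN N → ℝ≥0∞) {A : Set (RN N)}
    (hA : MeasurableSet A) : ∫⁻ x, (A.indicator f x) ^ t = ∫⁻ x in A, f x ^ t := by
  rw [← lintegral_indicator hA]
  refine lintegral_congr fun x => ?_
  by_cases hx : x ∈ A <;> simp [hx, ht]

/-- The remainder is `|f n - f'|`, written with truncated subtraction. One of its two terms always
vanishes, which is why the power bound holds with constant one for every `t > 0`. -/
theorem exists_remainder {t : ℝ} (ht : 0 < t) {f : ℕ → RN N → ℝ≥0∞} {f' : RN N → ℝ≥0∞}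
    (hf : ∀ n, Measurable (f n)) (hf' : Measurable f') (hfin : ∀ x, f' x ≠ ⊤)
    (hae : ∀ᵐ x, Tendsto (fun n => f n x) atTop (𝓝 (f' x))) :
    ∃ g : ℕ → RN N → ℝ≥0∞, (∀ n, Measurable (g n)) ∧ (∀ n x, f n x ≤ f' x + g n x) ∧
      (∀ n x, g n x ^ t ≤ f n x ^ t + f' x ^ t) ∧
      ∀ᵐ x, Tendsto (fun n => g n x) atTop (𝓝 0) := by
  refine ⟨fun n x => (f n x - f' x) + (f' x - f n x), fun n => ?_, fun n x => ?_, fun n x => ?_, ?_⟩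
  · have := hf n
    fun_prop
  · rw [← add_assoc]
    exact le_add_tsub.trans le_self_add
  · rcases le_total (f n x) (f' x) with h | h
    · simp only [tsub_eq_zero_of_le h, zero_add]
      exact (ENNReal.rpow_le_rpow tsub_le_self ht.le).trans le_add_self
    · simp only [tsub_eq_zero_of_le h, add_zero]
      exact (ENNReal.rpow_le_rpow tsub_le_self ht.le).trans le_self_add
  · filter_upwards [hae] with x hx
    have h1 : Tendsto (fun n => f n x - f' x) atTop (𝓝 (f' x - f' x)) :=
      ENNReal.Tendsto.sub hx tendsto_const_nhds (Or.inr (hfin x))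
    have h2 : Tendsto (fun n => f' x - f n x) atTop (𝓝 (f' x - f' x)) :=
      ENNReal.Tendsto.sub tendsto_const_nhds hx (Or.inl (hfin x))
    have h3 := h1.add h2
    simpa using h3

/-- The compact set `A` is at positive distance from `Vᶜ`, so the interaction is at most a constant
times the square of the interaction of `g n` with the unit ball, which vanishes. -/
theorem tendsto_steinWeissForm_far {β μ t : ℝ} (hβ : 0 ≤ β) (hμ : 0 < μ) (hβμ : 2 * β + μ < N)
    (ht : t = 2 * N / (2 * N - 2 * β - μ)) {g : ℕ → RN N → ℝ≥0∞} (hg : ∀ n, Measurable (g n))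
    (hae : ∀ᵐ x, Tendsto (fun n => g n x) atTop (𝓝 0)) {M : ℝ≥0∞} (hM : M ≠ ⊤)
    (hgM : ∀ n, ∫⁻ x, g n x ^ t ≤ M) {A V : Set (RN N)} (hA : IsCompact A) (hV : IsOpen V)
    (hAV : A ⊆ V) :
    Tendsto (fun n => steinWeissForm β μ (A.indicator (g n)) (Vᶜ.indicator (g n))) atTop
      (𝓝 0) := by
  have ht0 : 0 < t := one_pos.trans (steinWeiss_exponent_bounds hβ hμ hβμ ht).1
  obtain ⟨R, hR⟩ := hA.isBounded.exists_norm_le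
  obtain ⟨d, hd, hdV⟩ := hA.exists_cthickening_subset_open hV hAV
  obtain ⟨c, hc, hfar⟩ := exists_steinWeissForm_far_le (N := N) (β := β) (μ := μ) hβ hμ
    (abs_nonneg R) hd
  set e : RN N → ℝ≥0∞ := (Metric.ball (0 : RN N) 1).indicator fun _ => 1 with he
  have hem : Measurable e := measurable_const.indicator measurableSet_ball
  have hlim := tendsto_steinWeissForm_zero hβ hμ hβμ ht hg hem hae hM hgM (by
    rw [he, lintegral_indicator_rpow ht0 _ measurableSet_ball]
    simp [measure_ball_lt_top.ne])
  have h2 : Tendsto (fun n => c * steinWeissForm β μ (g n) e * steinWeissForm β μ (g n) e) atTop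
      (𝓝 (c * 0 * 0)) :=
    ENNReal.Tendsto.mul (ENNReal.Tendsto.const_mul hlim (Or.inr hc.ne)) (Or.inr (by simp)) hlim
      (Or.inr (by simp))
  rw [mul_zero] at h2
  refine tendsto_of_tendsto_of_tendsto_of_le_of_le tendsto_const_nhds h2 (fun _ => zero_le)
    fun n => hfar _ _ (hg n) (hg n) A V hA.measurableSet hV.measurableSet
      (fun x hx => (hR x hx).trans (le_abs_self R)) fun x hx y hy => ?_
  by_contra h
  refine hy (hdV (Metric.mem_cthickening_of_dist_le y x d A hx ?_))
  rw [dist_comm]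
  exact (not_le.1 h).le

/-- The data shared by the concentration estimates: `f n → f'` almost everywhere with bounded
`L^t` norms. -/
structure InteractionSeq (β μ t : ℝ) (f : ℕ → RN N → ℝ≥0∞) (f' : RN N → ℝ≥0∞) (M : ℝ≥0∞) :
    Prop where
  hβ : 0 ≤ β
  hμ : 0 < μ
  hβμ : 2 * β + μ < N
  ht : t = 2 * N / (2 * N - 2 * β - μ)
  hf : ∀ n, Measurable (f n)
  hf' : Measurable f'
  hfin : ∀ x, f' x ≠ ⊤
  hae : ∀ᵐ x, Tendsto (fun n => f n x) atTop (𝓝 (f' x))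
  hM : M ≠ ⊤
  hfM : ∀ n, ∫⁻ x, f n x ^ t ≤ M
  hfM' : ∫⁻ x, f' x ^ t ≤ M

namespace InteractionSeq

variable {β μ t : ℝ} {f : ℕ → RN N → ℝ≥0∞} {f' : RN N → ℝ≥0∞} {M : ℝ≥0∞}

theorem one_lt (h : InteractionSeq β μ t f f' M) : 1 < t :=
  (steinWeiss_exponent_bounds h.hβ h.hμ h.hβμ h.ht).1

theorem lt_two (h : InteractionSeq β μ t f f' M) : t < 2 :=
  (steinWeiss_exponent_bounds h.hβ h.hμ h.hβμ h.ht).2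

theorem form_ne_top (h : InteractionSeq β μ t f f' M) {g g' : RN N → ℝ≥0∞} (hg : Measurable g)
    (hg' : Measurable g') (h1 : ∫⁻ x, g x ^ t ≠ ⊤) (h1' : ∫⁻ x, g' x ^ t ≠ ⊤) :
    steinWeissForm β μ g g' ≠ ⊤ := by
  have ht0 : 0 < t := one_pos.trans h.one_lt
  refine ne_top_of_le_ne_top ?_ (steinWeissForm_le h.hβ h.hμ h.hβμ h.ht hg hg' h1 h1')
  exact ENNReal.mul_ne_top (ENNReal.mul_ne_top (steinWeissConst_lt_top h.hβ h.hμ h.hβμ).ne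
    (ENNReal.rpow_ne_top_of_nonneg (by positivity) h1))
    (ENNReal.rpow_ne_top_of_nonneg (by positivity) h1')

theorem lintegral_density_ne_top (h : InteractionSeq β μ t f f' M) (n : ℕ) :
    ∫⁻ x, interactionDensity β μ (f n) x ≠ ⊤ :=
  h.form_ne_top (h.hf n) (h.hf n) (ne_top_of_le_ne_top h.hM (h.hfM n))
    (ne_top_of_le_ne_top h.hM (h.hfM n))

theorem lintegral_density_limit_ne_top (h : InteractionSeq β μ t f f' M) :
    ∫⁻ x, interactionDensity β μ f' x ≠ ⊤ :=
  h.form_ne_top h.hf' h.hf' (ne_top_of_le_ne_top h.hM h.hfM') (ne_top_of_le_ne_top h.hM h.hfM')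

/-- The remainder `g n` of `f n` with its vanishing interactions. -/
theorem exists_remainder (h : InteractionSeq β μ t f f' M) :
    ∃ g : ℕ → RN N → ℝ≥0∞, (∀ n, Measurable (g n)) ∧ (∀ n x, f n x ≤ f' x + g n x) ∧
      (∀ n x, g n x ^ t ≤ f n x ^ t + f' x ^ t) ∧
      Tendsto (fun n => steinWeissForm β μ f' (g n) + steinWeissForm β μ (g n) f') atTop (𝓝 0) ∧
      ∀ A V : Set (RN N), IsCompact A → IsOpen V → A ⊆ V →
        Tendsto (fun n => steinWeissForm β μ (A.indicator (g n)) (Vᶜ.indicator (g n))) atTop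
          (𝓝 0) := by
  have ht0 : 0 < t := one_pos.trans h.one_lt
  obtain ⟨g, hg, hle, hpow, hae⟩ := _root_.exists_remainder ht0 h.hf h.hf' h.hfin h.hae
  have hgM : ∀ n, ∫⁻ x, g n x ^ t ≤ M + M := by
    intro n
    refine (lintegral_mono (hpow n)).trans ?_
    rw [lintegral_add_left ((h.hf n).pow_const t)]
    exact add_le_add (h.hfM n) h.hfM'
  have hMM : M + M ≠ ⊤ := ENNReal.add_ne_top.2 ⟨h.hM, h.hM⟩
  refine ⟨g, hg, hle, hpow, ?_, fun A V hA hV hAV =>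
    tendsto_steinWeissForm_far h.hβ h.hμ h.hβμ h.ht hg hae hMM hgM hA hV hAV⟩
  have h1 := tendsto_steinWeissForm_zero h.hβ h.hμ h.hβμ h.ht hg h.hf' hae hMM hgM
    (ne_top_of_le_ne_top h.hM h.hfM')
  have h2 := h1.add h1
  rw [add_zero] at h2
  refine h2.congr fun n => ?_
  rw [steinWeissForm_comm h.hβ h.hμ h.hf' (hg n)]

/-- Fatou in `y` for the potential, and convergence at the fixed point `x` for the other factor. -/
theorem ae_le_liminf_density (h : InteractionSeq β μ t f f' M) :
    ∀ᵐ x, interactionDensity β μ f' x ≤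
      liminf (fun n => interactionDensity β μ (f n) x) atTop := by
  have hx0 : ∀ᵐ x : RN N, x ≠ 0 := by
    have hN : 0 < N := by
      have : (0 : ℝ) < N := by linarith [h.hβ, h.hμ, h.hβμ]
      exact_mod_cast this
    have : Nonempty (Fin N) := ⟨⟨0, hN⟩⟩
    exact Measure.ae_ne volume 0
  filter_upwards [h.hae, hx0] with x hx hxne
  have hpot : weightedPotential β μ f' x ≤
      liminf (fun n => weightedPotential β μ (f n) x) atTop := by
    refine le_trans (lintegral_mono_ae (h.hae.mono fun y hy => ?_)) (lintegral_liminf_le fun n => by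
      have := h.hf n
      fun_prop)
    simp only [div_eq_mul_inv]
    -- The kernel factor may be infinite, where multiplication is continuous only away from the
    -- value zero.
    by_cases hf0 : f' y = 0
    · simp [hf0]
    · exact ((ENNReal.Tendsto.mul_const hy (Or.inl hf0)).liminf_eq).ge
  have hne : ‖x‖ₑ ^ β ≠ 0 := by
    simp [ENNReal.rpow_eq_zero_iff, hxne]
  have hfx : Tendsto (fun n => f n x / ‖x‖ₑ ^ β) atTop (𝓝 (f' x / ‖x‖ₑ ^ β)) :=
    ENNReal.Tendsto.div_const hx (Or.inr hne)
  have h3 := hfx.liminf_eq.ge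
  exact (mul_le_mul' hpot h3).trans ENNReal.le_liminf_mul

/-- The reverse Hölder estimate for the defect `κ`: after the limit energy is subtracted, only the
near interaction of the remainder with itself survives, and Stein–Weiss bounds it by a squared local
`L^t` norm. -/
theorem measure_le_of_eq_add (h : InteractionSeq β μ t f f' M) {ω ζ κ : Measure (RN N)}
    [IsFiniteMeasure ω] [IsFiniteMeasure ζ]
    (hω : TendstoMeasure (fun n x => f n x ^ t) ω)
    (hζ : TendstoMeasure (fun n => interactionDensity β μ (f n)) ζ)
    (hκ : ζ = volume.withDensity (interactionDensity β μ f') + κ) {K U : Set (RN N)}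
    (hK : IsCompact K) (hU : IsOpen U) (hKU : K ⊆ U) :
    κ K ≤ steinWeissConst N β μ * (ω + volume.withDensity fun x => f' x ^ t) U ^ (2 / t) := by
  have ht0 : 0 < t := one_pos.trans h.one_lt
  -- Two nested cutoffs: `φ` localises the energy inside `V`, and `ψ`, equal to one on the closure
  -- of `V`, localises the `L^t` mass inside `U`.
  obtain ⟨V, hV, hKV, hVU, hVc⟩ := exists_open_between_and_isCompact_closure hK hU hKU
  obtain ⟨φ, hφ, hφc, hφ1, hφs, hφ01⟩ := exists_cutoff hK hV hKV
  obtain ⟨ψ, hψ, hψc, hψ1, hψs, hψ01⟩ := exists_cutoff hVc hU hVU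
  obtain ⟨g, hg, hle, hpow, hmix, hfar⟩ := h.exists_remainder
  set A := tsupport φ with hA
  have hAm : MeasurableSet A := (isClosed_tsupport φ).measurableSet
  have hVm := hV.measurableSet
  have hfm' := h.hf'
  have hFm : Measurable (interactionDensity β μ f') := by fun_prop
  have hφm : Measurable fun x => ENNReal.ofReal (φ x) := by
    have := hφ.measurable
    fun_prop
  have hφA : ∀ x, ENNReal.ofReal (φ x) ≤ A.indicator 1 x := by
    intro x
    by_cases hx : x ∈ A
    · rw [Set.indicator_of_mem hx]
      exact ENNReal.ofReal_le_one.2 (hφ01 x).2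
    · rw [image_eq_zero_of_notMem_tsupport hx, ENNReal.ofReal_zero]
      exact zero_le
  set C := steinWeissConst N β μ with hC
  have hCt : C ≠ ⊤ := (steinWeissConst_lt_top h.hβ h.hμ h.hβμ).ne
  have hgV : ∀ n, ∫⁻ x in V, g n x ^ t ≤
      (∫⁻ x, ENNReal.ofReal (ψ x) * f n x ^ t) + ∫⁻ x, ENNReal.ofReal (ψ x) * f' x ^ t := by
    intro n
    have hfn := h.hf n
    have hψm := hψ.measurable
    rw [← lintegral_add_left (by fun_prop), ← lintegral_indicator hVm]
    refine lintegral_mono fun x => ?_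
    by_cases hx : x ∈ V
    · rw [Set.indicator_of_mem hx, hψ1 x (subset_closure hx), ENNReal.ofReal_one, one_mul, one_mul]
      exact hpow n x
    · rw [Set.indicator_of_notMem hx]
      exact zero_le
  have hgfin : ∀ n, ∫⁻ x, g n x ^ t ≠ ⊤ := by
    intro n
    refine ne_top_of_le_ne_top (ENNReal.add_ne_top.2 ⟨h.hM, h.hM⟩)
      ((lintegral_mono (hpow n)).trans ?_)
    rw [lintegral_add_left ((h.hf n).pow_const t)]
    exact add_le_add (h.hfM n) h.hfM'
  have hmain : ∀ n, ∫⁻ x, ENNReal.ofReal (φ x) * interactionDensity β μ (f n) x ≤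
      (∫⁻ x, ENNReal.ofReal (φ x) * interactionDensity β μ f' x) +
        C * ((∫⁻ x, ENNReal.ofReal (ψ x) * f n x ^ t) +
          ∫⁻ x, ENNReal.ofReal (ψ x) * f' x ^ t) ^ (2 / t) +
        ((steinWeissForm β μ f' (g n) + steinWeissForm β μ (g n) f') +
          steinWeissForm β μ (A.indicator (g n)) (Vᶜ.indicator (g n))) := by
    intro n
    have hgm := hg n
    rw [lintegral_mul_interactionDensity, lintegral_mul_interactionDensity]
    have hsplit : g n = V.indicator (g n) + Vᶜ.indicator (g n) :=
      (Set.indicator_self_add_compl V (g n)).symm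
    -- The second remainder is cut along `V`: Stein–Weiss bounds the part inside, and the part
    -- outside is at positive distance from the support of `φ`.
    have hgg : steinWeissForm β μ (fun x => ENNReal.ofReal (φ x) * g n x) (g n) ≤
        C * ((∫⁻ x, ENNReal.ofReal (ψ x) * f n x ^ t) +
          ∫⁻ x, ENNReal.ofReal (ψ x) * f' x ^ t) ^ (2 / t) +
          steinWeissForm β μ (A.indicator (g n)) (Vᶜ.indicator (g n)) := by
      have hAg : ∀ x, ENNReal.ofReal (φ x) * g n x ≤ A.indicator (g n) x := by
        intro x
        refine (mul_le_mul' (hφA x) le_rfl).trans ?_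
        by_cases hx : x ∈ A <;> simp [hx]
      have hAV : ∀ x, A.indicator (g n) x ≤ V.indicator (g n) x :=
        Set.indicator_le_indicator_of_subset hφs (fun _ => zero_le)
      calc steinWeissForm β μ (fun x => ENNReal.ofReal (φ x) * g n x) (g n)
          ≤ steinWeissForm β μ (A.indicator (g n)) (g n) :=
            steinWeissForm_mono hAg fun _ => le_rfl
        _ = steinWeissForm β μ (A.indicator (g n)) (V.indicator (g n)) +
            steinWeissForm β μ (A.indicator (g n)) (Vᶜ.indicator (g n)) := by
            rw [← steinWeissForm_add_right h.hβ h.hμ (hgm.indicator hAm) (hgm.indicator hVm)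
              (hgm.indicator hVm.compl), ← hsplit]
        _ ≤ _ := by
            refine add_le_add ((steinWeissForm_mono hAV fun _ => le_rfl).trans ?_) le_rfl
            have hVt : ∫⁻ x, V.indicator (g n) x ^ t = ∫⁻ x in V, g n x ^ t :=
              lintegral_indicator_rpow ht0 _ hVm
            have hVfin : ∫⁻ x, V.indicator (g n) x ^ t ≠ ⊤ := by
              rw [hVt]
              exact ne_top_of_le_ne_top (hgfin n) (setLIntegral_le_lintegral _ _)
            refine (steinWeissForm_le h.hβ h.hμ h.hβμ h.ht (hgm.indicator hVm)
              (hgm.indicator hVm) hVfin hVfin).trans ?_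
            rw [hVt, mul_assoc, ← ENNReal.rpow_add_of_nonneg _ _ (by positivity) (by positivity),
              ← add_div, one_add_one_eq_two]
            exact mul_le_mul' le_rfl (ENNReal.rpow_le_rpow (hgV n) (by positivity))
    have hφg : ∀ x, ENNReal.ofReal (φ x) * g n x ≤ g n x := fun x =>
      mul_le_of_le_one_left' (ENNReal.ofReal_le_one.2 (hφ01 x).2)
    have hφf : ∀ x, ENNReal.ofReal (φ x) * f' x ≤ f' x := fun x =>
      mul_le_of_le_one_left' (ENNReal.ofReal_le_one.2 (hφ01 x).2)
    calc steinWeissForm β μ (fun x => ENNReal.ofReal (φ x) * f n x) (f n)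
        ≤ steinWeissForm β μ ((fun x => ENNReal.ofReal (φ x) * f' x) +
            fun x => ENNReal.ofReal (φ x) * g n x) (f' + g n) := by
          refine steinWeissForm_mono (fun x => ?_) (hle n)
          rw [Pi.add_apply, ← mul_add]
          exact mul_le_mul' le_rfl (hle n x)
      _ = _ := steinWeissForm_add_add h.hβ h.hμ (by fun_prop) (by fun_prop) hfm' hgm
      _ ≤ (steinWeissForm β μ (fun x => ENNReal.ofReal (φ x) * f' x) f' +
            steinWeissForm β μ f' (g n)) + (steinWeissForm β μ (g n) f' + _) :=
          add_le_add (add_le_add le_rfl (steinWeissForm_mono hφf fun _ => le_rfl))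
            (add_le_add (steinWeissForm_mono hφg fun _ => le_rfl) hgg)
      _ = _ := by ring
  have hlimζ := hζ.tendsto_lintegral (fun n => by have := h.hf n; fun_prop)
    h.lintegral_density_ne_top hφ hφc hφ01
  have hlimω := hω.tendsto_lintegral (fun n => (h.hf n).pow_const t)
    (fun n => ne_top_of_le_ne_top h.hM (h.hfM n)) hψ hψc hψ01
  set b := ∫⁻ x, ENNReal.ofReal (ψ x) * f' x ^ t with hb
  set a := ∫⁻ x, ENNReal.ofReal (φ x) * interactionDensity β μ f' x with ha
  have hlimR : Tendsto (fun n => a +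
        C * ((∫⁻ x, ENNReal.ofReal (ψ x) * f n x ^ t) + b) ^ (2 / t) +
        ((steinWeissForm β μ f' (g n) + steinWeissForm β μ (g n) f') +
          steinWeissForm β μ (A.indicator (g n)) (Vᶜ.indicator (g n)))) atTop
      (𝓝 (a + C * ((∫⁻ x, ENNReal.ofReal (ψ x) ∂ω) + b) ^ (2 / t) + (0 + 0))) := by
    refine (tendsto_const_nhds.add (ENNReal.Tendsto.const_mul ?_ (Or.inr hCt))).add
      (hmix.add (hfar A V hφc.isCompact hV hφs))
    exact (ENNReal.continuous_rpow_const.tendsto _).comp (hlimω.add_const b)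
  have hfinal := le_of_tendsto_of_tendsto' hlimζ hlimR hmain
  rw [add_zero, add_zero, hκ, lintegral_add_measure,
    lintegral_withDensity_eq_lintegral_mul _ hFm hφm] at hfinal
  have ha' : ∫⁻ x, (interactionDensity β μ f' * fun x => ENNReal.ofReal (φ x)) x = a :=
    lintegral_congr fun x => mul_comm _ _
  rw [ha'] at hfinal
  have hat : a ≠ ⊤ := by
    refine ne_top_of_le_ne_top h.lintegral_density_limit_ne_top (lintegral_mono fun x => ?_)
    exact mul_le_of_le_one_left' (ENNReal.ofReal_le_one.2 (hφ01 x).2)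
  -- The localised energy of the limit occurs on both sides and is finite, so it cancels and leaves
  -- `κ`.
  have hcancel := (ENNReal.add_le_add_iff_left hat).1 hfinal
  refine ((measure_le_lintegral_cutoff κ hK.measurableSet hφ1).trans hcancel).trans
    (mul_le_mul' le_rfl (ENNReal.rpow_le_rpow ?_ (by positivity)))
  rw [Measure.add_apply, withDensity_apply _ hU.measurableSet]
  refine add_le_add (lintegral_cutoff_le_measure ω hU.measurableSet hψs hψ01) ?_
  rw [← lintegral_indicator hU.measurableSet]
  refine lintegral_mono fun x => ?_
  by_cases hx : x ∈ U
  · rw [Set.indicator_of_mem hx]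
    exact mul_le_of_le_one_left' (ENNReal.ofReal_le_one.2 (hψ01 x).2)
  · rw [image_eq_zero_of_notMem_tsupport fun h' => hx (hψs h'), ENNReal.ofReal_zero, zero_mul]
    exact zero_le

/-- An atom of the limit energy is produced by the interaction of `f n` with itself near the
atom. -/
theorem measure_singleton_le (h : InteractionSeq β μ t f f' M) {ζ : Measure (RN N)}
    [IsFiniteMeasure ζ] (hζ : TendstoMeasure (fun n => interactionDensity β μ (f n)) ζ)
    {z : RN N} {V : Set (RN N)} (hV : IsOpen V) (hz : z ∈ V) :
    ζ {z} ≤ limsup (fun n => steinWeissForm β μ (V.indicator (f n)) (V.indicator (f n))) atTop +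
      steinWeissForm β μ (V.indicator f') f' := by
  obtain ⟨φ, hφ, hφc, hφ1, hφs, hφ01⟩ :=
    exists_cutoff (isCompact_singleton (x := z)) hV (Set.singleton_subset_iff.2 hz)
  obtain ⟨g, hg, hle, hpow, hmix, hfar⟩ := h.exists_remainder
  set A := tsupport φ with hA
  have hAm : MeasurableSet A := (isClosed_tsupport φ).measurableSet
  have hVm := hV.measurableSet
  have hfm' := h.hf'
  have hmain : ∀ n, ∫⁻ x, ENNReal.ofReal (φ x) * interactionDensity β μ (f n) x ≤
      steinWeissForm β μ (V.indicator (f n)) (V.indicator (f n)) +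
      (steinWeissForm β μ (V.indicator f') f' +
        ((steinWeissForm β μ f' (g n) + steinWeissForm β μ (g n) f') +
          steinWeissForm β μ (A.indicator (g n)) (Vᶜ.indicator (g n)))) := by
    intro n
    have hgm := hg n
    have hfn := h.hf n
    rw [lintegral_mul_interactionDensity]
    have hsplit : f n = V.indicator (f n) + Vᶜ.indicator (f n) :=
      (Set.indicator_self_add_compl V (f n)).symm
    have hAf : ∀ x, ENNReal.ofReal (φ x) * f n x ≤ A.indicator (f n) x := by
      intro x
      by_cases hx : x ∈ A
      · rw [Set.indicator_of_mem hx]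
        exact mul_le_of_le_one_left' (ENNReal.ofReal_le_one.2 (hφ01 x).2)
      · rw [image_eq_zero_of_notMem_tsupport hx, ENNReal.ofReal_zero, zero_mul]
        exact zero_le
    have hAV : ∀ (q : RN N → ℝ≥0∞) x, A.indicator q x ≤ V.indicator q x := fun q =>
      Set.indicator_le_indicator_of_subset hφs (fun _ => zero_le)
    have hself : ∀ (S : Set (RN N)) (q : RN N → ℝ≥0∞) x, S.indicator q x ≤ q x := fun S q x =>
      Set.indicator_le_self' (fun _ _ => zero_le) x
    have hind : ∀ (S : Set (RN N)) x, S.indicator (f n) x ≤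
        (S.indicator f' + S.indicator (g n)) x := by
      intro S x
      rw [← Set.indicator_add']
      exact Set.indicator_le_indicator (hle n x)
    -- On `V × V` the sequence is kept whole, ready for the inequality defining `S_{β,μ}`. Only the
    -- interaction between `A` and `Vᶜ` is expanded into limit and remainder.
    calc steinWeissForm β μ (fun x => ENNReal.ofReal (φ x) * f n x) (f n)
        ≤ steinWeissForm β μ (A.indicator (f n)) (f n) := steinWeissForm_mono hAf fun _ => le_rfl
      _ = steinWeissForm β μ (A.indicator (f n)) (V.indicator (f n)) +
            steinWeissForm β μ (A.indicator (f n)) (Vᶜ.indicator (f n)) := by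
          rw [← steinWeissForm_add_right h.hβ h.hμ (hfn.indicator hAm) (hfn.indicator hVm)
              (hfn.indicator hVm.compl), ← hsplit]
      _ ≤ steinWeissForm β μ (V.indicator (f n)) (V.indicator (f n)) +
            steinWeissForm β μ (A.indicator f' + A.indicator (g n))
              (Vᶜ.indicator f' + Vᶜ.indicator (g n)) :=
          add_le_add (steinWeissForm_mono (hAV _) fun _ => le_rfl)
            (steinWeissForm_mono (hind A) (hind Vᶜ))
      _ = steinWeissForm β μ (V.indicator (f n)) (V.indicator (f n)) +
            (steinWeissForm β μ (A.indicator f') (Vᶜ.indicator f') +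
              steinWeissForm β μ (A.indicator f') (Vᶜ.indicator (g n)) +
            (steinWeissForm β μ (A.indicator (g n)) (Vᶜ.indicator f') +
              steinWeissForm β μ (A.indicator (g n)) (Vᶜ.indicator (g n)))) := by
          rw [steinWeissForm_add_add h.hβ h.hμ (hfm'.indicator hAm) (hgm.indicator hAm)
            (hfm'.indicator hVm.compl) (hgm.indicator hVm.compl)]
      _ ≤ steinWeissForm β μ (V.indicator (f n)) (V.indicator (f n)) +
            (steinWeissForm β μ (V.indicator f') f' + steinWeissForm β μ f' (g n) +
            (steinWeissForm β μ (g n) f' +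
              steinWeissForm β μ (A.indicator (g n)) (Vᶜ.indicator (g n)))) :=
          add_le_add le_rfl (add_le_add (add_le_add (steinWeissForm_mono (hAV _) (hself _ _))
            (steinWeissForm_mono (hself _ _) (hself _ _)))
            (add_le_add (steinWeissForm_mono (hself _ _) (hself _ _)) le_rfl))
      _ = _ := by ring
  have hlimζ := hζ.tendsto_lintegral (fun n => by have := h.hf n; fun_prop)
    h.lintegral_density_ne_top hφ hφc hφ01
  have hlim2 := (tendsto_const_nhds (x := steinWeissForm β μ (V.indicator f') f')).add
    (hmix.add (hfar A V hφc.isCompact hV hφs))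
  rw [add_zero, add_zero] at hlim2
  have hfin : steinWeissForm β μ (V.indicator f') f' ≠ ⊤ :=
    ne_top_of_le_ne_top h.lintegral_density_limit_ne_top
      (steinWeissForm_mono (fun x => Set.indicator_le_self' (fun _ _ => zero_le) x)
        fun _ => le_rfl)
  calc ζ {z} ≤ ∫⁻ x, ENNReal.ofReal (φ x) ∂ζ :=
        measure_le_lintegral_cutoff ζ (measurableSet_singleton z) hφ1
    _ = limsup (fun n => ∫⁻ x, ENNReal.ofReal (φ x) * interactionDensity β μ (f n) x) atTop :=
        hlimζ.limsup_eq.symm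
    _ ≤ _ := limsup_le_limsup (Eventually.of_forall hmain)
    _ ≤ _ := limsup_add_le_of_tendsto hfin hlim2

/-- The interaction energy at infinity. -/
theorem massAtInfinity_rpow_le (h : InteractionSeq β μ t f f' M) {ω : Measure (RN N)}
    [IsFiniteMeasure ω] (hω : TendstoMeasure (fun n x => f n x ^ t) ω) :
    massAtInfinity (fun n => interactionDensity β μ (f n)) ^ t ≤
      steinWeissConst N β μ ^ t * (massAtInfinity (fun n x => f n x ^ t) *
        (massAtInfinity (fun n x => f n x ^ t) + ω Set.univ)) := by
  have ht0 : 0 < t := one_pos.trans h.one_lt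
  set C := steinWeissConst N β μ with hC
  have hCt : C ≠ ⊤ := (steinWeissConst_lt_top h.hβ h.hμ h.hβμ).ne
  set L := massAtInfinity (fun n x => f n x ^ t) + ω Set.univ with hL
  have hlimsup : limsup (fun n => ∫⁻ x, f n x ^ t) atTop = L :=
    hω.limsup_lintegral (fun n => (h.hf n).pow_const t)
      fun n => ne_top_of_le_ne_top h.hM (h.hfM n)
  have hLM : L ≤ M := by
    rw [← hlimsup]
    exact limsup_le_of_le (by isBoundedDefault) (Eventually.of_forall h.hfM)
  have hLt : L ≠ ⊤ := ne_top_of_le_ne_top h.hM hLM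
  have hR : ∀ R : ℝ, massAtInfinity (fun n => interactionDensity β μ (f n)) ^ t ≤
      C ^ t * (limsup (fun n => ∫⁻ x in {x : RN N | R ≤ ‖x‖}, f n x ^ t) atTop * L) := by
    intro R
    set S : Set (RN N) := {x | R ≤ ‖x‖} with hS
    have hSm : MeasurableSet S := measurableSet_le measurable_const measurable_norm
    have hlt : limsup (fun n => ∫⁻ x in S, f n x ^ t) atTop ≠ ⊤ :=
      ne_top_of_le_ne_top h.hM (limsup_le_of_le (by isBoundedDefault) (Eventually.of_forall
        fun n => (setLIntegral_le_lintegral _ _).trans (h.hfM n)))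
    -- Only one factor is restricted to the exterior. The other keeps its full mass, hence the
    -- product of exterior and total mass in the conclusion.
    have hn : ∀ n, (∫⁻ x in S, interactionDensity β μ (f n) x) ^ t ≤
        C ^ t * ((∫⁻ x in S, f n x ^ t) * ∫⁻ x, f n x ^ t) := by
      intro n
      have hfn := ne_top_of_le_ne_top h.hM (h.hfM n)
      have e := lintegral_indicator_rpow ht0 (f n) hSm
      rw [setLIntegral_interactionDensity _ _ _ hSm]
      have hb := steinWeissForm_le h.hβ h.hμ h.hβμ h.ht ((h.hf n).indicator hSm) (h.hf n)
        (by rw [e]; exact ne_top_of_le_ne_top hfn (setLIntegral_le_lintegral _ _)) hfn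
      rw [e] at hb
      refine (ENNReal.rpow_le_rpow hb ht0.le).trans_eq ?_
      rw [ENNReal.mul_rpow_of_nonneg _ _ ht0.le, ENNReal.mul_rpow_of_nonneg _ _ ht0.le,
        ← ENNReal.rpow_mul, ← ENNReal.rpow_mul, one_div_mul_cancel ht0.ne', ENNReal.rpow_one,
        ENNReal.rpow_one, mul_assoc]
    calc massAtInfinity (fun n => interactionDensity β μ (f n)) ^ t
        ≤ (limsup (fun n => ∫⁻ x in S, interactionDensity β μ (f n) x) atTop) ^ t :=
          ENNReal.rpow_le_rpow (iInf_le _ R) ht0.le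
      _ = limsup (fun n => (∫⁻ x in S, interactionDensity β μ (f n) x) ^ t) atTop :=
          Monotone.map_limsup_of_continuousAt (F := atTop) (ENNReal.monotone_rpow_of_nonneg ht0.le)
            (fun n => ∫⁻ x in S, interactionDensity β μ (f n) x)
            ENNReal.continuous_rpow_const.continuousAt
      _ ≤ limsup (fun n => C ^ t * ((∫⁻ x in S, f n x ^ t) * ∫⁻ x, f n x ^ t)) atTop :=
          limsup_le_limsup (Eventually.of_forall hn)
      _ = C ^ t * limsup (fun n => (∫⁻ x in S, f n x ^ t) * ∫⁻ x, f n x ^ t) atTop :=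
          ENNReal.limsup_const_mul_of_ne_top (ENNReal.rpow_ne_top_of_nonneg ht0.le hCt)
      _ ≤ _ := by
          refine mul_le_mul' le_rfl ?_
          rw [← hlimsup]
          refine ENNReal.limsup_mul_le' (Or.inr ?_) (Or.inl hlt)
          rw [hlimsup]
          exact hLt
  have hlim : Tendsto (fun R : ℝ => C ^ t *
      (limsup (fun n => ∫⁻ x in {x : RN N | R ≤ ‖x‖}, f n x ^ t) atTop * L)) atTop
      (𝓝 (C ^ t * (massAtInfinity (fun n x => f n x ^ t) * L))) :=
    ENNReal.Tendsto.const_mul (ENNReal.Tendsto.mul_const (tendsto_massAtInfinity _) (Or.inr hLt))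
      (Or.inr (ENNReal.rpow_ne_top_of_nonneg ht0.le hCt))
  exact ge_of_tendsto' hlim hR

end InteractionSeq

end

noncomputable section

variable {N : ℕ}

/-! ### Concentration of the gradients -/

theorem tendsto_measure_closedBall_singleton (m : Measure (RN N)) [IsFiniteMeasure m] (z : RN N)
    {c : ℝ} (hc : 0 < c) :
    Tendsto (fun ε => m (Metric.closedBall z (c * ε))) (𝓝[>] 0) (𝓝 (m {z})) := by
  have h := tendsto_measure_cthickening_of_isClosed (μ := m) (s := {z})
    ⟨1, one_pos, measure_ne_top _ _⟩ isClosed_singleton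
  have h2 : Tendsto (fun ε : ℝ => c * ε) (𝓝[>] 0) (𝓝 0) := by
    have : Tendsto (fun ε : ℝ => c * ε) (𝓝 0) (𝓝 (c * 0)) := (continuous_const_mul c).tendsto 0
    rw [mul_zero] at this
    exact this.mono_left nhdsWithin_le_nhds
  refine (h.comp h2).congr' ?_
  filter_upwards [self_mem_nhdsWithin] with ε hε
  have : 0 ≤ c * ε := (mul_pos hc hε).le
  simp only [Function.comp_apply, Metric.cthickening_singleton z this]

theorem holderConjugate_sobolevExp {p : ℝ} (hp : 2 ≤ p) (hpN : p < N) :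
    (sobolevExp N p / p).HolderConjugate ((N : ℝ) / p) := by
  have hps := lt_sobolevExp hp hpN
  have hp0 : 0 < p := by linarith
  have hN : (0 : ℝ) < N := by linarith
  rw [Real.holderConjugate_iff]
  refine ⟨by rwa [one_lt_div hp0], ?_⟩
  unfold sobolevExp
  have : (N : ℝ) - p ≠ 0 := by linarith
  field_simp
  ring

/-- This takes the place of Rellich's theorem: `|u_n - w|^p` is bounded in `L^{p^*/p}` and tends to
zero almost everywhere, while `‖∇η‖^p` lies in the dual space `L^{N/p}`. -/
theorem tendsto_lintegral_sub_smul_gradient {p : ℝ} (hp : 2 ≤ p) (hpN : p < N) {u : ℕ → D1p N p}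
    {w : D1p N p} (hbdd : ∃ M : ℝ, ∀ n, D1p.gradNorm (u n) ≤ M)
    (hae : ∀ᵐ x : RN N, Tendsto (fun n => D1p.fn (u n) x) atTop (𝓝 (D1p.fn w x)))
    {η : RN N → ℝ} (hη : ContDiff ℝ (⊤ : ℕ∞) η) (hηN : ∫⁻ x, ‖gradient η x‖ₑ ^ (N : ℝ) < ⊤) :
    Tendsto (fun n => ∫⁻ x, ‖(D1p.fn (u n) x - D1p.fn w x) • gradient η x‖ₑ ^ p) atTop (𝓝 0) := by
  obtain ⟨M, hM⟩ := hbdd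
  have hp0 : 0 < p := by linarith
  have : Fact (1 ≤ ENNReal.ofReal p) := ⟨ENNReal.one_le_ofReal.2 (by linarith)⟩
  obtain ⟨K, hK, hKb⟩ := D1p.exists_lintegral_sobolevDensity_le (N := N) hp hpN
    (M + D1p.gradNorm w)
  have hgm := (continuous_gradient_of_contDiff hη).measurable
  have h := tendsto_lintegral_mul_of_ae_tendsto_zero (holderConjugate_sobolevExp hp hpN)
    (g := fun n x => ‖D1p.fn (u n) x - D1p.fn w x‖ₑ ^ p) (h := fun x => ‖gradient η x‖ₑ ^ p)
    (fun n => by fun_prop) (by fun_prop) ?_ hK.ne (fun n => ?_) ?_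
  · refine h.congr fun n => lintegral_congr fun x => ?_
    rw [enorm_smul, ENNReal.mul_rpow_of_nonneg _ _ hp0.le]
  · filter_upwards [hae] with x hx
    have h1 : Tendsto (fun n => ‖D1p.fn (u n) x - D1p.fn w x‖ₑ ^ p) atTop
        (𝓝 (‖D1p.fn w x - D1p.fn w x‖ₑ ^ p)) :=
      (ENNReal.continuous_rpow_const.tendsto _).comp (hx.sub_const _).enorm
    rwa [sub_self, enorm_zero, ENNReal.zero_rpow_of_pos hp0] at h1
  · have hfn : D1p.fn (u n - w) =ᵐ[volume] D1p.fn (u n) - D1p.fn w :=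
      Lp.coeFn_sub (u n).1.1 w.1.1
    refine le_trans (le_of_eq (lintegral_congr_ae (hfn.mono fun x hx => ?_)))
      (hKb (u n - w) ((norm_sub_le (u n).1.2 w.1.2).trans (add_le_add (hM n) le_rfl)))
    simp only [sobolevDensity]
    rw [hx, Pi.sub_apply, ← ENNReal.rpow_mul, mul_div_cancel₀ _ hp0.ne']
  · simpa only [← ENNReal.rpow_mul, mul_div_cancel₀ _ hp0.ne'] using hηN

/-- The cost of cutting off `u_n` is, in the limit, at most that of cutting off `w`: split `u_n ∇η`
into `(u_n - w) ∇η` and `w ∇η`. -/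
theorem exists_cutoff_seq {p : ℝ} (hp : 2 ≤ p) (hpN : p < N) {u : ℕ → D1p N p}
    {w : D1p N p} (hbdd : ∃ M : ℝ, ∀ n, D1p.gradNorm (u n) ≤ M)
    (hae : ∀ᵐ x : RN N, Tendsto (fun n => D1p.fn (u n) x) atTop (𝓝 (D1p.fn w x)))
    {η : RN N → ℝ} (hη : ContDiff ℝ (⊤ : ℕ∞) η) (hc : HasCompactSupport (gradient η))
    (h01 : ∀ x, 0 ≤ η x ∧ η x ≤ 1) (hηN : ∫⁻ x, ‖gradient η x‖ₑ ^ (N : ℝ) < ⊤) :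
    ∃ (v : ℕ → D1p N p) (T : ℕ → ℝ≥0∞),
      (∀ n, D1p.fn (v n) =ᵐ[volume] fun x => η x * D1p.fn (u n) x) ∧
      Tendsto T atTop (𝓝 ((∫⁻ x, ‖D1p.fn w x • gradient η x‖ₑ ^ p) ^ (1 / p))) ∧
      ∀ n, (∫⁻ x, gradDensity (v n) x) ≤
        ((∫⁻ x, ENNReal.ofReal (η x) * gradDensity (u n) x) ^ (1 / p) + T n) ^ p := by
  have hp0 : 0 < p := by linarith
  have hgm := (continuous_gradient_of_contDiff hη).measurable
  choose v hv1 hv2 using fun n => D1p.exists_mul_grad_le hp hpN (u n) hη hc h01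
  have hlim := tendsto_lintegral_sub_smul_gradient hp hpN hbdd hae hη hηN
  refine ⟨v, fun n => (∫⁻ x, ‖(D1p.fn (u n) x - D1p.fn w x) • gradient η x‖ₑ ^ p) ^ (1 / p) +
    (∫⁻ x, ‖D1p.fn w x • gradient η x‖ₑ ^ p) ^ (1 / p), hv1, ?_, fun n => ?_⟩
  · have h1 : Tendsto (fun n =>
        (∫⁻ x, ‖(D1p.fn (u n) x - D1p.fn w x) • gradient η x‖ₑ ^ p) ^ (1 / p)) atTop
        (𝓝 ((0 : ℝ≥0∞) ^ (1 / p))) := (ENNReal.continuous_rpow_const.tendsto _).comp hlim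
    rw [ENNReal.zero_rpow_of_pos (by positivity)] at h1
    simpa using h1.add_const ((∫⁻ x, ‖D1p.fn w x • gradient η x‖ₑ ^ p) ^ (1 / p))
  · rw [← ENNReal.rpow_inv_le_iff hp0, ← one_div]
    refine (hv2 n).trans (add_le_add le_rfl ?_)
    refine le_trans (ENNReal.rpow_le_rpow (lintegral_mono fun x => ?_) (by positivity))
      (ENNReal.lintegral_Lp_add_le (μ := volume)
        (f := fun x => ‖(D1p.fn (u n) x - D1p.fn w x) • gradient η x‖ₑ)
        (g := fun x => ‖D1p.fn w x • gradient η x‖ₑ) (by fun_prop) (by fun_prop) (by linarith))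
    refine ENNReal.rpow_le_rpow ?_ hp0.le
    refine le_trans (le_of_eq ?_) (enorm_add_le _ _)
    rw [← add_smul, sub_add_cancel]

/-- The interaction energy of an atom is controlled by the gradient energy of the atom. -/
theorem steinWeissSobolevConst_mul_atom_le {p β μ t : ℝ} (hp : 2 ≤ p) (hpN : p < N)
    {u : ℕ → D1p N p} {w : D1p N p} (hbdd : ∃ M : ℝ, ∀ n, D1p.gradNorm (u n) ≤ M)
    (hae : ∀ᵐ x : RN N, Tendsto (fun n => D1p.fn (u n) x) atTop (𝓝 (D1p.fn w x)))
    {M : ℝ≥0∞} (hI : InteractionSeq β μ t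
      (fun n x => ‖D1p.fn (u n) x‖ₑ ^ steinWeissExp N p β μ)
      (fun x => ‖D1p.fn w x‖ₑ ^ steinWeissExp N p β μ) M)
    {ν ζ : Measure (RN N)} [IsFiniteMeasure ν] [IsFiniteMeasure ζ]
    (hν : TendstoMeasure (fun n => gradDensity (u n)) ν)
    (hζ : TendstoMeasure (fun n => steinWeissDensity β μ (u n)) ζ) (z : RN N) :
    steinWeissSobolevConst N p β μ * ζ {z} ^ (p / (2 * steinWeissExp N p β μ)) ≤ ν {z} := by
  have hp0 : 0 < p := by linarith
  have hps := sobolevExp_pos hp hpN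
  have hr := steinWeissExp_pos (β := β) (μ := μ) hI.hβμ hp hpN
  have hN : 0 < N := by
    have : (0 : ℝ) < N := by linarith
    exact_mod_cast this
  have hNe : Nonempty (Fin N) := ⟨⟨0, hN⟩⟩
  obtain ⟨K, hK, hcut⟩ := exists_smooth_cutoffs hN
  set S := steinWeissSobolevConst N p β μ with hS
  have hS0 : S ≠ 0 := (steinWeissSobolevConst_pos hI.hβ hI.hμ hI.hβμ hp hpN).ne'
  set r := steinWeissExp N p β μ with hrd
  set q : ℝ := p / (2 * r) with hq
  have hq0 : 0 < q := by positivity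
  set f : ℕ → RN N → ℝ≥0∞ := fun n x => ‖D1p.fn (u n) x‖ₑ ^ r with hf
  set f' : RN N → ℝ≥0∞ := fun x => ‖D1p.fn w x‖ₑ ^ r with hf'
  have hfin := isFiniteMeasure_withDensity (D1p.lintegral_sobolevDensity_ne_top hp hpN w)
  have hfin2 := isFiniteMeasure_withDensity hI.lintegral_density_limit_ne_top
  set σ := volume.withDensity (sobolevDensity w) with hσ
  set F := volume.withDensity (interactionDensity β μ f') with hF
  -- The estimate at scale `ε`. As `ε → 0` the balls shrink to `{z}`, where `σ` and `F` have no
  -- mass, so only `ν {z}` remains. The form `1 * ε` matches `tendsto_measure_closedBall_singleton`.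
  have hstep : ∀ ε : ℝ, 0 < ε → ζ {z} ≤
      (((ν (Metric.closedBall z (2 * ε))) ^ (1 / p) +
        (σ (Metric.closedBall z (2 * ε)) ^ (p / sobolevExp N p) * K ^ (p / N)) ^ (1 / p)) ^ p / S)
          ^ q⁻¹ + F (Metric.closedBall z (1 * ε)) := by
    intro ε hε
    obtain ⟨η, hηs, hηc, h01, h1, h0, hg1, hg2, hηK⟩ := hcut z ε hε
    obtain ⟨v, T, hv1, hT, hv2⟩ := exists_cutoff_seq hp hpN hbdd hae hηs
      (hasCompactSupport_gradient hηc) h01 (hηK.trans_lt hK)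
    set V := Metric.ball z ε with hV
    have hVm : MeasurableSet V := measurableSet_ball
    have hsupp : tsupport η ⊆ Metric.closedBall z (2 * ε) := by
      refine closure_minimal (fun x hx => ?_) Metric.isClosed_closedBall
      by_contra hx2
      exact hx (h0 x (not_le.1 fun h => hx2 (Metric.mem_closedBall.2 h)).le)
    set X : ℕ → ℝ≥0∞ := fun n =>
      ((∫⁻ x, ENNReal.ofReal (η x) * gradDensity (u n) x) ^ (1 / p) + T n) ^ p with hX
    have hform : ∀ n, steinWeissForm β μ (V.indicator (f n)) (V.indicator (f n)) ≤
        (X n / S) ^ q⁻¹ := by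
      intro n
      have hfv : (fun x => ‖D1p.fn (v n) x‖ₑ ^ r) =ᵐ[volume]
          fun x => ‖η x * D1p.fn (u n) x‖ₑ ^ r := (hv1 n).mono fun x hx => by simp only [hx]
      have hle : ∀ x, V.indicator (f n) x ≤ ‖η x * D1p.fn (u n) x‖ₑ ^ r := by
        intro x
        by_cases hx : x ∈ V
        · rw [Set.indicator_of_mem hx, h1 x (Metric.mem_ball.1 hx).le, one_mul]
        · rw [Set.indicator_of_notMem hx]
          exact zero_le
      have hD : steinWeissForm β μ (V.indicator (f n)) (V.indicator (f n)) ≤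
          ∫⁻ x, steinWeissDensity β μ (v n) x := by
        rw [D1p.lintegral_steinWeissDensity_eq, steinWeissForm_congr_ae hfv hfv]
        exact steinWeissForm_mono hle hle
      refine hD.trans (le_trans ?_ (ENNReal.rpow_le_rpow (ENNReal.div_le_div_right (hv2 n) S)
        (by positivity)))
      rw [ENNReal.le_rpow_inv_iff hq0, ENNReal.le_div_iff_mul_le (Or.inl hS0)
        (Or.inr (D1p.lintegral_gradDensity_ne_top hp (v n))), mul_comm]
      exact steinWeissSobolevConst_mul_le (β := β) (μ := μ) hI.hβμ hp hpN (v n)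
    have hXlim : Tendsto X atTop (𝓝 (((∫⁻ x, ENNReal.ofReal (η x) ∂ν) ^ (1 / p) +
        (∫⁻ x, ‖D1p.fn w x • gradient η x‖ₑ ^ p) ^ (1 / p)) ^ p)) := by
      have hl := hν.tendsto_lintegral (fun n => by fun_prop)
        (fun n => D1p.lintegral_gradDensity_ne_top hp (u n)) hηs.continuous hηc h01
      exact (ENNReal.continuous_rpow_const.tendsto _).comp
        (((ENNReal.continuous_rpow_const.tendsto _).comp hl).add hT)
    have hYlim := (ENNReal.continuous_rpow_const (y := q⁻¹).tendsto _).comp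
      (ENNReal.Tendsto.div_const hXlim (Or.inr hS0))
    refine (hI.measure_singleton_le hζ Metric.isOpen_ball (Metric.mem_ball_self hε)).trans
      (add_le_add ?_ ?_)
    · refine (limsup_le_limsup (Eventually.of_forall hform)).trans (hYlim.limsup_eq.le.trans ?_)
      refine ENNReal.rpow_le_rpow (ENNReal.div_le_div_right (ENNReal.rpow_le_rpow (add_le_add
        (ENNReal.rpow_le_rpow (lintegral_cutoff_le_measure ν measurableSet_closedBall hsupp h01)
          (by positivity)) (ENNReal.rpow_le_rpow ?_ (by positivity))) hp0.le) _) (by positivity)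
      rw [hσ, withDensity_apply _ measurableSet_closedBall]
      exact (lintegral_smul_gradient_le hp hpN (D1p.measurable_fn w) hηs
        measurableSet_closedBall fun x hx => hg2 x (not_le.1 fun h =>
          hx (Metric.mem_closedBall.2 h))).trans
        (mul_le_mul' le_rfl (ENNReal.rpow_le_rpow hηK (by positivity)))
    · rw [← setLIntegral_interactionDensity _ _ _ hVm, ← withDensity_apply _ hVm, one_mul]
      exact measure_mono Metric.ball_subset_closedBall
  have hσ0 : σ {z} = 0 := withDensity_absolutelyContinuous _ _ (measure_singleton z)
  have hF0 : F {z} = 0 := withDensity_absolutelyContinuous _ _ (measure_singleton z)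
  have hlim : Tendsto (fun ε : ℝ => (((ν (Metric.closedBall z (2 * ε))) ^ (1 / p) +
        (σ (Metric.closedBall z (2 * ε)) ^ (p / sobolevExp N p) * K ^ (p / N)) ^ (1 / p)) ^ p / S)
          ^ q⁻¹ + F (Metric.closedBall z (1 * ε))) (𝓝[>] 0)
      (𝓝 (((ν {z} ^ (1 / p) + (σ {z} ^ (p / sobolevExp N p) * K ^ (p / N)) ^ (1 / p)) ^ p / S)
          ^ q⁻¹ + F {z})) := by
    refine Tendsto.add ?_ (tendsto_measure_closedBall_singleton F z one_pos)
    refine (ENNReal.continuous_rpow_const.tendsto _).comp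
      (ENNReal.Tendsto.div_const ?_ (Or.inr hS0))
    refine (ENNReal.continuous_rpow_const.tendsto _).comp (Tendsto.add
      ((ENNReal.continuous_rpow_const.tendsto _).comp
        (tendsto_measure_closedBall_singleton ν z two_pos)) ?_)
    exact (ENNReal.continuous_rpow_const.tendsto _).comp (ENNReal.Tendsto.mul_const
      ((ENNReal.continuous_rpow_const.tendsto _).comp
        (tendsto_measure_closedBall_singleton σ z two_pos))
      (Or.inr (ENNReal.rpow_ne_top_of_nonneg (by positivity) hK.ne)))
  have hfinal : ζ {z} ≤ _ := ge_of_tendsto hlim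
    (by filter_upwards [self_mem_nhdsWithin] with ε hε using hstep ε hε)
  rw [hσ0, hF0, ENNReal.zero_rpow_of_pos (by positivity), zero_mul,
    ENNReal.zero_rpow_of_pos (by positivity), add_zero, add_zero, ← ENNReal.rpow_mul,
    one_div_mul_cancel hp0.ne', ENNReal.rpow_one, ENNReal.le_rpow_inv_iff hq0] at hfinal
  rw [mul_comm]
  exact ENNReal.mul_le_of_le_div hfinal

/-! ### The Sobolev inequality in the limit and at infinity -/

theorem sobolevConst_pos {p : ℝ} (hp : 2 ≤ p) (hpN : p < N) : 0 < sobolevConst N p := by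
  obtain ⟨K, hK, hS⟩ := D1p.exists_eLpNorm_fn_le (N := N) hp hpN
  have hp0 : 0 < p := by linarith
  have hinv : 0 < (K ^ p)⁻¹ := ENNReal.inv_pos.2 (ENNReal.rpow_ne_top_of_nonneg hp0.le hK.ne)
  refine hinv.trans_le (le_iInf₂ fun w hw => ?_)
  have h := hS w
  rw [← D1p.eLpNorm_fn_eq hp hpN, hw] at h
  have h2 := ENNReal.rpow_le_rpow h hp0.le
  rw [ENNReal.one_rpow, ENNReal.mul_rpow_of_nonneg _ _ hp0.le, ← ENNReal.rpow_mul,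
    one_div_mul_cancel hp0.ne', ENNReal.rpow_one] at h2
  rw [← one_div]
  exact ENNReal.div_le_of_le_mul' h2

theorem lintegral_sobolevDensity_le_div {p : ℝ} (hp : 2 ≤ p) (hpN : p < N) (w : D1p N p) :
    ∫⁻ x, sobolevDensity w x ≤
      ((∫⁻ x, gradDensity w x) / sobolevConst N p) ^ (p / sobolevExp N p)⁻¹ := by
  have hps := sobolevExp_pos hp hpN
  have hp0 : 0 < p := by linarith
  rw [ENNReal.le_rpow_inv_iff (by positivity), ENNReal.le_div_iff_mul_le
    (Or.inl (sobolevConst_pos hp hpN).ne') (Or.inr (D1p.lintegral_gradDensity_ne_top hp w)), mul_comm]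
  exact sobolevConst_mul_le hp hpN w

theorem limsup_rpow_comp {a : ℕ → ℝ≥0∞} {s : ℝ} (hs : 0 ≤ s) :
    limsup (fun n => a n ^ s) atTop = limsup a atTop ^ s :=
  (Monotone.map_limsup_of_continuousAt (F := atTop) (ENNReal.monotone_rpow_of_nonneg hs) a
    ENNReal.continuous_rpow_const.continuousAt).symm

theorem limsup_div_const {a : ℕ → ℝ≥0∞} {S : ℝ≥0∞} (hS : S ≠ 0) :
    limsup (fun n => a n / S) atTop = limsup a atTop / S := by
  simp only [div_eq_mul_inv, mul_comm _ S⁻¹]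
  exact ENNReal.limsup_const_mul_of_ne_top (ENNReal.inv_ne_top.2 hS)

theorem mul_rpow_le_of_le_div_rpow {a b S : ℝ≥0∞} {q : ℝ} (hq : 0 < q)
    (h : a ≤ (b / S) ^ q⁻¹) : S * a ^ q ≤ b := by
  rw [ENNReal.le_rpow_inv_iff hq] at h
  rw [mul_comm]
  exact ENNReal.mul_le_of_le_div h

theorem sobolevConst_mul_limsup_le {p : ℝ} (hp : 2 ≤ p) (hpN : p < N) (u : ℕ → D1p N p) :
    sobolevConst N p * (limsup (fun n => ∫⁻ x, sobolevDensity (u n) x) atTop) ^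
      (p / sobolevExp N p) ≤ limsup (fun n => ∫⁻ x, gradDensity (u n) x) atTop := by
  have hps := sobolevExp_pos hp hpN
  have hp0 : 0 < p := by linarith
  refine mul_rpow_le_of_le_div_rpow (by positivity) ?_
  rw [← limsup_div_const (sobolevConst_pos hp hpN).ne', ← limsup_rpow_comp (by positivity)]
  exact limsup_le_limsup (Eventually.of_forall fun n =>
    lintegral_sobolevDensity_le_div hp hpN (u n))

theorem gradient_one_sub (η : RN N → ℝ) (x : RN N) :
    gradient (fun x => 1 - η x) x = -gradient η x := by
  unfold gradient
  rw [fderiv_const_sub, map_neg]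

/-- The Sobolev inequality at infinity. -/
theorem sobolevConst_mul_massAtInfinity_le {p : ℝ} (hp : 2 ≤ p) (hpN : p < N)
    {u : ℕ → D1p N p} {w : D1p N p} (hbdd : ∃ M : ℝ, ∀ n, D1p.gradNorm (u n) ≤ M)
    (hae : ∀ᵐ x : RN N, Tendsto (fun n => D1p.fn (u n) x) atTop (𝓝 (D1p.fn w x))) :
    sobolevConst N p * massAtInfinity (fun n => sobolevDensity (u n)) ^ (p / sobolevExp N p) ≤
      massAtInfinity (fun n => gradDensity (u n)) := by
  have hp0 : 0 < p := by linarith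
  have hps := sobolevExp_pos hp hpN
  have hN : 0 < N := by
    have : (0 : ℝ) < N := by linarith
    exact_mod_cast this
  obtain ⟨K, hK, hcut⟩ := exists_smooth_cutoffs hN
  have hS0 : sobolevConst N p ≠ 0 := (sobolevConst_pos hp hpN).ne'
  set S := sobolevConst N p with hS
  set q : ℝ := p / sobolevExp N p with hq
  have hq0 : 0 < q := by positivity
  set G : ℝ → ℝ≥0∞ := fun R => limsup (fun n => ∫⁻ x in {x : RN N | R ≤ ‖x‖}, gradDensity (u n) x)
    atTop with hG
  set B : ℕ → ℝ≥0∞ := fun k => ∫⁻ x in {x : RN N | (k : ℝ) ≤ ‖x‖}, sobolevDensity w x with hB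
  -- The cutoff `1 - η` vanishes for `‖x‖ ≤ k` and equals one for `‖x‖ ≥ 2k`, so the Sobolev mass
  -- beyond `2k` is paid for by the gradient beyond `k` and a tail of `|w|^{p^*}`.
  have hstep : ∀ k : ℕ, 1 ≤ k → massAtInfinity (fun n => sobolevDensity (u n)) ≤
      ((G k ^ (1 / p) + (B k ^ q * K ^ (p / N)) ^ (1 / p)) ^ p / S) ^ q⁻¹ := by
    intro k hk
    have hk0 : (0 : ℝ) < k := by exact_mod_cast hk
    obtain ⟨η, hηs, hηc, h01, h1, h0, hg1, hg2, hηK⟩ := hcut 0 k hk0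
    have hgr : gradient (fun x => 1 - η x) = fun x => -gradient η x :=
      funext (gradient_one_sub η)
    have hχs : ContDiff ℝ (⊤ : ℕ∞) fun x => 1 - η x := contDiff_const.sub hηs
    have hχc : HasCompactSupport (gradient fun x => 1 - η x) := by
      rw [hgr]
      exact (hasCompactSupport_gradient hηc).comp_left (g := fun y : RN N => -y) neg_zero
    have hχK : ∫⁻ x, ‖gradient (fun x => 1 - η x) x‖ₑ ^ (N : ℝ) ≤ K := by
      simpa only [hgr, enorm_neg] using hηK
    obtain ⟨v, T, hv1, hT, hv2⟩ := exists_cutoff_seq hp hpN hbdd hae hχs hχc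
      (fun x => ⟨by linarith [(h01 x).2], by linarith [(h01 x).1]⟩) (hχK.trans_lt hK)
    have hkS : MeasurableSet {x : RN N | (k : ℝ) ≤ ‖x‖} :=
      measurableSet_le measurable_const measurable_norm
    have h2kS : MeasurableSet {x : RN N | (2 * k : ℝ) ≤ ‖x‖} :=
      measurableSet_le measurable_const measurable_norm
    have hgrad : ∀ n, ∫⁻ x, gradDensity (v n) x ≤
        ((∫⁻ x in {x : RN N | (k : ℝ) ≤ ‖x‖}, gradDensity (u n) x) ^ (1 / p) + T n) ^ p := by
      intro n
      refine (hv2 n).trans (ENNReal.rpow_le_rpow (add_le_add (ENNReal.rpow_le_rpow ?_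
        (by positivity)) le_rfl) hp0.le)
      rw [← lintegral_indicator hkS]
      refine lintegral_mono fun x => ?_
      by_cases hx : x ∈ {x : RN N | (k : ℝ) ≤ ‖x‖}
      · rw [Set.indicator_of_mem hx]
        exact mul_le_of_le_one_left' (ENNReal.ofReal_le_one.2 (by linarith [(h01 x).1]))
      · rw [h1 x (by rw [dist_zero_right]; exact (not_le.1 hx).le), sub_self, ENNReal.ofReal_zero,
          zero_mul]
        exact zero_le
    have hsob : ∀ n, ∫⁻ x in {x : RN N | (2 * k : ℝ) ≤ ‖x‖}, sobolevDensity (u n) x ≤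
        ∫⁻ x, sobolevDensity (v n) x := by
      intro n
      rw [← lintegral_indicator h2kS]
      refine lintegral_mono_ae ((hv1 n).mono fun x hx => ?_)
      by_cases hx2 : x ∈ {x : RN N | (2 * k : ℝ) ≤ ‖x‖}
      · rw [Set.indicator_of_mem hx2]
        simp only [sobolevDensity]
        rw [hx]
        dsimp only
        rw [h0 x (by rw [dist_zero_right]; exact hx2), sub_zero, one_mul]
      · rw [Set.indicator_of_notMem hx2]
        exact zero_le
    have hTfin : (∫⁻ x, ‖D1p.fn w x • gradient (fun x => 1 - η x) x‖ₑ ^ p) ≤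
        B k ^ q * K ^ (p / N) :=
      (lintegral_smul_gradient_le hp hpN (D1p.measurable_fn w) hχs hkS fun x hx => by
        rw [hgr]
        dsimp only
        rw [hg1 x (by rw [dist_zero_right]; exact not_le.1 hx), neg_zero]).trans
        (mul_le_mul' le_rfl (ENNReal.rpow_le_rpow hχK (by positivity)))
    have hBt : B k ≠ ⊤ := ne_top_of_le_ne_top (D1p.lintegral_sobolevDensity_ne_top hp hpN w)
      (setLIntegral_le_lintegral _ _)
    have hTt : (∫⁻ x, ‖D1p.fn w x • gradient (fun x => 1 - η x) x‖ₑ ^ p) ^ (1 / p) ≠ ⊤ :=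
      ENNReal.rpow_ne_top_of_nonneg (by positivity) (ne_top_of_le_ne_top (ENNReal.mul_ne_top
        (ENNReal.rpow_ne_top_of_nonneg hq0.le hBt)
        (ENNReal.rpow_ne_top_of_nonneg (by positivity) hK.ne)) hTfin)
    calc massAtInfinity (fun n => sobolevDensity (u n))
        ≤ limsup (fun n => ∫⁻ x in {x : RN N | (2 * k : ℝ) ≤ ‖x‖}, sobolevDensity (u n) x) atTop :=
          iInf_le _ _
      _ ≤ limsup (fun n => ((((∫⁻ x in {x : RN N | (k : ℝ) ≤ ‖x‖}, gradDensity (u n) x) ^ (1 / p)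
            + T n) ^ p) / S) ^ q⁻¹) atTop :=
          limsup_le_limsup (Eventually.of_forall fun n => (hsob n).trans
            ((lintegral_sobolevDensity_le_div hp hpN (v n)).trans
              (ENNReal.rpow_le_rpow (ENNReal.div_le_div_right (hgrad n) _) (by positivity))))
      _ = ((limsup (fun n => (∫⁻ x in {x : RN N | (k : ℝ) ≤ ‖x‖}, gradDensity (u n) x) ^ (1 / p)
            + T n) atTop) ^ p / S) ^ q⁻¹ := by
          rw [limsup_rpow_comp (by positivity), limsup_div_const hS0, limsup_rpow_comp hp0.le]
      _ ≤ _ := by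
          refine ENNReal.rpow_le_rpow (ENNReal.div_le_div_right (ENNReal.rpow_le_rpow ?_ hp0.le) _)
            (by positivity)
          refine (limsup_add_le_of_tendsto hTt hT).trans (add_le_add ?_
            (ENNReal.rpow_le_rpow hTfin (by positivity)))
          rw [limsup_rpow_comp (by positivity)]
  have hGlim : Tendsto (fun k : ℕ => G k) atTop
      (𝓝 (massAtInfinity fun n => gradDensity (u n))) :=
    (tendsto_massAtInfinity _).comp tendsto_natCast_atTop_atTop
  have hlim : Tendsto (fun k : ℕ =>
      ((G k ^ (1 / p) + (B k ^ q * K ^ (p / N)) ^ (1 / p)) ^ p / S) ^ q⁻¹) atTop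
      (𝓝 ((((massAtInfinity fun n => gradDensity (u n)) ^ (1 / p) +
        ((0 : ℝ≥0∞) ^ q * K ^ (p / N)) ^ (1 / p)) ^ p / S) ^ q⁻¹)) := by
    refine (ENNReal.continuous_rpow_const.tendsto _).comp
      (ENNReal.Tendsto.div_const ?_ (Or.inr hS0))
    refine (ENNReal.continuous_rpow_const.tendsto _).comp (Tendsto.add
      ((ENNReal.continuous_rpow_const.tendsto _).comp hGlim) ?_)
    exact (ENNReal.continuous_rpow_const.tendsto _).comp (ENNReal.Tendsto.mul_const
      ((ENNReal.continuous_rpow_const.tendsto _).comp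
        (tendsto_lintegral_tail (D1p.lintegral_sobolevDensity_ne_top hp hpN w)))
      (Or.inr (ENNReal.rpow_ne_top_of_nonneg (by positivity) hK.ne)))
  have hfinal : massAtInfinity (fun n => sobolevDensity (u n)) ≤ _ := ge_of_tendsto hlim
    (by filter_upwards [eventually_ge_atTop 1] with k hk using hstep k hk)
  rw [ENNReal.zero_rpow_of_pos hq0, zero_mul, ENNReal.zero_rpow_of_pos (by positivity), add_zero,
    ← ENNReal.rpow_mul, one_div_mul_cancel hp0.ne', ENNReal.rpow_one] at hfinal
  exact mul_rpow_le_of_le_div_rpow hq0 hfinal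

end

noncomputable section

variable {N : ℕ}

/-! ### Lower semicontinuity of the gradient energy -/

/-- The tangent inequality of the convex function `‖·‖^p` at `a`, obtained from Cauchy–Schwarz and
Young. -/
theorem young_inner {p : ℝ} (hp : 2 ≤ p) (a b : RN N) :
    p * (‖a‖ ^ (p - 2) * inner ℝ a b) ≤ (p - 1) * ‖a‖ ^ p + ‖b‖ ^ p := by
  have hp0 : 0 < p := by linarith
  have hconj := Real.HolderConjugate.conjExponent (show 1 < p by linarith)
  have h1 := Real.young_inequality_of_nonneg (norm_nonneg b)
    (Real.rpow_nonneg (norm_nonneg a) (p - 1)) hconj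
  have hc : p.conjExponent = p / (p - 1) := rfl
  have hp1 : p - 1 ≠ 0 := by linarith
  rw [← Real.rpow_mul (norm_nonneg a), hc, mul_div_cancel₀ _ hp1] at h1
  have h2 : ‖a‖ ^ (p - 2) * inner ℝ a b ≤ ‖b‖ * ‖a‖ ^ (p - 1) := by
    rcases eq_or_ne a 0 with rfl | ha
    · simp only [inner_zero_left, mul_zero]
      positivity
    · calc ‖a‖ ^ (p - 2) * inner ℝ a b ≤ ‖a‖ ^ (p - 2) * (‖a‖ * ‖b‖) := by
            gcongr
            exact real_inner_le_norm a b
        _ = _ := by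
            have : p - 1 = p - 2 + 1 := by ring
            rw [this, Real.rpow_add_one (norm_ne_zero_iff.2 ha)]
            ring
  calc p * (‖a‖ ^ (p - 2) * inner ℝ a b) ≤
      p * (‖b‖ ^ p / p + ‖a‖ ^ p / (p / (p - 1))) :=
        mul_le_mul_of_nonneg_left (h2.trans h1) hp0.le
    _ = _ := by
        field_simp
        ring

/-- Weak lower semicontinuity, localised. Multiply the tangent inequality at `∇w` by `φ`, evaluate
it at `∇u_n` and integrate: the linear term is a bounded functional of `u_n`, hence converges. In
the limit, `p ∫ φ ‖∇w‖^p ≤ (p - 1) ∫ φ ‖∇w‖^p + ∫ φ dν`. -/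
theorem withDensity_gradDensity_le {p : ℝ} (hp : 2 ≤ p) {u : ℕ → D1p N p} {w : D1p N p}
    (hweak : D1p.WeakTendsto u w) {ν : Measure (RN N)} [IsFiniteMeasure ν]
    (hν : TendstoMeasure (fun n => gradDensity (u n)) ν) :
    volume.withDensity (gradDensity w) ≤ ν := by
  have hp0 : 0 < p := by linarith
  have hconj := Real.HolderConjugate.conjExponent (show 1 < p by linarith)
  set q := p.conjExponent with hq
  have := isFiniteMeasure_withDensity (D1p.lintegral_gradDensity_ne_top hp w)
  refine measure_le_of_lintegral_cutoff_le fun φ hφ hφc h01 => ?_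
  have hφm : Measurable φ := hφ.measurable
  set H : RN N → RN N := fun x => (φ x * ‖D1p.grad w x‖ ^ (p - 2)) • D1p.grad w x with hH
  have hHm : Measurable H := by fun_prop
  have hqc : (ENNReal.ofReal q).HolderConjugate (ENNReal.ofReal p) := hconj.symm.ennrealOfReal
  have hp1 : Fact (1 ≤ ENNReal.ofReal p) := ⟨ENNReal.one_le_ofReal.2 (by linarith)⟩
  have hq1 : Fact (1 ≤ ENNReal.ofReal q) := ⟨ENNReal.one_le_ofReal.2 hconj.symm.lt.le⟩
  have hHle : ∀ x, ‖H x‖ ≤ ‖D1p.grad w x‖ ^ (p - 1) := by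
    intro x
    simp only [hH]
    rw [norm_smul, norm_mul, Real.norm_of_nonneg (h01 x).1,
      Real.norm_of_nonneg (Real.rpow_nonneg (norm_nonneg _) _)]
    rcases eq_or_ne (D1p.grad w x) 0 with h0 | h0
    · rw [h0, norm_zero, mul_zero]
      positivity
    · have : p - 1 = p - 2 + 1 := by ring
      rw [this, Real.rpow_add_one (norm_ne_zero_iff.2 h0), mul_assoc]
      exact mul_le_of_le_one_left (by positivity) (h01 x).2
  have hHLp : MemLp H (ENNReal.ofReal q) volume := by
    refine ⟨hHm.aestronglyMeasurable, ?_⟩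
    rw [eLpNorm_ofReal_eq hconj.symm.pos]
    refine ENNReal.rpow_lt_top_of_nonneg (by have := hconj.symm.pos; positivity)
      (ne_top_of_le_ne_top (D1p.lintegral_gradDensity_ne_top hp w) (lintegral_mono fun x => ?_))
    have h1 : ‖H x‖ₑ ≤ ‖D1p.grad w x‖ₑ ^ (p - 1) := by
      rw [← ofReal_norm, ← ofReal_norm, ENNReal.ofReal_rpow_of_nonneg (norm_nonneg _) (by linarith)]
      exact ENNReal.ofReal_le_ofReal (hHle x)
    refine (ENNReal.rpow_le_rpow h1 hconj.symm.nonneg).trans_eq ?_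
    have hpq : (p - 1) * q = p := by
      rw [hq, Real.conjExponent]
      have : p - 1 ≠ 0 := by linarith
      field_simp
    rw [← ENNReal.rpow_mul, hpq]
    rfl
  set L : Lp (RN N) (ENNReal.ofReal p) (volume : Measure (RN N)) →L[ℝ] ℝ :=
    (innerSL ℝ).lpPairing volume (ENNReal.ofReal q) (ENNReal.ofReal p) (hHLp.toLp H) with hL
  have hLv : ∀ v : D1p N p, L v.1.2 = ∫ x, inner ℝ (H x) (D1p.grad v x) := by
    intro v
    rw [hL, ContinuousLinearMap.lpPairing_eq_integral]
    refine integral_congr_ae (hHLp.coeFn_toLp.mono fun x hx => ?_)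
    simp only [hx]
    rfl
  have hlim : Tendsto (fun n => L (u n).1.2) atTop (𝓝 (L w.1.2)) :=
    hweak (L.toLinearMap ∘ₗ LinearMap.snd ℝ _ _ ∘ₗ (D1p N p).subtype)
      ⟨‖L‖, fun v => L.le_opNorm v.1.2⟩
  simp only [hLv] at hlim
  have hint : ∀ v : D1p N p, Integrable fun x => ‖D1p.grad v x‖ ^ p := by
    intro v
    have h := (D1p.memLp_grad v).integrable_norm_rpow (ENNReal.ofReal_pos.2 hp0).ne'
      ENNReal.ofReal_ne_top
    rwa [ENNReal.toReal_ofReal hp0.le] at h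
  have hφint : ∀ v : D1p N p, Integrable fun x => φ x * ‖D1p.grad v x‖ ^ p := by
    intro v
    refine (hint v).mono (Measurable.aestronglyMeasurable (by fun_prop)) (ae_of_all _ fun x => ?_)
    rw [norm_mul, Real.norm_of_nonneg (h01 x).1]
    exact mul_le_of_le_one_left (norm_nonneg _) (h01 x).2
  have hinner : ∀ v : D1p N p, Integrable fun x => inner ℝ (H x) (D1p.grad v x) := by
    intro v
    refine (((hint w).const_mul (p - 1)).add (hint v)).mono
      (Measurable.aestronglyMeasurable (by fun_prop)) (ae_of_all _ fun x => ?_)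
    have key : ∀ b : RN N, inner ℝ (H x) b ≤ (p - 1) * ‖D1p.grad w x‖ ^ p + ‖b‖ ^ p := by
      intro b
      have hy := young_inner hp (D1p.grad w x) b
      have e : inner ℝ (H x) b =
          φ x * (‖D1p.grad w x‖ ^ (p - 2) * inner ℝ (D1p.grad w x) b) := by
        simp only [hH, real_inner_smul_left]
        ring
      rw [e]
      set c := ‖D1p.grad w x‖ ^ (p - 2) * inner ℝ (D1p.grad w x) b
      have h0 : 0 ≤ (p - 1) * ‖D1p.grad w x‖ ^ p + ‖b‖ ^ p := by
        have : 0 ≤ p - 1 := by linarith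
        positivity
      rcases le_total c 0 with hc | hc
      · exact (mul_nonpos_of_nonneg_of_nonpos (h01 x).1 hc).trans h0
      · refine (mul_le_of_le_one_left hc (h01 x).2).trans (le_trans ?_ hy)
        nlinarith
    -- The upper bound is even in its argument, so applying it to the opposite vector bounds the
    -- absolute value.
    have h2 := key (-D1p.grad v x)
    rw [inner_neg_right, norm_neg] at h2
    refine le_trans ?_ (le_abs_self _)
    exact abs_le.2 ⟨by simp only [Pi.add_apply]; linarith, key _⟩
  have hdens : ∀ v : D1p N p, ∫ x, φ x ∂(volume.withDensity (gradDensity v)) =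
      ∫ x, φ x * ‖D1p.grad v x‖ ^ p := by
    intro v
    rw [integral_withDensity_eq_integral_toReal_smul (measurable_gradDensity v)
      (ae_of_all _ fun x => ENNReal.rpow_lt_top_of_nonneg hp0.le enorm_ne_top)]
    refine integral_congr_ae (ae_of_all _ fun x => ?_)
    simp only [gradDensity, smul_eq_mul]
    rw [← ENNReal.toReal_rpow, toReal_enorm, mul_comm]
  have hineq : ∀ n, p * ∫ x, inner ℝ (H x) (D1p.grad (u n) x) ≤
      (p - 1) * (∫ x, φ x * ‖D1p.grad w x‖ ^ p) +
        ∫ x, φ x ∂(volume.withDensity (gradDensity (u n))) := by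
    intro n
    rw [hdens, ← integral_const_mul, ← integral_const_mul,
      ← integral_add ((hφint w).const_mul _) (hφint (u n))]
    refine integral_mono ((hinner (u n)).const_mul p)
      (((hφint w).const_mul (p - 1)).add (hφint (u n))) fun x => ?_
    have hy := mul_le_mul_of_nonneg_left
      (young_inner hp (D1p.grad w x) (D1p.grad (u n) x)) (h01 x).1
    simp only [hH, real_inner_smul_left]
    nlinarith
  have hself : ∫ x, inner ℝ (H x) (D1p.grad w x) = ∫ x, φ x * ‖D1p.grad w x‖ ^ p := by
    refine integral_congr_ae (ae_of_all _ fun x => ?_)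
    simp only [hH, real_inner_smul_left, real_inner_self_eq_norm_sq]
    rcases eq_or_ne (D1p.grad w x) 0 with h0 | h0
    · rw [h0, norm_zero, Real.zero_rpow hp0.ne']
      ring
    · have h2 := Real.rpow_add_natCast (norm_ne_zero_iff.2 h0) (p - 2) 2
      rw [show p - 2 + ((2 : ℕ) : ℝ) = p by push_cast; ring] at h2
      rw [h2]
      ring
  have hfinal := le_of_tendsto_of_tendsto' (hlim.const_mul p) ((hν φ hφ hφc).const_add _) hineq
  rw [hself] at hfinal
  have hreal : ∫ x, φ x ∂(volume.withDensity (gradDensity w)) ≤ ∫ x, φ x ∂ν := by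
    rw [hdens]
    linarith
  have hφi : ∀ (m : Measure (RN N)) [IsFiniteMeasure m], Integrable φ m := fun m _ =>
    hφ.integrable_of_hasCompactSupport hφc
  rw [← ofReal_integral_eq_lintegral_ofReal (hφi _) (ae_of_all _ fun x => (h01 x).1),
    ← ofReal_integral_eq_lintegral_ofReal (hφi _) (ae_of_all _ fun x => (h01 x).1)]
  exact ENNReal.ofReal_le_ofReal hreal

/-- A measure dominates the sum of an absolutely continuous measure and of its own atoms. -/
theorem withDensity_add_sum_dirac_le {m : Measure (RN N)} (hN : 0 < N) {g : RN N → ℝ≥0∞}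
    (hg : volume.withDensity g ≤ m) {J : Set ℕ} {z : ℕ → RN N} (hz : Set.InjOn z J) :
    volume.withDensity g + Measure.sum (fun j : J => m {z j} • Measure.dirac (z j)) ≤ m := by
  have hNe : Nonempty (Fin N) := ⟨⟨0, hN⟩⟩
  set D : Set (RN N) := Set.range fun j : J => z j with hD
  have hDc : D.Countable := Set.countable_range _
  -- The atoms form a countable set, null for the density, so the two summands are carried by
  -- disjoint sets and may be compared with `m` separately.
  have hD0 : volume.withDensity g D = 0 :=
    withDensity_absolutelyContinuous _ _ (hDc.measure_zero volume)
  refine Measure.le_iff.2 fun A hA => ?_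
  rw [Measure.add_apply, Measure.sum_apply _ hA]
  have h1 : volume.withDensity g A ≤ m (A \ D) := by
    rw [← measure_sdiff_null hD0]
    exact hg _
  have h2 : ∑' j : J, (m {z j} • Measure.dirac (z j)) A ≤ m (A ∩ D) := by
    have hdisj : Pairwise (Function.onFun Disjoint fun j : J => A ∩ {z j}) := by
      intro i j hij
      refine Set.disjoint_left.2 fun x hx hx' => hij ?_
      exact Subtype.ext (hz i.2 j.2 (hx.2.symm.trans hx'.2))
    refine le_trans (ENNReal.tsum_le_tsum fun j => ?_) ((tsum_measure_le_measure_univ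
      (μ := m.restrict (A ∩ D)) (s := fun j : J => A ∩ {z j})
      (fun j => (hA.inter (measurableSet_singleton _)).nullMeasurableSet)
      (hdisj.mono fun i j h => h.aedisjoint)).trans_eq (Measure.restrict_apply_univ _))
    rw [Measure.smul_apply, Measure.dirac_apply' _ hA, smul_eq_mul,
      Measure.restrict_apply (hA.inter (measurableSet_singleton _))]
    by_cases hj : z j ∈ A
    · rw [Set.indicator_of_mem hj, Pi.one_apply, mul_one]
      refine measure_mono fun x hx => ?_
      rw [Set.mem_singleton_iff.1 hx]
      exact ⟨⟨hj, rfl⟩, hj, j, rfl⟩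
    · rw [Set.indicator_of_notMem hj, mul_zero]
      exact zero_le
  refine (add_le_add h1 h2).trans_eq ?_
  rw [add_comm]
  exact measure_inter_add_sdiff A hDc.measurableSet

end

noncomputable section

variable {N : ℕ}

/-! ### Proof of the concentration-compactness statement -/

theorem D1p.interactionSeq {p β μ : ℝ} (hβ : 0 ≤ β) (hμ : 0 < μ) (hβμ : 2 * β + μ < N)
    (hp : 2 ≤ p) (hpN : p < N) {u : ℕ → D1p N p} {w : D1p N p}
    (hbdd : ∃ M : ℝ, ∀ n, D1p.gradNorm (u n) ≤ M)
    (hae : ∀ᵐ x : RN N, Tendsto (fun n => D1p.fn (u n) x) atTop (𝓝 (D1p.fn w x))) :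
    ∃ M : ℝ≥0∞, InteractionSeq β μ (2 * N / (2 * N - 2 * β - μ))
      (fun n x => ‖D1p.fn (u n) x‖ₑ ^ steinWeissExp N p β μ)
      (fun x => ‖D1p.fn w x‖ₑ ^ steinWeissExp N p β μ) M := by
  obtain ⟨M, hM⟩ := hbdd
  obtain ⟨K, hK, hKb⟩ := D1p.exists_lintegral_sobolevDensity_le (N := N) hp hpN
    (max M (D1p.gradNorm w))
  have hr := steinWeissExp_pos (β := β) (μ := μ) hβμ hp hpN
  exact ⟨K, {
    hβ := hβ
    hμ := hμ
    hβμ := hβμ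
    ht := rfl
    hf := fun n => by fun_prop
    hf' := by fun_prop
    hfin := fun x => ENNReal.rpow_ne_top_of_nonneg hr.le enorm_ne_top
    hae := hae.mono fun x hx => (ENNReal.continuous_rpow_const.tendsto _).comp hx.enorm
    hM := hK.ne
    hfM := fun n => by
      simp only [D1p.lintegral_rpow_rpow hβμ hp hpN rfl]
      exact hKb _ ((hM n).trans (le_max_left _ _))
    hfM' := by
      simp only [D1p.lintegral_rpow_rpow hβμ hp hpN rfl]
      exact hKb _ (le_max_right _ _) }⟩

theorem ENNReal.rpow_neg_mul_le {c x y : ℝ≥0∞} {a : ℝ} (ha : 0 < a) (hc : c ≠ ⊤)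
    (h : x ≤ c ^ a * y) : c ^ (-a) * x ≤ y := by
  -- For `c = 0` the negative power is infinite, but the hypothesis then forces `x = 0`.
  rcases eq_or_ne c 0 with rfl | h0
  · rw [ENNReal.zero_rpow_of_pos ha, zero_mul] at h
    rw [le_antisymm h zero_le, mul_zero]
    exact zero_le
  · calc c ^ (-a) * x ≤ c ^ (-a) * (c ^ a * y) := mul_le_mul' le_rfl h
      _ = y := by rw [← mul_assoc, ← ENNReal.rpow_add _ _ h0 hc, neg_add_cancel, ENNReal.rpow_zero,
          one_mul]

theorem lemma3p3 (N : ℕ) (p β μ : ℝ) (hβ : 0 ≤ β) (hμ : 0 < μ) (hβμ : 2 * β + μ < N)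
    (hp : 2 ≤ p) (hpN : p < N)
    (u : ℕ → D1p N p) (w : D1p N p)
    (hbdd : ∃ M : ℝ, ∀ n, D1p.gradNorm (u n) ≤ M)
    (hweak : D1p.WeakTendsto u w)
    (hae : ∀ᵐ x : RN N, Tendsto (fun n => D1p.fn (u n) x) atTop (𝓝 (D1p.fn w x)))
    (ν ω ζ : Measure (RN N)) [IsFiniteMeasure ν] [IsFiniteMeasure ω] [IsFiniteMeasure ζ]
    (hω : TendstoMeasure (fun n => sobolevDensity (u n)) ω)
    (hν : TendstoMeasure (fun n => gradDensity (u n)) ν)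
    (hζ : TendstoMeasure (fun n => steinWeissDensity β μ (u n)) ζ)
    (νinf ωinf ζinf : ℝ≥0∞)
    (hνinf : νinf = massAtInfinity (fun n => gradDensity (u n)))
    (hωinf : ωinf = massAtInfinity (fun n => sobolevDensity (u n)))
    (hζinf : ζinf = massAtInfinity (fun n => steinWeissDensity β μ (u n))) :
    steinWeissConst N β μ < ⊤ ∧
    (∃ (J : Set ℕ) (z : ℕ → RN N) (ωa ζa νa : ℕ → ℝ≥0),
      Set.InjOn z J ∧ (∀ j ∈ J, 0 < ωa j ∧ 0 < ζa j ∧ 0 < νa j) ∧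
      ζ = volume.withDensity (steinWeissDensity β μ w) +
        Measure.sum (fun j : J => (ζa j : ℝ≥0∞) • Measure.dirac (z j)) ∧
      ∑' j : J, (ζa j : ℝ≥0∞) ^ (p / (2 * steinWeissExp N p β μ)) < ⊤ ∧
      volume.withDensity (gradDensity w) +
        Measure.sum (fun j : J => (νa j : ℝ≥0∞) • Measure.dirac (z j)) ≤ ν ∧
      volume.withDensity (sobolevDensity w) +
        Measure.sum (fun j : J => (ωa j : ℝ≥0∞) • Measure.dirac (z j)) ≤ ω ∧
      (∀ j ∈ J,
        steinWeissSobolevConst N p β μ * (ζa j : ℝ≥0∞) ^ (p / (2 * steinWeissExp N p β μ))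
          ≤ νa j ∧
        (ζa j : ℝ≥0∞) ^ ((N : ℝ) / (2 * N - 2 * β - μ))
          ≤ steinWeissConst N β μ ^ ((N : ℝ) / (2 * N - 2 * β - μ)) * ωa j)) ∧
    limsup (fun n => ∫⁻ x, gradDensity (u n) x) atTop = νinf + ν Set.univ ∧
    limsup (fun n => ∫⁻ x, sobolevDensity (u n) x) atTop = ωinf + ω Set.univ ∧
    limsup (fun n => ∫⁻ x, steinWeissDensity β μ (u n) x) atTop = ζinf + ζ Set.univ ∧
    steinWeissConst N β μ ^ (-(2 * (N : ℝ) / (2 * N - 2 * β - μ))) *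
        ζinf ^ (2 * (N : ℝ) / (2 * N - 2 * β - μ))
      ≤ ωinf * (ω Set.univ + ωinf) ∧
    sobolevConst N p ^ (2 : ℝ) *
        steinWeissConst N β μ ^ (-(p / steinWeissExp N p β μ)) *
        ζinf ^ (p / steinWeissExp N p β μ)
      ≤ νinf * (ν Set.univ + νinf) := by
  obtain ⟨M, hI⟩ := D1p.interactionSeq hβ hμ hβμ hp hpN hbdd hae
  have hp0 : 0 < p := by linarith
  have hN : 0 < N := by
    have : (0 : ℝ) < N := by linarith
    exact_mod_cast this
  have hNe : Nonempty (Fin N) := ⟨⟨0, hN⟩⟩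
  have hps := sobolevExp_pos hp hpN
  have hr := steinWeissExp_pos (β := β) (μ := μ) hβμ hp hpN
  have hrt := steinWeissExp_mul (β := β) (μ := μ) hβμ hp hpN
  set t : ℝ := 2 * N / (2 * N - 2 * β - μ) with ht
  set r := steinWeissExp N p β μ with hrd
  set C := steinWeissConst N β μ with hC
  have hCt : C < ⊤ := steinWeissConst_lt_top hβ hμ hβμ
  have ht1 : 1 < t := hI.one_lt
  have ht2 : t < 2 := hI.lt_two
  have ht0 : 0 < t := one_pos.trans ht1
  have hsob : ∀ v : D1p N p, (fun x => (‖D1p.fn v x‖ₑ ^ r) ^ t) = sobolevDensity v := fun v =>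
    funext (D1p.lintegral_rpow_rpow hβμ hp hpN ht v)
  have hsobs : (fun n x => (‖D1p.fn (u n) x‖ₑ ^ r) ^ t) = fun n => sobolevDensity (u n) :=
    funext fun n => hsob (u n)
  have hω' : TendstoMeasure (fun n x => (‖D1p.fn (u n) x‖ₑ ^ r) ^ t) ω := by
    rw [hsobs]
    exact hω
  have hgfin := fun n => D1p.lintegral_gradDensity_ne_top hp (u n)
  have hsfin := fun n => D1p.lintegral_sobolevDensity_ne_top hp hpN (u n)
  have hzfin := fun n => D1p.lintegral_steinWeissDensity_ne_top hβ hμ hβμ hp hpN (u n)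
  have hgm := fun n => measurable_gradDensity (u n)
  have hsm := fun n => measurable_sobolevDensity (u n)
  have hzm := fun n => measurable_steinWeissDensity β μ (u n)
  have hlimν := hν.limsup_lintegral hgm hgfin
  have hlimω := hω.limsup_lintegral hsm hsfin
  have hlimζ := hζ.limsup_lintegral hzm hzfin
  rw [← hνinf] at hlimν
  rw [← hωinf] at hlimω
  rw [← hζinf] at hlimζ
  have hinf : ζinf ^ t ≤ C ^ t * (ωinf * (ωinf + ω Set.univ)) := by
    have h := hI.massAtInfinity_rpow_le hω'
    beta_reduce at h
    rw [hsobs] at h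
    rw [hζinf, hωinf]
    exact h
  refine ⟨hCt, ?_, hlimν, hlimω, hlimζ, ?_, ?_⟩
  · have hνac := withDensity_gradDensity_le hp hweak hν
    have hωac : volume.withDensity (sobolevDensity w) ≤ ω :=
      hω.withDensity_le hsm hsfin (measurable_sobolevDensity w)
        (D1p.lintegral_sobolevDensity_ne_top hp hpN w) (hae.mono fun x hx =>
          (((ENNReal.continuous_rpow_const.tendsto _).comp hx.enorm).liminf_eq).ge)
    have hζac : volume.withDensity (steinWeissDensity β μ w) ≤ ζ :=
      hζ.withDensity_le hzm hzfin (measurable_steinWeissDensity β μ w)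
        (D1p.lintegral_steinWeissDensity_ne_top hβ hμ hβμ hp hpN w) hI.ae_le_liminf_density
    have hFfin := isFiniteMeasure_withDensity
      (D1p.lintegral_steinWeissDensity_ne_top hβ hμ hβμ hp hpN w)
    have hσfin := isFiniteMeasure_withDensity (D1p.lintegral_sobolevDensity_ne_top hp hpN w)
    set F := volume.withDensity (steinWeissDensity β μ w) with hF
    set σ := volume.withDensity (sobolevDensity w) with hσ
    -- The defect measure. Domination of `F` by `ζ` makes this truncated subtraction a genuine
    -- decomposition.
    set κ := ζ - F with hκ
    have hsum : ζ = F + κ := by rw [hκ, add_comm, Measure.sub_add_cancel_of_le hζac]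
    have hκfin : IsFiniteMeasure κ := ⟨(Measure.sub_le Set.univ).trans_lt (measure_lt_top ζ _)⟩
    have hKU : ∀ K U, IsCompact K → IsOpen U → K ⊆ U → κ K ≤ C * (ω + σ) U ^ (2 / t) := by
      intro K U hK hU hKU
      have h := hI.measure_le_of_eq_add hω' hζ hsum hK hU hKU
      rw [hsob] at h
      exact h
    have hbound : ∀ A, MeasurableSet A → κ A ≤ C * (ω + σ) A ^ (2 / t) := fun A hA =>
      measure_le_const_mul_rpow hCt.ne (by positivity) hKU hA
    -- The exponent `2 / t` exceeds one because `2β + μ > 0`, that is, `t < 2`.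
    obtain ⟨J, z, hz, hpos, hsumκ⟩ := exists_eq_sum_dirac hCt.ne
      (by rwa [one_lt_div ht0]) hbound
    have hF0 : ∀ x, F {x} = 0 := fun x => withDensity_absolutelyContinuous _ _ (measure_singleton x)
    have hσ0 : ∀ x, σ {x} = 0 := fun x => withDensity_absolutelyContinuous _ _ (measure_singleton x)
    have hκζ : ∀ x, κ {x} = ζ {x} := fun x => by
      rw [hsum, Measure.add_apply, hF0, zero_add]
    have hνj : ∀ x, steinWeissSobolevConst N p β μ * κ {x} ^ (p / (2 * r)) ≤ ν {x} := fun x => by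
      rw [hκζ]
      exact steinWeissSobolevConst_mul_atom_le hp hpN hbdd hae hI hν hζ x
    have hωj : ∀ x, κ {x} ^ ((N : ℝ) / (2 * N - 2 * β - μ)) ≤
        C ^ ((N : ℝ) / (2 * N - 2 * β - μ)) * ω {x} := by
      intro x
      have h := hbound {x} (measurableSet_singleton x)
      have ht' : (N : ℝ) / (2 * N - 2 * β - μ) = t / 2 := by rw [ht]; ring
      rw [Measure.add_apply, hσ0, add_zero] at h
      rw [ht']
      refine (ENNReal.rpow_le_rpow h (by positivity)).trans_eq ?_
      rw [ENNReal.mul_rpow_of_nonneg _ _ (by positivity), ← ENNReal.rpow_mul,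
        div_mul_div_cancel₀ ht0.ne', div_self two_ne_zero, ENNReal.rpow_one]
    have hS0 := steinWeissSobolevConst_pos hβ hμ hβμ hp hpN
    -- The weights are the full point masses of the three measures at the atoms of `κ`; those of `ω`
    -- and `ν` are positive because they control the positive mass of `κ`.
    refine ⟨J, z, fun j => (ω {z j}).toNNReal, fun j => (κ {z j}).toNNReal,
      fun j => (ν {z j}).toNNReal, hz, fun j hj => ?_, ?_⟩
    · have hκ0 : 0 < κ {z j} := pos_iff_ne_zero.2 (hpos j hj)
      have hD : 0 < 2 * (N : ℝ) - 2 * β - μ := by linarith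
      refine ⟨ENNReal.toNNReal_pos ?_ (measure_ne_top _ _),
        ENNReal.toNNReal_pos hκ0.ne' (measure_ne_top _ _),
        ENNReal.toNNReal_pos ?_ (measure_ne_top _ _)⟩
      · intro h0
        have h := hωj (z j)
        rw [h0, mul_zero] at h
        exact absurd h (not_le.2 (ENNReal.rpow_pos hκ0 (measure_ne_top _ _)))
      · intro h0
        have h := hνj (z j)
        rw [h0] at h
        exact absurd h (not_le.2 (ENNReal.mul_pos hS0.ne'
          (ENNReal.rpow_pos hκ0 (measure_ne_top _ _)).ne'))
    · simp only [ENNReal.coe_toNNReal (measure_ne_top _ _)]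
      have hνsum := withDensity_add_sum_dirac_le hN hνac hz
      refine ⟨by rw [← hsumκ]; exact hsum, ?_, hνsum, withDensity_add_sum_dirac_le hN hωac hz,
        fun j _ => ⟨hνj _, hωj _⟩⟩
      have h1 : ∑' j : J, ν {z j} ≤ ν Set.univ := by
        have h2 := (Measure.le_iff'.1 hνsum) Set.univ
        rw [Measure.add_apply, Measure.sum_apply _ .univ] at h2
        refine le_trans (le_of_eq ?_) (le_add_self.trans h2)
        exact tsum_congr fun j => by simp
      -- Summing the atomic inequality bounds the series by the finite mass of `ν`, and `S_{β,μ} >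
      -- 0` then removes the factor.
      have h2 : steinWeissSobolevConst N p β μ * ∑' j : J, κ {z j} ^ (p / (2 * r)) < ⊤ := by
        rw [← ENNReal.tsum_mul_left]
        exact ((ENNReal.tsum_le_tsum fun j => hνj _).trans h1).trans_lt (measure_lt_top _ _)
      exact lt_top_iff_ne_top.2 fun h => h2.ne (by rw [h, ENNReal.mul_top hS0.ne'])
  · rw [add_comm (ω Set.univ)]
    exact ENNReal.rpow_neg_mul_le ht0 hCt.ne hinf
  · have hS1 : sobolevConst N p * ωinf ^ (p / sobolevExp N p) ≤ νinf := by
      rw [hωinf, hνinf]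
      exact sobolevConst_mul_massAtInfinity_le hp hpN hbdd hae
    have hS2 := sobolevConst_mul_limsup_le hp hpN u
    rw [hlimω, hlimν] at hS2
    have hq0 : 0 < p / sobolevExp N p := by positivity
    have hexp : t * (p / sobolevExp N p) = p / r := by
      rw [← hrt]
      field_simp
    -- The power `p / p^*` turns the exponent `t` into `p / r`, and each factor on the right becomes
    -- the Sobolev power that `hS1` or `hS2` bounds. Each uses one factor of `S`, hence `S^2`.
    have h := ENNReal.rpow_le_rpow hinf hq0.le
    rw [← ENNReal.rpow_mul, hexp, ENNReal.mul_rpow_of_nonneg _ _ hq0.le, ← ENNReal.rpow_mul, hexp,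
      ENNReal.mul_rpow_of_nonneg _ _ hq0.le] at h
    have h2 := ENNReal.rpow_neg_mul_le (by positivity) hCt.ne h
    rw [mul_assoc, add_comm (ν Set.univ)]
    calc sobolevConst N p ^ (2 : ℝ) * (C ^ (-(p / r)) * ζinf ^ (p / r))
        ≤ sobolevConst N p ^ (2 : ℝ) * (ωinf ^ (p / sobolevExp N p) *
            (ωinf + ω Set.univ) ^ (p / sobolevExp N p)) := mul_le_mul' le_rfl h2
      _ = (sobolevConst N p * ωinf ^ (p / sobolevExp N p)) *
            (sobolevConst N p * (ωinf + ω Set.univ) ^ (p / sobolevExp N p)) := by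
          rw [ENNReal.rpow_two]
          ring
      _ ≤ _ := mul_le_mul' hS1 hS2

end
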